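/- Let $K\ge 2$ be an integer, let $\mathcal T$ be the vertex set of the rooted tree in which every vertex has exactly $K$ children (root $0$), and let $T$ be its adjacency operator on $\ell^2(\mathcal T)$, $(T\psi)(x)=\sum_{\mathrm{dist}(x,y)=1}\psi(y)$. Let $\{V(x)\}_{x\in\mathcal T}$ be independent identically distributed real random variables with distribution $\varrho(v)\,dv$, where * $\varrho\in L^\infty(\mathbb R)$ and $\int|v|^{\varsigma}\varrho(v)\,dv<\infty$ for some $\varsigma\in(0,1)$; * there is a finite constant $c$ with $\varrho(v)\le c\,M(v)$ for Lebesgue-almost all $v$, where $M(v):=\inf_{\nu\in(0,1]}(2\nu)^{-1}\int \mathbf 1_{|x-v|\le\nu}\,\varrho(x)\,dx$; * $\operatorname{supp}\varrho=[-1,1]$ (the support of the measure $\varrho(v)\,dv$). For $\lambda\ge0$ let $H_\lambda=T+\lambda V$, let $G_\lambda(x,y;\zeta)=\langle\delta_x,(H_\lambda-\zeta)^{-1}\delta_y\rangle$ for $\operatorname{Im}\zeta>0$, let $G_\lambda(0,0;E+i0)=\lim_{\eta\downarrow0}G_\lambda(0,0;E+i\eta)$, and let $$L_\lambda(E):=-\mathbb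 E\big[\log|G_\lambda(0,0;E+i0)|\big].$$ We say that $L_\lambda(E)$ is well defined if this limit almost surely exists, is finite and is nonzero, and $\log|G_\lambda(0,0;E+i0)|$ is integrable. Put $E_\lambda:=-2\sqrt K-\lambda$ (almost surely, $E_\lambda=\inf\sigma(H_\lambda)$). Then for every $\lambda>0$: $L_\lambda(E)$ is well defined for Lebesgue-almost every $E\in\mathbb R$, $L_0(E_\lambda-\lambda)$ is well defined, and $$\limsup_{E\downarrow E_\lambda}L_\lambda(E)\ \le\ L_0(E_\lambda-\lambda),$$ where the limsup is taken over the energies $E>E_\lambda$ at which $L_\lambda(E)$ is well defined. -/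

import Mathlib

open scoped Topology ENNReal

noncomputable section

namespace TreeAnderson

/-- Vertices of the rooted tree with branching number `K`: a vertex is the word of the choices
made on the way from the root (the empty word `[]`), the last choice first; the children of `x`
are `a :: x` for `a : Fin K`. -/
abbrev Vertex (K : ℕ) : Type := List (Fin K)

/-- The rooted tree with branching number `K`: `x` and `y` are joined by an edge iff one of them
is a child of the other. -/
def tree (K : ℕ) : SimpleGraph (Vertex K) where
  Adj x y := (∃ a, y = a :: x) ∨ (∃ a, x = a :: y)
  symm := ⟨fun _ _ h => h.symm⟩
  loopless := ⟨by
    rintro x (⟨a, h⟩ | ⟨a, h⟩) <;>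
      · have := congrArg List.length h
        simp at this⟩

theorem neighborSet_nil {K : ℕ} :
    (tree K).neighborSet [] = Set.range (fun a : Fin K => [a]) := by
  ext y
  simp [tree, SimpleGraph.mem_neighborSet, eq_comm]

theorem neighborSet_cons {K : ℕ} (b : Fin K) (t : Vertex K) :
    (tree K).neighborSet (b :: t) =
      insert t (Set.range (fun a : Fin K => a :: b :: t)) := by
  ext y
  simp only [tree, SimpleGraph.mem_neighborSet, Set.mem_insert_iff, Set.mem_range,
    List.cons.injEq]
  constructor
  · rintro (⟨a, rfl⟩ | ⟨a, h⟩)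
    · exact Or.inr ⟨a, rfl⟩
    · exact Or.inl h.2.symm
  · rintro (rfl | ⟨a, rfl⟩)
    · exact Or.inr ⟨b, rfl, rfl⟩
    · exact Or.inl ⟨a, rfl⟩

instance instLocallyFinite (K : ℕ) : (tree K).LocallyFinite := fun x =>
  Set.Finite.fintype (by
    cases x with
    | nil => rw [neighborSet_nil]; exact Set.finite_range _
    | cons b t => rw [neighborSet_cons]; exact (Set.finite_range _).insert _)

/-- The Hilbert space `ℓ²(𝒯)` of square-summable complex functions on the vertices. -/
abbrev Hil (K : ℕ) : Type := lp (fun _ : Vertex K => ℂ) 2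

/-- The Kronecker function `δ_x ∈ ℓ²(𝒯)`. -/
def delta {K : ℕ} (x : Vertex K) : Hil K := lp.single 2 x (1 : ℂ)

/-- The adjacency action `(Tψ)(x) = ∑_{dist(x,y) = 1} ψ(y)`, as a function on the vertices. -/
def adjFun {K : ℕ} (ψ : Vertex K → ℂ) (x : Vertex K) : ℂ :=
  ∑ y ∈ (tree K).neighborFinset x, ψ y

theorem adjFun_nil {K : ℕ} (ψ : Vertex K → ℂ) : adjFun ψ [] = ∑ a : Fin K, ψ [a] := by
  classical
  have h : (tree K).neighborFinset [] = Finset.univ.image (fun a : Fin K => [a]) := by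
    ext y
    rw [SimpleGraph.mem_neighborFinset, ← SimpleGraph.mem_neighborSet, neighborSet_nil]
    simp
  rw [adjFun, h, Finset.sum_image]
  intro a _ b _ hab
  simpa using hab

theorem adjFun_cons {K : ℕ} (ψ : Vertex K → ℂ) (b : Fin K) (t : Vertex K) :
    adjFun ψ (b :: t) = ψ t + ∑ a : Fin K, ψ (a :: b :: t) := by
  classical
  have h : (tree K).neighborFinset (b :: t) =
      insert t (Finset.univ.image (fun a : Fin K => a :: b :: t)) := by
    ext y
    rw [SimpleGraph.mem_neighborFinset, ← SimpleGraph.mem_neighborSet, neighborSet_cons]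
    simp
  rw [adjFun, h, Finset.sum_insert, Finset.sum_image]
  · intro a _ c _ hac
    simpa using hac
  · simp only [Finset.mem_image, Finset.mem_univ, true_and, not_exists]
    intro a ha
    have := congrArg List.length ha
    simp only [List.length_cons] at this
    omega

/-- `ψ` transported to the `b`-th branch: `x ↦ ψ(t)` if `x = b :: t`, and `0` otherwise. -/
def branchFun {K : ℕ} (ψ : Vertex K → ℂ) (b : Fin K) : Vertex K → ℂ
  | [] => 0
  | c :: t => if c = b then ψ t else 0

theorem adjFun_eq {K : ℕ} (ψ : Vertex K → ℂ) :
    adjFun ψ = ∑ b : Fin K, (branchFun ψ b + fun x => ψ (b :: x)) := by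
  funext x
  cases x with
  | nil => simp [adjFun_nil, branchFun, Finset.sum_apply]
  | cons c t =>
    simp [adjFun_cons, branchFun, Finset.sum_apply, Finset.sum_add_distrib]

/-- The adjacency operator maps `ℓ²(𝒯)` to itself. -/
theorem memℓp_adjFun {K : ℕ} {ψ : Vertex K → ℂ} (hψ : Memℓp ψ 2) : Memℓp (adjFun ψ) 2 := by
  have h2 : 0 < (2 : ℝ≥0∞).toReal := by norm_num
  have hs := hψ.summable h2
  have hinj : ∀ b : Fin K, Function.Injective (fun x : Vertex K => b :: x) := fun b x y h => by
    simpa using h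
  have h1 : ∀ b : Fin K, Memℓp (branchFun ψ b) 2 := fun b => by
    refine memℓp_gen ?_
    rw [← (hinj b).summable_iff]
    · simpa only [Function.comp_def, branchFun, if_true] using hs
    · rintro (_ | ⟨c, t⟩) hx
      · simp [branchFun]
      · have hc : c ≠ b := by
          rintro rfl
          exact hx ⟨t, rfl⟩
        simp [branchFun, hc]
  have h3 : ∀ b : Fin K, Memℓp (fun x : Vertex K => ψ (b :: x)) 2 := fun b =>
    memℓp_gen (hs.comp_injective (hinj b))
  have h4 : ∀ s : Finset (Fin K),
      Memℓp (∑ b ∈ s, (branchFun ψ b + fun x => ψ (b :: x))) 2 := by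
    intro s
    induction s using Finset.induction_on with
    | empty =>
      rw [Finset.sum_empty]
      exact zero_memℓp
    | insert b s hb ih =>
      rw [Finset.sum_insert hb]
      exact Memℓp.add (Memℓp.add (h1 b) (h3 b)) ih
  rw [adjFun_eq]
  exact h4 _

/-- The random Schrödinger operator `H = T + lam V` for one real potential `v` (bounded or not):
`(Hψ)(x) = (Tψ)(x) + lam v(x) ψ(x)`, on the domain of all `ψ ∈ ℓ²(𝒯)` for which
`lam v ψ ∈ ℓ²(𝒯)`. As `T` is bounded, this is the usual self-adjoint realization. -/
def hamiltonian {K : ℕ} (lam : ℝ) (v : Vertex K → ℝ) : Hil K →ₗ.[ℂ] Hil K where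
  domain :=
    { carrier := {ψ | Memℓp (fun x => ((lam * v x : ℝ) : ℂ) * ψ x) 2}
      zero_mem' := by
        have : (fun x => ((lam * v x : ℝ) : ℂ) * (0 : Hil K) x) = 0 := by
          funext x
          simp
        simp only [Set.mem_ofPred_eq, this]
        exact zero_memℓp
      add_mem' := fun {φ ψ} hφ hψ => by
        have : (fun x => ((lam * v x : ℝ) : ℂ) * (φ + ψ : Hil K) x) =
            (fun x => ((lam * v x : ℝ) : ℂ) * φ x) +
              fun x => ((lam * v x : ℝ) : ℂ) * ψ x := by
          funext x
          simp [mul_add]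
        simp only [Set.mem_ofPred_eq, this]
        exact Memℓp.add hφ hψ
      smul_mem' := fun c ψ hψ => by
        have : (fun x => ((lam * v x : ℝ) : ℂ) * (c • ψ : Hil K) x) =
            c • (fun x => ((lam * v x : ℝ) : ℂ) * ψ x) := by
          funext x
          simp only [lp.coeFn_smul, Pi.smul_apply, smul_eq_mul]
          ring
        simp only [Set.mem_ofPred_eq, this]
        exact Memℓp.const_smul hψ c }
  toFun :=
    { toFun := fun ψ =>
        ⟨fun x => adjFun ψ.1 x + ((lam * v x : ℝ) : ℂ) * ψ.1 x,
          Memℓp.add (memℓp_adjFun (lp.memℓp ψ.1)) ψ.2⟩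
      map_add' := fun φ ψ => by
        apply lp.ext
        funext x
        simp only [adjFun, Submodule.coe_add, lp.coeFn_add, Pi.add_apply,
          Finset.sum_add_distrib]
        ring
      map_smul' := fun c ψ => by
        apply lp.ext
        funext x
        simp only [adjFun, Submodule.coe_smul, lp.coeFn_smul, Pi.smul_apply, smul_eq_mul,
          RingHom.id_apply, ← Finset.mul_sum]
        ring }

/-- `R` is the resolvent `(A - ζ)⁻¹`: a bounded, everywhere defined two-sided inverse of
`A - ζ : dom A → E`. -/
def IsResolvent {E : Type*} [NormedAddCommGroup E] [NormedSpace ℂ E]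
    (A : E →ₗ.[ℂ] E) (ζ : ℂ) (R : E →L[ℂ] E) : Prop :=
  (∀ φ : E, ∃ h : R φ ∈ A.domain, A ⟨R φ, h⟩ - ζ • R φ = φ) ∧
    ∀ ψ : A.domain, R (A ψ - ζ • (ψ : E)) = ψ

open Classical in
/-- The resolvent `(A - ζ)⁻¹` (by convention `0` if `ζ` is in the spectrum of `A`). -/
def resolventOp {E : Type*} [NormedAddCommGroup E] [NormedSpace ℂ E]
    (A : E →ₗ.[ℂ] E) (ζ : ℂ) : E →L[ℂ] E :=
  if h : ∃ R, IsResolvent A ζ R then h.choose else 0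

/-- The Green function `G_lam(x, y; ζ) = ⟨δ_x, (H_lam - ζ)⁻¹ δ_y⟩`. -/
def green {K : ℕ} (lam : ℝ) (v : Vertex K → ℝ) (x y : Vertex K) (ζ : ℂ) : ℂ :=
  inner ℂ (delta x) (resolventOp (hamiltonian lam v) ζ (delta y))

/-- The boundary value `G_lam(x, y; E + i0) = lim_{η ↓ 0} G_lam(x, y; E + iη)`
(meaningful where that limit exists). -/
def greenBoundary {K : ℕ} (lam : ℝ) (v : Vertex K → ℝ) (x y : Vertex K) (E : ℝ) : ℂ :=
  Filter.limUnder (𝓝[>] (0 : ℝ)) fun η : ℝ => green lam v x y (E + η * Complex.I)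

variable {Ω : Type*} [MeasurableSpace Ω]

/-- The Lyapunov exponent `L_lam(E) = -𝔼 (log |G_lam(0, 0; E + i0)|)` of the random potential `V`
(meaningful at the energies where `LyapunovDefined` holds). -/
def lyapunov {K : ℕ} (P : MeasureTheory.Measure Ω) (V : Vertex K → Ω → ℝ) (lam E : ℝ) : ℝ :=
  -∫ ω, Real.log ‖greenBoundary lam (fun x => V x ω) [] [] E‖ ∂P

/-- The formula for `L_lam(E)` makes sense: almost surely the limit `G_lam(0, 0; E + i0)` exists,
is finite and does not vanish, and the logarithm of its modulus is integrable. -/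
def LyapunovDefined {K : ℕ} (P : MeasureTheory.Measure Ω) (V : Vertex K → Ω → ℝ)
    (lam E : ℝ) : Prop :=
  (∀ᵐ ω ∂P, ∃ g : ℂ, g ≠ 0 ∧
    Filter.Tendsto (fun η : ℝ => green lam (fun x => V x ω) [] [] (E + η * Complex.I))
      (𝓝[>] (0 : ℝ)) (𝓝 g)) ∧
  MeasureTheory.Integrable
    (fun ω => Real.log ‖greenBoundary lam (fun x => V x ω) [] [] E‖) P

/-- The probability measure `ϱ(v) dv` on the line with density `ϱ`. -/
def densityMeasure (ϱ : ℝ → ℝ) : MeasureTheory.Measure ℝ :=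
  MeasureTheory.volume.withDensity fun v => ENNReal.ofReal (ϱ v)

/-- The minimal function `M(v) = inf_{ν ∈ (0,1]} (2ν)⁻¹ ∫ 1_{|x - v| ≤ ν} ϱ(x) dx`. -/
def minimalFunction (ϱ : ℝ → ℝ) (v : ℝ) : ℝ :=
  ⨅ ν : Set.Ioc (0 : ℝ) 1, (2 * (ν : ℝ))⁻¹ * ∫ x in {x : ℝ | |x - v| ≤ (ν : ℝ)}, ϱ x

/-- The potential `V` consists of independent identically distributed random variables whose
common distribution is `ϱ(v) dv`, with an (essentially) bounded density `ϱ` that has a finite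
moment of some order in `(0,1)` and is dominated by a multiple of its minimal function. -/
structure IsAdmissiblePotential {K : ℕ} (P : MeasureTheory.Measure Ω) (V : Vertex K → Ω → ℝ)
    (ϱ : ℝ → ℝ) : Prop where
  measurable : ∀ x, Measurable (V x)
  indep : ProbabilityTheory.iIndepFun V P
  density_nonneg : ∀ᵐ v : ℝ, 0 ≤ ϱ v
  density_bounded : MeasureTheory.MemLp ϱ ∞ MeasureTheory.volume
  law : ∀ x, P.map (V x) = densityMeasure ϱ
  moment : ∃ s ∈ Set.Ioo (0 : ℝ) 1, MeasureTheory.Integrable (fun v : ℝ => |v| ^ s * ϱ v)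
  regular : ∃ c : ℝ, ∀ᵐ v : ℝ, ϱ v ≤ c * minimalFunction ϱ v

/-- `E_lam = -2√K - lam`, which is the almost sure infimum of the spectrum of `H_lam` for
potentials whose single-site distribution has support `[-1, 1]`. -/
def bottomEnergy (K : ℕ) (lam : ℝ) : ℝ := -2 * Real.sqrt K - lam

end TreeAnderson

end

namespace TreeAnderson

open MeasureTheory Filter

variable {K : ℕ}

/-! ### Truncated Green functions and the law of the potential -/

/-! Write `G_n(z)` for the root Green function of the tree cut off after `n` generations. It
satisfies `G_{n+1} = 1 / (λV(0) - z - ∑ G_n(child))` and converges to the true `G(z)` for `Im z > 0`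
(`tendsto_truncGreen`).

At a fixed depth the inequality is deterministic. At real `E` slightly above `E_λ` the `G_n` of
bounded depth are real, and since `V ≤ 1` and `E > E_λ` they are at least the truncations of the
free Green function at `E_λ - λ` (`freeTrunc_le_truncGreen`). The latter converge to the free Green
function as the depth grows, so `-log G_n` is at most about `L_0(E_λ - λ)` for large `n`.

What has to be shown is that `G` stays close to `G_m` for one deep `m`, uniformly as `E ↓ E_λ` and
`η ↓ 0`, although `E` lies in the range of the spectrum and no deterministic bound survives at
infinite depth. Closeness is measured by the moment `𝔼|G_n - G_m|^s` with `s < 1`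
(`exists_truncDist_le`). The difference is propagated through the recursion with the weight `1/|1 -
βG_n|`, where `β` is the coupling of the root to its exterior. One generation replaces `β` by
another coupling of the same kind. It multiplies the moment by about `K · K^{-s/2} · 𝔼(√K +
λ(V+1))^{-s}`, which is below `1` for `s` near `1` because `V` is not concentrated at `-1`. This
requires the sibling branches to obey the edge bounds of depth `m`. They fail with probability
`O(𝔼|G_n - G_m|^s)`, and then an a priori moment bound costs the same factor again, so the total
error is quadratic (`childTerm_lintegral_le`). Starting from a small deterministic distance at
bounded depths, the smallness propagates to all `n`.

For almost every `E` the exponent is well defined by a Fatou theorem for the Cayley transform of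
`G`, which is bounded and analytic, together with fractional moments of `G` and `1/G`. These exclude
the boundary values `∞` and `0` and make `log|G|` integrable. The distance estimate enters the final
bound through `neg_log_norm_le`. -/

/-- The potential seen from the child `a` of the root. -/
def childPot (v : Vertex K → ℝ) (a : Fin K) : Vertex K → ℝ := fun t => v (t ++ [a])

/-- The Green function at the root of the tree truncated to the first `n` generations. -/
noncomputable def truncGreen (lam : ℝ) (z : ℂ) : ℕ → (Vertex K → ℝ) → ℂ
  | 0, _ => 0
  | n + 1, v => ((lam * v [] : ℝ) - z - ∑ a, truncGreen lam z n (childPot v a))⁻¹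

theorem truncGreen_zero (lam : ℝ) (z : ℂ) (v : Vertex K → ℝ) : truncGreen lam z 0 v = 0 := rfl

theorem truncGreen_succ (lam : ℝ) (z : ℂ) (n : ℕ) (v : Vertex K → ℝ) :
    truncGreen lam z (n + 1) v =
      ((lam * v [] : ℝ) - z - ∑ a, truncGreen lam z n (childPot v a))⁻¹ := rfl

theorem inv_im_nonneg {w : ℂ} (hw : w.im ≤ 0) : 0 ≤ (w⁻¹).im := by
  rw [Complex.inv_im]
  exact div_nonneg (by linarith) (Complex.normSq_nonneg w)

theorem truncGreen_im_nonneg (lam : ℝ) {z : ℂ} (hz : 0 ≤ z.im) (n : ℕ) (v : Vertex K → ℝ) :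
    0 ≤ (truncGreen lam z n v).im := by
  induction n generalizing v with
  | zero => simp [truncGreen_zero]
  | succ n ih =>
    rw [truncGreen_succ]
    apply inv_im_nonneg
    have : 0 ≤ ∑ a, (truncGreen lam z n (childPot v a)).im := Finset.sum_nonneg fun a _ => ih _
    simp only [Complex.sub_im, Complex.ofReal_im, Complex.im_sum]
    linarith

theorem denom_im_neg (lam : ℝ) {z : ℂ} (hz : 0 < z.im) (n : ℕ) (v : Vertex K → ℝ) :
    (((lam * v [] : ℝ) : ℂ) - z - ∑ a, truncGreen lam z n (childPot v a)).im < 0 := by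
  have : 0 ≤ ∑ a, (truncGreen lam z n (childPot v a)).im :=
    Finset.sum_nonneg fun a _ => truncGreen_im_nonneg lam hz.le n _
  simp only [Complex.sub_im, Complex.ofReal_im, Complex.im_sum]
  linarith

theorem ne_zero_of_im_neg {w : ℂ} (h : w.im < 0) : w ≠ 0 := by
  rintro rfl
  simp at h

theorem truncGreen_succ_ne_zero (lam : ℝ) {z : ℂ} (hz : 0 < z.im) (n : ℕ) (v : Vertex K → ℝ) :
    truncGreen lam z (n + 1) v ≠ 0 := by
  rw [truncGreen_succ]
  exact inv_ne_zero (ne_zero_of_im_neg (denom_im_neg lam hz n v))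

@[fun_prop]
theorem measurable_childPot (a : Fin K) : Measurable fun v : Vertex K → ℝ => childPot v a := by
  unfold childPot
  fun_prop

theorem measurable_truncGreen_prod (lam : ℝ) (n : ℕ) :
    Measurable fun p : ℂ × (Vertex K → ℝ) => truncGreen lam p.1 n p.2 := by
  induction n with
  | zero => simp [truncGreen_zero]
  | succ n ih =>
    simp only [truncGreen_succ]
    have h : ∀ a : Fin K,
        Measurable fun p : ℂ × (Vertex K → ℝ) => truncGreen lam p.1 n (childPot p.2 a) := fun a =>
      ih.comp (measurable_fst.prodMk ((measurable_childPot a).comp measurable_snd))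
    fun_prop

@[fun_prop]
theorem measurable_truncGreen (lam : ℝ) (z : ℂ) (n : ℕ) :
    Measurable fun v : Vertex K → ℝ => truncGreen lam z n v :=
  (measurable_truncGreen_prod lam n).comp (measurable_const.prodMk measurable_id)

/-- The law of an independent potential with single-site distribution `μ`. -/
noncomputable def potLaw (K : ℕ) (μ : Measure ℝ) : Measure (Vertex K → ℝ) :=
  Measure.infinitePi fun _ : Vertex K => μ

section Law

variable (μ : Measure ℝ) [IsProbabilityMeasure μ]

instance : IsProbabilityMeasure (potLaw K μ) := by
  unfold potLaw
  infer_instance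

theorem measurePreserving_childPot (a : Fin K) :
    MeasurePreserving (fun v : Vertex K → ℝ => childPot v a) (potLaw K μ) (potLaw K μ) := by
  refine ⟨measurable_childPot a, ?_⟩
  unfold potLaw childPot
  exact Measure.map_infinitePi_infinitePi_of_inj (P := fun _ : Vertex K => μ)
    (f := fun t : Vertex K => t ++ [a]) (fun s t h => List.append_cancel_right h)

/-- Each vertex reads one coordinate of two independent copies of the potential. Injectivity of `f`
means that no coordinate is read twice, so the values read are again independent with the same law.
-/
theorem measurePreserving_reindex (f : Vertex K → Bool × Vertex K) (hf : f.Injective) :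
    MeasurePreserving (fun (p : (Vertex K → ℝ) × (Vertex K → ℝ)) (x : Vertex K) =>
        (bif (f x).1 then p.2 else p.1) (f x).2)
      ((potLaw K μ).prod (potLaw K μ)) (potLaw K μ) := by
  have h0 : Measurable (fun (p : (Vertex K → ℝ) × (Vertex K → ℝ)) (x : Vertex K) =>
        (bif (f x).1 then p.2 else p.1) (f x).2) := by
    refine measurable_pi_lambda _ fun x => ?_
    cases (f x).1 <;> simp only [cond_true, cond_false] <;> fun_prop
  refine ⟨h0, ?_⟩
  have h1 := Measure.infinitePi_map_curry (fun (_ : Bool) (_ : Vertex K) => μ)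
  have h2 := Measure.infinitePi_map_eval_prod (P := fun _ : Bool => potLaw K μ)
    (i := false) (j := true) (by simp)
  have h3 := Measure.map_infinitePi_infinitePi_of_inj (P := fun _ : Bool × Vertex K => μ) hf
  rw [← h2]
  unfold potLaw at h0 ⊢
  have h4 : Measurable fun ω : Bool → Vertex K → ℝ => (ω false, ω true) := by fun_prop
  rw [← h1, Measure.map_map h0 h4, Measure.map_map (h0.comp h4) (by fun_prop), ← h3]
  congr 1
  ext w x
  rcases hx : f x with ⟨b, y⟩
  cases b <;> simp [hx, MeasurableEquiv.coe_curry, Function.curry]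

open Classical in
/-- The potential with value `r` at the root, `u` on the branch of the child `a`, and equal to `w`
elsewhere. -/
noncomputable def glue (a : Fin K) (r : ℝ) (w u : Vertex K → ℝ) : Vertex K → ℝ := fun x =>
  if x = [] then r else if x.getLast? = some a then u x.dropLast else w x

theorem glue_nil (a : Fin K) (r : ℝ) (w u : Vertex K → ℝ) : glue a r w u [] = r := by
  simp [glue]

theorem childPot_glue_self (a : Fin K) (r : ℝ) (w u : Vertex K → ℝ) :
    childPot (glue a r w u) a = u := by
  funext t
  simp [glue, childPot]

theorem childPot_glue_of_ne {a b : Fin K} (h : b ≠ a) (r : ℝ) (w u : Vertex K → ℝ) :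
    childPot (glue a r w u) b = childPot w b := by
  funext t
  simp [glue, childPot, h]

theorem measurePreserving_glue (a : Fin K) :
    MeasurePreserving (fun p : ℝ × (Vertex K → ℝ) × (Vertex K → ℝ) => glue a p.1 p.2.1 p.2.2)
      (μ.prod ((potLaw K μ).prod (potLaw K μ))) (potLaw K μ) := by
  classical
  -- Two reindexings are composed: the first splices `u` into the branch of `a`, the second (`h2`)
  -- takes the root value from a further independent copy.
  have h1 := measurePreserving_reindex μ
    (fun x : Vertex K => if x.getLast? = some a then (true, x.dropLast) else (false, x)) (by
      intro x y hxy
      simp only at hxy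
      split_ifs at hxy with hx hy hy
      · rw [← List.dropLast_append_getLast? a hx, ← List.dropLast_append_getLast? a hy,
          show x.dropLast = y.dropLast by simpa using hxy]
      · simp at hxy
      · simp at hxy
      · exact (Prod.ext_iff.1 hxy).2)
  have h2 := measurePreserving_reindex μ
    (fun x : Vertex K => (decide (x = []), x)) (fun x y hxy => (Prod.ext_iff.1 hxy).2)
  have h3 : MeasurePreserving (fun v : Vertex K → ℝ => v []) (potLaw K μ) μ :=
    measurePreserving_eval_infinitePi (fun _ : Vertex K => μ) []
  have h4 := h2.comp ((h1.prod (MeasurePreserving.id (potLaw K μ))))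
  have h5 : Measurable (fun p : ℝ × (Vertex K → ℝ) × (Vertex K → ℝ) =>
      glue a p.1 p.2.1 p.2.2) := by
    refine measurable_pi_lambda _ fun x => ?_
    unfold glue
    split_ifs <;> fun_prop
  refine ⟨h5, ?_⟩
  have h6 := (h3.prod (MeasurePreserving.id ((potLaw K μ).prod (potLaw K μ)))).map_eq
  rw [← h6, Measure.map_map h5 (by fun_prop)]
  have h7 : MeasurePreserving (Prod.swap (α := Vertex K → ℝ)
      (β := (Vertex K → ℝ) × (Vertex K → ℝ))) ((potLaw K μ).prod
      ((potLaw K μ).prod (potLaw K μ))) _ := Measure.measurePreserving_swap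
  refine Eq.trans ?_ (h4.comp h7).map_eq
  congr 1
  ext p x
  simp only [Function.comp, Prod.map, glue, id, Prod.swap]
  by_cases hx : x = []
  · simp [hx]
  · by_cases hy : x.getLast? = some a <;> simp [hx, hy]

/-- The order of integration is what matters later: with the siblings `w` outermost, a case
distinction on them leaves the root value `r` and the branch `u` free to be averaged. -/
theorem lintegral_glue (a : Fin K) {F : (Vertex K → ℝ) → ℝ≥0∞} (hF : Measurable F) :
    ∫⁻ v, F v ∂potLaw K μ =
      ∫⁻ w, ∫⁻ r, ∫⁻ u, F (glue a r w u) ∂potLaw K μ ∂μ ∂potLaw K μ := by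
  have h := measurePreserving_glue μ a
  have hm : Measurable fun p : ℝ × (Vertex K → ℝ) × (Vertex K → ℝ) =>
      F (glue a p.1 p.2.1 p.2.2) := hF.comp h.measurable
  rw [← h.lintegral_comp hF, lintegral_prod _ hm.aemeasurable]
  have h1 : ∀ r, ∫⁻ q : (Vertex K → ℝ) × (Vertex K → ℝ), F (glue a r q.1 q.2)
      ∂((potLaw K μ).prod (potLaw K μ)) =
      ∫⁻ w, ∫⁻ u, F (glue a r w u) ∂potLaw K μ ∂potLaw K μ := fun r =>
    lintegral_prod _ (hm.comp (measurable_const.prodMk measurable_id)).aemeasurable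
  simp only [h1]
  refine lintegral_lintegral_swap (Measurable.aemeasurable ?_)
  exact Measurable.lintegral_prod_right'
    (f := fun p : (ℝ × (Vertex K → ℝ)) × (Vertex K → ℝ) => F (glue a p.1.1 p.1.2 p.2))
    (hm.comp (g := fun p : ℝ × (Vertex K → ℝ) × (Vertex K → ℝ) => F (glue a p.1 p.2.1 p.2.2))
      (f := fun p : (ℝ × (Vertex K → ℝ)) × (Vertex K → ℝ) => (p.1.1, p.1.2, p.2)) (by fun_prop))

/-- Almost every potential takes values in `[-1, 1]` if the single-site law does. -/
theorem ae_potLaw_mem (hμ : ∀ᵐ r ∂μ, r ∈ Set.Icc (-1 : ℝ) 1) :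
    ∀ᵐ v ∂potLaw K μ, ∀ x, v x ∈ Set.Icc (-1 : ℝ) 1 := by
  rw [ae_all_iff]
  intro x
  have h3 : MeasurePreserving (fun v : Vertex K → ℝ => v x) (potLaw K μ) μ :=
    measurePreserving_eval_infinitePi (fun _ : Vertex K => μ) x
  exact h3.quasiMeasurePreserving.ae hμ

end Law

/-! ### Fractional moments of the differences of truncations -/

theorem rpow_sum_le_sum_rpow {ι : Type*} (t : Finset ι) (f : ι → ℝ) (hf : ∀ i ∈ t, 0 ≤ f i)
    {s : ℝ} (hs0 : 0 < s) (hs1 : s ≤ 1) : (∑ i ∈ t, f i) ^ s ≤ ∑ i ∈ t, f i ^ s := by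
  classical
  induction t using Finset.induction_on with
  | empty => simp [Real.zero_rpow hs0.ne']
  | insert a t ha ih =>
    rw [Finset.sum_insert ha, Finset.sum_insert ha]
    have h1 := hf a (Finset.mem_insert_self _ _)
    have h2 : ∀ i ∈ t, 0 ≤ f i := fun i hi => hf i (Finset.mem_insert_of_mem hi)
    exact (Real.rpow_add_le_add_rpow h1 (Finset.sum_nonneg h2) hs0.le hs1).trans
      (add_le_add le_rfl (ih h2))

theorem norm_sum_rpow_le {ι : Type*} (t : Finset ι) (f : ι → ℂ)
    {s : ℝ} (hs0 : 0 < s) (hs1 : s ≤ 1) : ‖∑ i ∈ t, f i‖ ^ s ≤ ∑ i ∈ t, ‖f i‖ ^ s :=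
  (Real.rpow_le_rpow (norm_nonneg _) (norm_sum_le _ _) hs0.le).trans
    (rpow_sum_le_sum_rpow t _ (fun _ _ => norm_nonneg _) hs0 hs1)

theorem ofReal_norm_div_rpow (a b : ℂ) (s : ℝ) : ENNReal.ofReal ((‖a‖ / ‖b‖) ^ s) =
    ENNReal.ofReal (‖a‖ ^ s) * ENNReal.ofReal ((‖b‖ ^ s)⁻¹) := by
  rw [Real.div_rpow (norm_nonneg _) (norm_nonneg _), div_eq_mul_inv,
    ENNReal.ofReal_mul (Real.rpow_nonneg (norm_nonneg _) _)]

/-- The `s`-moment of the distance of two truncated Green functions. -/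
noncomputable def truncDist (K : ℕ) (lam : ℝ) (μ : Measure ℝ) (s : ℝ) (z : ℂ) (n m : ℕ) : ℝ≥0∞ :=
  ∫⁻ v : Vertex K → ℝ, ENNReal.ofReal (‖truncGreen lam z n v - truncGreen lam z m v‖ ^ s)
    ∂potLaw K μ

/-- The `s`-moment of the distance of two truncated Green functions, weighted by the coupling `β`
of the root to an exterior site. -/
noncomputable def weightedDist (K : ℕ) (lam : ℝ) (μ : Measure ℝ) (s : ℝ) (z β : ℂ) (n m : ℕ) :
    ℝ≥0∞ :=
  ∫⁻ v : Vertex K → ℝ, ENNReal.ofReal ((‖truncGreen lam z n v - truncGreen lam z m v‖ /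
    ‖1 - β * truncGreen lam z n v‖) ^ s) ∂potLaw K μ

theorem weightedDist_zero (lam : ℝ) (μ : Measure ℝ) (s : ℝ) (z : ℂ) (n m : ℕ) :
    weightedDist K lam μ s z 0 n m = truncDist K lam μ s z n m := by
  simp [weightedDist, truncDist]

theorem truncGreen_sub {lam : ℝ} {z : ℂ} (hz : 0 < z.im) (n m : ℕ) (v : Vertex K → ℝ) :
    truncGreen lam z (n + 1) v - truncGreen lam z (m + 1) v =
      truncGreen lam z (n + 1) v * truncGreen lam z (m + 1) v *
        ∑ a, (truncGreen lam z n (childPot v a) - truncGreen lam z m (childPot v a)) := by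
  have h1 := ne_zero_of_im_neg (denom_im_neg lam hz n v)
  have h2 := ne_zero_of_im_neg (denom_im_neg lam hz m v)
  rw [truncGreen_succ, truncGreen_succ, Finset.sum_sub_distrib]
  field_simp
  ring

/-- The weight turns the factor `G_{n+1}` of the difference identity into `1/(G_{n+1}⁻¹ - β)`, that
is, it shifts the root denominator by `β`. The remaining factor `G_{m+1}` has a deterministic bound
near the edge. -/
theorem weighted_ratio_eq {lam : ℝ} {z β : ℂ} (hz : 0 < z.im) (n m : ℕ)
    (v : Vertex K → ℝ) :
    ‖truncGreen lam z (n + 1) v - truncGreen lam z (m + 1) v‖ /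
        ‖1 - β * truncGreen lam z (n + 1) v‖ =
      ‖truncGreen lam z (m + 1) v‖ *
        (‖∑ a, (truncGreen lam z n (childPot v a) - truncGreen lam z m (childPot v a))‖ /
        ‖((lam * v [] : ℝ) : ℂ) - z - ∑ a, truncGreen lam z n (childPot v a) - β‖) := by
  have h1 := truncGreen_succ_ne_zero lam hz n v
  have h2 : ((lam * v [] : ℝ) : ℂ) - z - ∑ a, truncGreen lam z n (childPot v a) =
      (truncGreen lam z (n + 1) v)⁻¹ := by rw [truncGreen_succ, inv_inv]
  have h3 : (truncGreen lam z (n + 1) v)⁻¹ - β =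
      (truncGreen lam z (n + 1) v)⁻¹ * (1 - β * truncGreen lam z (n + 1) v) := by
    field_simp
  rw [h2, h3, truncGreen_sub hz, norm_mul, norm_mul, norm_mul, norm_inv]
  have h4 : ‖truncGreen lam z (n + 1) v‖ ≠ 0 := norm_ne_zero_iff.2 h1
  -- If the weight is singular, both denominators vanish and both sides are `0` by the convention
  -- for division.
  by_cases h5 : ‖1 - β * truncGreen lam z (n + 1) v‖ = 0
  · simp [h5]
  · field_simp

/-- The contribution of the child `a` to the weighted distance. -/
noncomputable def childTerm (lam : ℝ) (s : ℝ) (z β : ℂ) (n m : ℕ) (a : Fin K)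
    (v : Vertex K → ℝ) : ℝ :=
  (‖truncGreen lam z n (childPot v a) - truncGreen lam z m (childPot v a)‖ /
    ‖((lam * v [] : ℝ) : ℂ) - z - ∑ b, truncGreen lam z n (childPot v b) - β‖) ^ s

theorem measurable_childTerm (lam : ℝ) (s : ℝ) (z β : ℂ) (n m : ℕ) (a : Fin K) :
    Measurable (childTerm lam s z β n m a) := by
  unfold childTerm
  have h : ∀ (n : ℕ) (b : Fin K), Measurable fun v : Vertex K → ℝ =>
      truncGreen lam z n (childPot v b) := fun n b =>
    (measurable_truncGreen lam z n).comp (measurable_childPot b)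
  fun_prop

theorem weighted_ratio_rpow_le {lam s : ℝ} (hs0 : 0 < s) (hs1 : s ≤ 1) {z β : ℂ} (hz : 0 < z.im)
    (n m : ℕ) (v : Vertex K → ℝ) {κ : ℝ} (hκ : ‖truncGreen lam z (m + 1) v‖ ≤ κ) :
    (‖truncGreen lam z (n + 1) v - truncGreen lam z (m + 1) v‖ /
        ‖1 - β * truncGreen lam z (n + 1) v‖) ^ s ≤
      κ ^ s * ∑ a, childTerm lam s z β n m a v := by
  have hκ0 : 0 ≤ κ := (norm_nonneg _).trans hκ
  rw [weighted_ratio_eq hz, Real.mul_rpow (by positivity) (by positivity),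
    Real.div_rpow (by positivity) (by positivity)]
  refine mul_le_mul (Real.rpow_le_rpow (norm_nonneg _) hκ hs0.le) ?_ (by positivity)
    (by positivity)
  simp only [childTerm, Real.div_rpow (norm_nonneg _) (norm_nonneg _)]
  rw [← Finset.sum_div]
  gcongr
  exact norm_sum_rpow_le _ _ hs0 hs1

/-- The sum of the truncated Green functions at the children other than `a`. -/
noncomputable def siblingSum (lam : ℝ) (z : ℂ) (n : ℕ) (a : Fin K) (w : Vertex K → ℝ) : ℂ :=
  ∑ b ∈ Finset.univ.erase a, truncGreen lam z n (childPot w b)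

theorem measurable_siblingSum (lam : ℝ) (z : ℂ) (n : ℕ) (a : Fin K) :
    Measurable (siblingSum lam z n a) := by
  unfold siblingSum
  have h : ∀ (b : Fin K), Measurable fun v : Vertex K → ℝ =>
      truncGreen lam z n (childPot v b) := fun b =>
    (measurable_truncGreen lam z n).comp (measurable_childPot b)
  fun_prop

/-- The denominator becomes `B - G_n(u)` with `B` depending only on `r`, `w` and `β`, so `B` is
constant when the branch of `a` is averaged. -/
theorem childTerm_glue (lam s : ℝ) (z β : ℂ) (n m : ℕ) (a : Fin K) (r : ℝ)
    (w u : Vertex K → ℝ) :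
    childTerm lam s z β n m a (glue a r w u) =
      (‖truncGreen lam z n u - truncGreen lam z m u‖ /
        ‖((lam * r : ℝ) : ℂ) - z - siblingSum lam z n a w - β - truncGreen lam z n u‖) ^ s := by
  unfold childTerm siblingSum
  rw [glue_nil, childPot_glue_self, ← Finset.add_sum_erase _ _ (Finset.mem_univ a),
    childPot_glue_self, Finset.sum_congr rfl fun b hb => by
      rw [childPot_glue_of_ne (Finset.ne_of_mem_erase hb)]]
  congr 3
  ring_nf

theorem siblingSum_im_nonneg (lam : ℝ) {z : ℂ} (hz : 0 < z.im) (n : ℕ) (a : Fin K)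
    (w : Vertex K → ℝ) : 0 ≤ (siblingSum lam z n a w).im := by
  unfold siblingSum
  rw [Complex.im_sum]
  exact Finset.sum_nonneg fun b _ => truncGreen_im_nonneg lam hz.le n _

section Law

variable (μ : Measure ℝ) [IsProbabilityMeasure μ]

theorem lintegral_truncGreen_child (lam s : ℝ) (z : ℂ) (n m : ℕ) (a : Fin K) :
    ∫⁻ v, ENNReal.ofReal (‖truncGreen lam z n (childPot v a) -
      truncGreen lam z m (childPot v a)‖ ^ s) ∂potLaw K μ = truncDist K lam μ s z n m :=
  (measurePreserving_childPot μ a).lintegral_comp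
    (f := fun v => ENNReal.ofReal (‖truncGreen lam z n v - truncGreen lam z m v‖ ^ s))
    (by fun_prop)

theorem lintegral_childSum_le {lam s : ℝ} (hs0 : 0 < s) (hs1 : s ≤ 1) (z : ℂ) (n m : ℕ)
    (t : Finset (Fin K)) :
    ∫⁻ v, ENNReal.ofReal (‖∑ a ∈ t, (truncGreen lam z n (childPot v a) -
      truncGreen lam z m (childPot v a))‖ ^ s) ∂potLaw K μ ≤ K * truncDist K lam μ s z n m := by
  calc _ ≤ ∫⁻ v, ∑ a ∈ t, ENNReal.ofReal (‖truncGreen lam z n (childPot v a) -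
      truncGreen lam z m (childPot v a)‖ ^ s) ∂potLaw K μ := by
        refine lintegral_mono fun v => ?_
        rw [← ENNReal.ofReal_sum_of_nonneg fun _ _ => by positivity]
        exact ENNReal.ofReal_le_ofReal (norm_sum_rpow_le _ _ hs0 hs1)
    _ = ∑ a ∈ t, truncDist K lam μ s z n m := by
        rw [lintegral_finsetSum]
        · simp only [lintegral_truncGreen_child]
        · intro a _
          have h : ∀ n : ℕ, Measurable fun v : Vertex K → ℝ =>
              truncGreen lam z n (childPot v a) := fun n =>
            (measurable_truncGreen lam z n).comp (measurable_childPot a)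
          have := h n
          have := h m
          fun_prop
    _ ≤ _ := by
        rw [Finset.sum_const, nsmul_eq_mul]
        gcongr
        exact_mod_cast (Finset.card_le_univ t).trans (by simp)

/-- With `u` fixed, averaging over the root value first bounds the denominator by `C` whatever the
shift is. The numerator depends on `u` alone. -/
theorem lintegral_bad_le {lam s : ℝ} {C : ℝ≥0∞}
    (hC : ∀ w : ℂ, ∫⁻ r, ENNReal.ofReal ((‖((lam * r : ℝ) : ℂ) - w‖ ^ s)⁻¹) ∂μ ≤ C)
    (z c : ℂ) (n m : ℕ) :
    ∫⁻ r, ∫⁻ u : Vertex K → ℝ, ENNReal.ofReal ((‖truncGreen lam z n u - truncGreen lam z m u‖ /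
        ‖((lam * r : ℝ) : ℂ) - c - truncGreen lam z n u‖) ^ s) ∂potLaw K μ ∂μ ≤
      C * truncDist K lam μ s z n m := by
  have hg : ∀ n : ℕ, Measurable fun p : ℝ × (Vertex K → ℝ) => truncGreen lam z n p.2 := fun n =>
    (measurable_truncGreen lam z n).comp measurable_snd
  have hn := hg n
  have hm := hg m
  rw [lintegral_lintegral_swap (by fun_prop)]
  rw [truncDist, ← lintegral_const_mul _ (by fun_prop)]
  refine lintegral_mono fun u => ?_
  simp only [ofReal_norm_div_rpow]
  rw [lintegral_const_mul _ (by fun_prop), mul_comm]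
  gcongr
  simpa only [sub_sub] using hC (c + truncGreen lam z n u)

end Law

/-! ### One step of the recursion for the weighted differences -/

section Law

variable (μ : Measure ℝ)

/-- Since `B - G = B (1 - B⁻¹ G)`, the child sees a weighted distance with the new coupling `B⁻¹`.
It lies in the closed upper half-plane because `Im B < 0`, so the class of couplings is preserved.
-/
theorem lintegral_good_le {lam s : ℝ} {z B : ℂ} {n m : ℕ} {ρ ℓ : ℝ} {A : ℝ≥0∞} (hs : 0 < s)
    (hA : ∀ β : ℂ, 0 ≤ β.im → ‖β‖ ≤ ρ → weightedDist K lam μ s z β n m ≤ A)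
    (hB : B.im < 0) (hℓ : 0 < ℓ) (hBℓ : ℓ ≤ ‖B‖) (hBρ : ‖B‖⁻¹ ≤ ρ) :
    ∫⁻ u : Vertex K → ℝ, ENNReal.ofReal ((‖truncGreen lam z n u - truncGreen lam z m u‖ /
        ‖B - truncGreen lam z n u‖) ^ s) ∂potLaw K μ ≤ ENNReal.ofReal ((ℓ ^ s)⁻¹) * A := by
  have hB0 := ne_zero_of_im_neg hB
  have h1 := hA B⁻¹ (inv_im_nonneg hB.le) (by rwa [norm_inv])
  have h2 : ∀ u : Vertex K → ℝ,
      ENNReal.ofReal ((‖truncGreen lam z n u - truncGreen lam z m u‖ /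
        ‖B - truncGreen lam z n u‖) ^ s) =
      ENNReal.ofReal ((‖B‖ ^ s)⁻¹) *
        ENNReal.ofReal ((‖truncGreen lam z n u - truncGreen lam z m u‖ /
          ‖1 - B⁻¹ * truncGreen lam z n u‖) ^ s) := by
    intro u
    have h3 : B - truncGreen lam z n u = B * (1 - B⁻¹ * truncGreen lam z n u) := by
      field_simp
    rw [h3, norm_mul, ← ENNReal.ofReal_mul (by positivity),
      ← Real.inv_rpow (norm_nonneg _), ← Real.mul_rpow (by positivity) (by positivity)]
    congr 2
    rw [div_mul_eq_div_div_swap, div_eq_mul_inv _ ‖B‖, mul_comm]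
  simp only [h2]
  rw [lintegral_const_mul _ (by fun_prop)]
  gcongr
  exact h1

variable [IsProbabilityMeasure μ]

/-- If the siblings at depth `n` are close to those at depth `m`, then `Re B` is large and the term
contracts. Otherwise the a priori bound `C * h` applies, where `h` is the unweighted distance, on an
event of probability `O(h)`; that event is independent of `r` and `u`, so its contribution is
quadratic in `h`. -/
theorem childTerm_lintegral_le {lam s : ℝ} (hlam : 0 < lam) (hs0 : 0 < s) (hs1 : s ≤ 1)
    (hK : 0 < K)
    {z : ℂ} (hz : 0 < z.im) {t : ℝ} (ht0 : 0 < t) (ht1 : t < √K)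
    (hρ : 1 / (√K - t) ≤ 1 / √K + 3 * t / 4)
    (hre : z.re ≤ -2 * √K - lam + t / 8)
    (hμ : ∀ᵐ r ∂μ, r ∈ Set.Icc (-1 : ℝ) 1) {n m : ℕ}
    (hm : ∀ v : Vertex K → ℝ, (∀ x, v x ∈ Set.Icc (-1 : ℝ) 1) →
      ‖truncGreen lam z m v‖ ≤ 1 / √K)
    {C A : ℝ≥0∞}
    (hC : ∀ w : ℂ, ∫⁻ r, ENNReal.ofReal ((‖((lam * r : ℝ) : ℂ) - w‖ ^ s)⁻¹) ∂μ ≤ C)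
    (hA : ∀ β : ℂ, 0 ≤ β.im → ‖β‖ ≤ 1 / (√K - t) → weightedDist K lam μ s z β n m ≤ A)
    {β : ℂ} (hβ0 : 0 ≤ β.im) (hβ1 : ‖β‖ ≤ 1 / (√K - t)) (a : Fin K) :
    ∫⁻ v, ENNReal.ofReal (childTerm lam s z β n m a v) ∂potLaw K μ ≤
      (∫⁻ r, ENNReal.ofReal (((√K + lam * (r + 1) - t) ^ s)⁻¹) ∂μ) * A +
        C * truncDist K lam μ s z n m *
          (ENNReal.ofReal (((t / 8) ^ s)⁻¹) * (K * truncDist K lam μ s z n m)) := by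
  have hR : 0 < √(K : ℝ) := Real.sqrt_pos.2 (by exact_mod_cast hK)
  have hRR : √(K : ℝ) * √K = K := Real.mul_self_sqrt (by positivity)
  set h := truncDist K lam μ s z n m with hh
  set q := ∫⁻ r, ENNReal.ofReal (((√K + lam * (r + 1) - t) ^ s)⁻¹) ∂μ with hq
  set bad : Set (Vertex K → ℝ) :=
    {w | t / 8 ≤ ‖siblingSum lam z n a w - siblingSum lam z m a w‖} with hbad
  have hmn := measurable_siblingSum lam z n a
  have hmm := measurable_siblingSum lam z m a
  have hbm : MeasurableSet bad := measurableSet_le measurable_const (by fun_prop)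
  rw [lintegral_glue μ a (measurable_childTerm lam s z β n m a).ennreal_ofReal]
  -- Markov's inequality for the `s`-th power of the sibling difference.
  have hprob : potLaw K μ bad ≤ ENNReal.ofReal (((t / 8) ^ s)⁻¹) * (K * h) := by
    have h1 := lintegral_childSum_le (K := K) μ hs0 hs1 z n m (Finset.univ.erase a) (lam := lam)
    have h2 : ENNReal.ofReal ((t / 8) ^ s) * potLaw K μ bad ≤ K * h := by
      refine le_trans ?_ h1
      have h3 : ∀ v : Vertex K → ℝ, ∑ b ∈ Finset.univ.erase a,
          (truncGreen lam z n (childPot v b) - truncGreen lam z m (childPot v b)) =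
          siblingSum lam z n a v - siblingSum lam z m a v := fun v => by
        rw [Finset.sum_sub_distrib]; rfl
      simp only [h3]
      refine le_trans ?_ (mul_meas_ge_le_lintegral (by fun_prop)
        (ENNReal.ofReal ((t / 8) ^ s)))
      gcongr
      intro w hw
      exact ENNReal.ofReal_le_ofReal (Real.rpow_le_rpow (by positivity) hw hs0.le)
    have h4 : ENNReal.ofReal (((t / 8) ^ s)⁻¹) * ENNReal.ofReal ((t / 8) ^ s) = 1 := by
      rw [← ENNReal.ofReal_mul (by positivity), inv_mul_cancel₀ (by positivity)]
      simp
    calc _ = ENNReal.ofReal (((t / 8) ^ s)⁻¹) *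
          (ENNReal.ofReal ((t / 8) ^ s) * potLaw K μ bad) := by
          rw [← mul_assoc, h4, one_mul]
      _ ≤ _ := by gcongr
  have hpt : ∀ᵐ w ∂potLaw K μ,
      ∫⁻ r, ∫⁻ u, ENNReal.ofReal (childTerm lam s z β n m a (glue a r w u)) ∂potLaw K μ ∂μ ≤
        q * A + bad.indicator (fun _ => C * h) w := by
    filter_upwards [ae_potLaw_mem μ hμ] with w hw
    simp only [childTerm_glue]
    by_cases hwb : w ∈ bad
    · rw [Set.indicator_of_mem hwb]
      refine le_add_left ?_
      have := lintegral_bad_le (K := K) μ hC z (z + siblingSum lam z n a w + β) n m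
      simpa only [sub_add_eq_sub_sub] using this
    · rw [Set.indicator_of_notMem hwb, add_zero, hq, ← lintegral_mul_const _ (by fun_prop)]
      refine lintegral_mono_ae ?_
      filter_upwards [hμ] with r hr
      have hS : ‖siblingSum lam z n a w‖ ≤ (K - 1) * (1 / √K) + t / 8 := by
        have h1 : ‖siblingSum lam z m a w‖ ≤ (K - 1) * (1 / √K) := by
          unfold siblingSum
          refine (norm_sum_le _ _).trans ((Finset.sum_le_sum fun b _ => hm _ fun x => hw _).trans ?_)
          rw [Finset.sum_const, Finset.card_erase_of_mem (Finset.mem_univ a)]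
          simp [Nat.cast_sub (show 1 ≤ K from hK)]
        have h2 : ‖siblingSum lam z n a w - siblingSum lam z m a w‖ ≤ t / 8 := by
          simp only [hbad, Set.mem_ofPred_eq, not_le] at hwb
          exact hwb.le
        have h3 := norm_add_le (siblingSum lam z n a w - siblingSum lam z m a w)
          (siblingSum lam z m a w)
        rw [sub_add_cancel] at h3
        linarith
      have hK1 : ((K : ℝ) - 1) * (1 / √K) = √K - 1 / √K := by
        field_simp
        linarith
      have hre1 := (Complex.re_le_norm (siblingSum lam z n a w)).trans hS
      have hre2 := (Complex.re_le_norm β).trans hβ1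
      have hr1 : 0 ≤ lam * (r + 1) := mul_nonneg hlam.le (by linarith [hr.1])
      have him := siblingSum_im_nonneg lam hz n a w
      -- The margin `t` is spent as `t/8` on the energy, `t/8` on the siblings and `3t/4` on `Re β`.
      -- The terms `1/√K` from the missing sibling and from `β` cancel.
      have hBre : √K + lam * (r + 1) - t ≤
          ‖((lam * r : ℝ) : ℂ) - z - siblingSum lam z n a w - β‖ := by
        refine le_trans ?_ (Complex.re_le_norm _)
        simp only [Complex.sub_re, Complex.ofReal_re]
        linarith
      refine lintegral_good_le μ hs0 hA (B := ((lam * r : ℝ) : ℂ) - z -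
        siblingSum lam z n a w - β) ?_ (by linarith) hBre ?_
      · simp only [Complex.sub_im, Complex.ofReal_im]
        linarith
      · rw [← one_div]
        exact one_div_le_one_div_of_le (by linarith) (by linarith)
  refine (lintegral_mono_ae hpt).trans ?_
  rw [lintegral_add_left measurable_const, lintegral_const, measure_univ, mul_one,
    lintegral_indicator_const hbm]
  gcongr

theorem weightedDist_succ_le_sum {lam s κ : ℝ} (hs0 : 0 < s) (hs1 : s ≤ 1)
    {z : ℂ} (hz : 0 < z.im)
    (hμ : ∀ᵐ r ∂μ, r ∈ Set.Icc (-1 : ℝ) 1) {n m : ℕ}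
    (hm : ∀ v : Vertex K → ℝ, (∀ x, v x ∈ Set.Icc (-1 : ℝ) 1) →
      ‖truncGreen lam z (m + 1) v‖ ≤ κ) {β : ℂ} {X : ℝ≥0∞}
    (hX : ∀ a : Fin K,
      ∫⁻ v, ENNReal.ofReal (childTerm lam s z β n m a v) ∂potLaw K μ ≤ X) :
    weightedDist K lam μ s z β (n + 1) (m + 1) ≤ K * ENNReal.ofReal (κ ^ s) * X := by
  have hk : 0 ≤ κ := (norm_nonneg _).trans (hm (fun _ => 0) (by simp))
  have hc := fun a : Fin K => measurable_childTerm lam s z β n m a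
  calc _ ≤ ∫⁻ v, ENNReal.ofReal (κ ^ s) * ∑ a, ENNReal.ofReal (childTerm lam s z β n m a v)
        ∂potLaw K μ := by
        refine lintegral_mono_ae ?_
        filter_upwards [ae_potLaw_mem μ hμ] with v hv
        rw [← ENNReal.ofReal_sum_of_nonneg fun a _ => by unfold childTerm; positivity,
          ← ENNReal.ofReal_mul (by positivity)]
        exact ENNReal.ofReal_le_ofReal (weighted_ratio_rpow_le hs0 hs1 hz n m v (hm v hv))
    _ = ENNReal.ofReal (κ ^ s) * ∑ a, ∫⁻ v, ENNReal.ofReal (childTerm lam s z β n m a v)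
        ∂potLaw K μ := by
        rw [lintegral_const_mul _ (by fun_prop), lintegral_finsetSum _ (by fun_prop)]
    _ ≤ ENNReal.ofReal (κ ^ s) * ∑ a : Fin K, X := by
        gcongr with a
        exact hX a
    _ = _ := by
        rw [Finset.sum_const, Finset.card_univ, Fintype.card_fin, nsmul_eq_mul, mul_left_comm,
          mul_assoc]

/-- A crude step valid for every `β`, without any smallness of the siblings. It removes the weight
at the price of a constant, and so starts the iteration. -/
theorem weightedDist_succ_le {lam s κ : ℝ} (hs0 : 0 < s) (hs1 : s ≤ 1)
    {z : ℂ} (hz : 0 < z.im)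
    (hμ : ∀ᵐ r ∂μ, r ∈ Set.Icc (-1 : ℝ) 1) {n m : ℕ}
    (hm : ∀ v : Vertex K → ℝ, (∀ x, v x ∈ Set.Icc (-1 : ℝ) 1) →
      ‖truncGreen lam z (m + 1) v‖ ≤ κ) {C : ℝ≥0∞}
    (hC : ∀ w : ℂ, ∫⁻ r, ENNReal.ofReal ((‖((lam * r : ℝ) : ℂ) - w‖ ^ s)⁻¹) ∂μ ≤ C) (β : ℂ) :
    weightedDist K lam μ s z β (n + 1) (m + 1) ≤
      K * ENNReal.ofReal (κ ^ s) * (C * truncDist K lam μ s z n m) := by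
  refine weightedDist_succ_le_sum μ hs0 hs1 hz hμ hm fun a => ?_
  rw [lintegral_glue μ a (measurable_childTerm lam s z β n m a).ennreal_ofReal]
  calc _ ≤ ∫⁻ w : Vertex K → ℝ, C * truncDist K lam μ s z n m ∂potLaw K μ := by
        refine lintegral_mono fun w => ?_
        simp only [childTerm_glue]
        have := lintegral_bad_le (K := K) μ hC z (z + siblingSum lam z n a w + β) n m
        simpa only [sub_add_eq_sub_sub] using this
    _ = _ := by simp

/-- Each generation contributes a factor `θ` and, from the bad event, an additive `c₂ H²`. As `θ ≤
1`, these errors add up at most linearly in the number of generations. -/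
theorem weightedDist_iterate_le {lam s : ℝ} (hlam : 0 < lam) (hs0 : 0 < s) (hs1 : s ≤ 1)
    (hK : 0 < K)
    {z : ℂ} (hz : 0 < z.im) {t : ℝ} (ht0 : 0 < t) (ht1 : t < √K)
    (hρ : 1 / (√K - t) ≤ 1 / √K + 3 * t / 4)
    (hre : z.re ≤ -2 * √K - lam + t / 8)
    (hμ : ∀ᵐ r ∂μ, r ∈ Set.Icc (-1 : ℝ) 1) {n m N : ℕ}
    (hm : ∀ j ≤ N + 1, ∀ v : Vertex K → ℝ, (∀ x, v x ∈ Set.Icc (-1 : ℝ) 1) →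
      ‖truncGreen lam z (m + j) v‖ ≤ 1 / √K)
    {C θ c₁ c₂ H : ℝ≥0∞}
    (hC : ∀ w : ℂ, ∫⁻ r, ENNReal.ofReal ((‖((lam * r : ℝ) : ℂ) - w‖ ^ s)⁻¹) ∂μ ≤ C)
    (hθ : θ = K * ENNReal.ofReal ((1 / √K) ^ s) *
      ∫⁻ r, ENNReal.ofReal (((√K + lam * (r + 1) - t) ^ s)⁻¹) ∂μ)
    (hθ1 : θ ≤ 1)
    (hc₁ : c₁ = K * ENNReal.ofReal ((1 / √K) ^ s) * C)
    (hc₂ : c₂ = c₁ * (ENNReal.ofReal (((t / 8) ^ s)⁻¹) * K))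
    (hH : ∀ j ≤ N, truncDist K lam μ s z (n + j) (m + j) ≤ H) :
    ∀ j ≤ N, ∀ β : ℂ, 0 ≤ β.im → ‖β‖ ≤ 1 / (√K - t) →
      weightedDist K lam μ s z β (n + j + 1) (m + j + 1) ≤ θ ^ j * (c₁ * H) + j * (c₂ * H * H) := by
  intro j
  induction j with
  | zero =>
    intro _ β _ _
    refine (weightedDist_succ_le μ hs0 hs1 hz hμ (hm 1 (by omega)) hC β).trans ?_
    have := hH 0 (by omega)
    simp only [pow_zero, one_mul, Nat.cast_zero, zero_mul, add_zero, hc₁]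
    rw [← mul_assoc]
    gcongr
    exact this
  | succ j ih =>
    intro hj β hβ0 hβ1
    have h1 := fun a => childTerm_lintegral_le μ hlam hs0 hs1 hK hz ht0 ht1 hρ hre hμ
      (hm (j + 1) (by omega)) hC (ih (by omega)) hβ0 hβ1 a
    refine (weightedDist_succ_le_sum μ hs0 hs1 hz hμ (hm (j + 2) (by omega)) h1).trans ?_
    have h2 := hH (j + 1) hj
    have h3 : truncDist K lam μ s z (n + j + 1) (m + j + 1) ≤ H := h2
    set q := ∫⁻ r, ENNReal.ofReal (((√K + lam * (r + 1) - t) ^ s)⁻¹) ∂μ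
    set k := ENNReal.ofReal ((1 / √K) ^ s)
    set d := ENNReal.ofReal (((t / 8) ^ s)⁻¹)
    calc _ ≤ K * k * (q * (θ ^ j * (c₁ * H) + j * (c₂ * H * H)) + C * H * (d * (K * H))) := by
          gcongr <;> exact h2
      _ = θ * (θ ^ j * (c₁ * H)) + (θ * (j * (c₂ * H * H)) + c₂ * H * H) := by
          rw [hc₂, hc₁, hθ]
          ring
      _ ≤ θ ^ (j + 1) * (c₁ * H) + (1 * (j * (c₂ * H * H)) + c₂ * H * H) := by
          refine add_le_add (by rw [pow_succ', mul_assoc]) ?_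
          gcongr
      _ = _ := by
          push_cast
          ring

end Law

/-! ### Deterministic bounds near the edge of the spectrum -/

/-- At the edge with `V = -1` the recursion `x ↦ 1/(2√K - K x)` started at `0` gives `j/((j+1)√K)`.
The weaker bound with `2j/(2j+1)` leaves room `√K(1/(2j+1) - 1/(2j+2))` in the denominator, which
pays for `ε` up to depth `M`. -/
theorem truncGreen_norm_le (hK : 0 < K) {lam : ℝ} (hlam : 0 ≤ lam) {z : ℂ} {ε : ℝ} {M : ℕ}
    (hre : z.re ≤ -2 * √K - lam + ε) (hM : ε * ((2 * M + 1) * (2 * M + 2)) ≤ √K) (hε : 0 ≤ ε) :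
    ∀ j ≤ M, ∀ v : Vertex K → ℝ, (∀ x, v x ∈ Set.Icc (-1 : ℝ) 1) →
      ‖truncGreen lam z j v‖ ≤ 1 / √K * (2 * j / (2 * j + 1)) := by
  have hR : 0 < √(K : ℝ) := Real.sqrt_pos.2 (by exact_mod_cast hK)
  have hRR : √(K : ℝ) * √K = K := Real.mul_self_sqrt (by positivity)
  intro j
  induction j with
  | zero => intro _ v _; simp [truncGreen_zero]
  | succ j ih =>
    intro hj v hv
    have hjM : (j : ℝ) + 1 ≤ M := by exact_mod_cast hj
    rw [truncGreen_succ, norm_inv]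
    have hS : ‖∑ a, truncGreen lam z j (childPot v a)‖ ≤ √K * (2 * j / (2 * j + 1)) := by
      refine (norm_sum_le _ _).trans
        ((Finset.sum_le_sum fun a _ => ih (by omega) _ fun x => hv _).trans ?_)
      rw [Finset.sum_const, Finset.card_univ, Fintype.card_fin, nsmul_eq_mul, ← mul_assoc]
      apply le_of_eq
      congr 1
      field_simp
      linarith
    have hb := (Complex.re_le_norm _).trans hS
    have h1 : 0 ≤ lam * (v [] + 1) := mul_nonneg hlam (by linarith [(hv []).1])
    have h2 : ε * ((2 * j + 1) * (2 * j + 2)) ≤ √K := by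
      refine le_trans ?_ hM
      gcongr <;> linarith
    have h3 : ε ≤ √K * (1 / (2 * j + 1) - 1 / (2 * j + 2)) := by
      have : √(K : ℝ) * (1 / (2 * j + 1) - 1 / (2 * j + 2)) =
          √K / ((2 * j + 1) * (2 * j + 2)) := by
        field_simp
        ring
      rw [this, le_div_iff₀ (by positivity)]
      exact h2
    have h4 : √(K : ℝ) * ((2 * j + 3) / (2 * j + 2)) ≤
        ‖((lam * v [] : ℝ) : ℂ) - z - ∑ a, truncGreen lam z j (childPot v a)‖ := by
      refine le_trans ?_ (Complex.re_le_norm _)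
      simp only [Complex.sub_re, Complex.ofReal_re]
      have h5 : √(K : ℝ) * ((2 * j + 3) / (2 * j + 2)) =
          2 * √K - √K * (2 * j / (2 * j + 1)) - √K * (1 / (2 * j + 1) - 1 / (2 * j + 2)) := by
        field_simp
        ring
      linarith
    calc _ ≤ (√(K : ℝ) * ((2 * j + 3) / (2 * j + 2)))⁻¹ := by
          gcongr
      _ = _ := by
          push_cast
          field_simp
          ring

theorem truncGreen_norm_le' (hK : 0 < K) {lam : ℝ} (hlam : 0 ≤ lam) {z : ℂ} {ε : ℝ} {M : ℕ}
    (hre : z.re ≤ -2 * √K - lam + ε) (hM : ε * ((2 * M + 1) * (2 * M + 2)) ≤ √K) (hε : 0 ≤ ε)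
    {j : ℕ} (hj : j ≤ M) {v : Vertex K → ℝ} (hv : ∀ x, v x ∈ Set.Icc (-1 : ℝ) 1) :
      ‖truncGreen lam z j v‖ ≤ 1 / √K := by
  refine (truncGreen_norm_le hK hlam hre hM hε j hj v hv).trans ?_
  refine mul_le_of_le_one_right (by positivity) ?_
  rw [div_le_one (by positivity)]
  linarith

/-- One generation multiplies the distance by at most `2(m+1)/(2m+3) ≤ √(m+1)/√(m+2)`, and the
product telescopes. The factor below `1` comes from the refined bound on the shallower function. The
estimate does not depend on `r`. -/
theorem truncGreen_dist_le (hK : 0 < K) {lam : ℝ} (hlam : 0 ≤ lam) {z : ℂ} (hz : 0 < z.im)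
    {ε : ℝ} {M : ℕ}
    (hre : z.re ≤ -2 * √K - lam + ε) (hM : ε * ((2 * M + 1) * (2 * M + 2)) ≤ √K) (hε : 0 ≤ ε)
    (r : ℕ) : ∀ m, m + r ≤ M → ∀ v : Vertex K → ℝ, (∀ x, v x ∈ Set.Icc (-1 : ℝ) 1) →
      ‖truncGreen lam z (m + r) v - truncGreen lam z m v‖ ≤ 1 / √K * (1 / √(m + 1)) := by
  have hR : 0 < √(K : ℝ) := Real.sqrt_pos.2 (by exact_mod_cast hK)
  have hRR : √(K : ℝ) * √K = K := Real.mul_self_sqrt (by positivity)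
  intro m
  induction m with
  | zero =>
    intro hm v hv
    simpa [truncGreen_zero] using truncGreen_norm_le' hK hlam hre hM hε hm hv
  | succ m ih =>
    intro hm v hv
    rw [show m + 1 + r = (m + r) + 1 by ring, truncGreen_sub hz, norm_mul, norm_mul]
    have h1 := truncGreen_norm_le' hK hlam hre hM hε (j := m + r + 1) (by omega) hv
    have h2 := truncGreen_norm_le hK hlam hre hM hε (m + 1) (by omega) v hv
    have h3 : ‖∑ a, (truncGreen lam z (m + r) (childPot v a) -
        truncGreen lam z m (childPot v a))‖ ≤ K * (1 / √K * (1 / √(m + 1))) := by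
      refine (norm_sum_le _ _).trans
        ((Finset.sum_le_sum fun a _ => ih (by omega) _ fun x => hv _).trans ?_)
      simp
    calc _ ≤ 1 / √K * (1 / √K * (2 * (m + 1 : ℕ) / (2 * (m + 1 : ℕ) + 1))) *
          (K * (1 / √K * (1 / √(m + 1)))) := by gcongr
      _ = 1 / √K * ((2 * (m + 1) / (2 * m + 3)) * (1 / √(m + 1))) := by
          push_cast
          generalize √(K : ℝ) = R at hR hRR
          rw [← hRR]
          field_simp
          ring
      _ ≤ _ := by
          gcongr
          push_cast
          have h5 : 0 < √((m : ℝ) + 1) := by positivity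
          have h6 : 0 < √((m : ℝ) + 1 + 1) := by positivity
          rw [← mul_div_assoc, mul_one, div_div, div_le_div_iff₀ (by positivity) h6, one_mul]
          have h7 : √((m : ℝ) + 1) * √(m + 1) = m + 1 := Real.mul_self_sqrt (by positivity)
          have h8 : √((m : ℝ) + 1 + 1) * √(m + 1 + 1) = m + 1 + 1 :=
            Real.mul_self_sqrt (by positivity)
          -- After squaring, the claim is `4(m+1)(m+2) ≤ (2m+3)²`.
          refine abs_le_of_sq_le_sq' ?_ (by positivity) |>.2
          have : (2 * ((m : ℝ) + 1) * √(m + 1 + 1)) ^ 2 = 4 * (m + 1) ^ 2 * (m + 1 + 1) := by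
            rw [mul_pow, sq (√((m : ℝ) + 1 + 1)), h8]
            ring
          rw [this, mul_pow, sq (√((m : ℝ) + 1)), h7]
          nlinarith [show (0 : ℝ) ≤ m from Nat.cast_nonneg m]

theorem truncDist_triangle (lam : ℝ) (μ : Measure ℝ) {s : ℝ} (hs0 : 0 < s) (hs1 : s ≤ 1) (z : ℂ)
    (n l m : ℕ) : truncDist K lam μ s z n m ≤
      truncDist K lam μ s z n l + truncDist K lam μ s z l m := by
  unfold truncDist
  rw [← lintegral_add_left (by fun_prop)]
  refine lintegral_mono fun v => ?_
  rw [← ENNReal.ofReal_add (by positivity) (by positivity)]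
  apply ENNReal.ofReal_le_ofReal
  refine le_trans ?_ (Real.rpow_add_le_add_rpow (norm_nonneg _) (norm_nonneg _) hs0.le hs1)
  refine Real.rpow_le_rpow (norm_nonneg _) ?_ hs0.le
  simpa using norm_add_le (truncGreen lam z n v - truncGreen lam z l v)
    (truncGreen lam z l v - truncGreen lam z m v)

theorem truncDist_le_of_forall (lam : ℝ) (μ : Measure ℝ) [IsProbabilityMeasure μ] {s : ℝ}
    (hs0 : 0 < s) (z : ℂ) (n m : ℕ)
    (hμ : ∀ᵐ r ∂μ, r ∈ Set.Icc (-1 : ℝ) 1) {d : ℝ}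
    (h : ∀ v : Vertex K → ℝ, (∀ x, v x ∈ Set.Icc (-1 : ℝ) 1) →
      ‖truncGreen lam z n v - truncGreen lam z m v‖ ≤ d) :
    truncDist K lam μ s z n m ≤ ENNReal.ofReal (d ^ s) := by
  calc _ ≤ ∫⁻ _ : Vertex K → ℝ, ENNReal.ofReal (d ^ s) ∂potLaw K μ := by
        refine lintegral_mono_ae ?_
        filter_upwards [ae_potLaw_mem μ hμ] with v hv
        exact ENNReal.ofReal_le_ofReal (Real.rpow_le_rpow (norm_nonneg _) (h v hv) hs0.le)
    _ = _ := by simp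

/-- A bounded density has uniformly bounded negative fractional moments. -/
theorem exists_negMoment_bound (μ : Measure ℝ) [IsProbabilityMeasure μ] {D : ℝ≥0∞} (hD : D ≠ ⊤)
    (hμD : μ ≤ D • volume) {lam : ℝ} (hlam : 0 < lam) {s : ℝ} (hs0 : 0 < s) (hs1 : s < 1) :
    ∃ C : ℝ≥0∞, C ≠ ⊤ ∧
      ∀ w : ℂ, ∫⁻ r, ENNReal.ofReal ((‖((lam * r : ℝ) : ℂ) - w‖ ^ s)⁻¹) ∂μ ≤ C := by
  set I := ∫⁻ u in Set.Icc (-1 : ℝ) 1, ENNReal.ofReal ((|u| ^ s)⁻¹) with hI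
  have hint : I ≠ ⊤ := by
    have h1 : IntegrableOn (fun u : ℝ => (|u| ^ s)⁻¹) (Set.Ioc 0 1) := by
      have h2 := (intervalIntegral.intervalIntegrable_rpow' (a := 0) (b := 1)
        (show (-1 : ℝ) < -s by linarith)).1
      refine h2.congr_fun (fun u hu => ?_) measurableSet_Ioc
      simp only
      rw [abs_of_pos hu.1, Real.rpow_neg hu.1.le]
    have h3 : IntegrableOn (fun u : ℝ => (|u| ^ s)⁻¹) (Set.Ico (-1) 0) := by
      have h4 := (Measure.measurePreserving_neg (volume : Measure ℝ)).integrableOn_comp_preimage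
        (Homeomorph.neg ℝ).measurableEmbedding (f := fun u : ℝ => (|u| ^ s)⁻¹) (s := Set.Ioc 0 1)
      have h5 := h4.2 h1
      simpa [Function.comp_def] using h5
    have h6 : IntegrableOn (fun u : ℝ => (|u| ^ s)⁻¹) (Set.Icc (-1) 1) := by
      have h7 : Set.Icc (-1 : ℝ) 1 ⊆ (Set.Ico (-1) 0 ∪ {0}) ∪ Set.Ioc 0 1 := by
        intro x hx
        rcases lt_trichotomy x 0 with h | h | h
        · exact Or.inl (Or.inl ⟨hx.1, h⟩)
        · exact Or.inl (Or.inr h)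
        · exact Or.inr ⟨h, hx.2⟩
      refine IntegrableOn.mono_set ((h3.union ?_).union h1) h7
      exact integrableOn_singleton (by simp) (by simp)
    exact h6.lintegral_lt_top.ne
  refine ⟨ENNReal.ofReal ((lam ^ s)⁻¹) * (1 + D * I), ?_, fun w => ?_⟩
  · finiteness
  set x := w.re / lam with hx
  have hne : ∀ᵐ r ∂μ, r ≠ x := by
    rw [ae_iff]
    simp only [ne_eq, not_not, Set.ofPred_eq_eq_singleton]
    exact le_antisymm ((hμD _).trans (by simp)) (zero_le)
  -- Only the real part of `λr - w` is kept. At distance at least `1` from the singularity the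
  -- integrand is at most `1`; closer to it the density bound and the integrability of `|u|^{-s}`
  -- are used.
  calc _ ≤ ∫⁻ r, ENNReal.ofReal ((lam ^ s)⁻¹) * (1 + (Set.Icc (-1 : ℝ) 1).indicator
        (fun u => ENNReal.ofReal ((|u| ^ s)⁻¹)) (r - x)) ∂μ := by
        refine lintegral_mono_ae ?_
        filter_upwards [hne] with r hr
        have h0 : 0 < |r - x| := abs_pos.2 (sub_ne_zero.2 hr)
        have h1 : lam * |r - x| ≤ ‖((lam * r : ℝ) : ℂ) - w‖ := by
          refine le_trans (le_of_eq ?_) (Complex.abs_re_le_norm _)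
          rw [← abs_of_pos hlam, ← abs_mul, abs_of_pos hlam, hx]
          congr 1
          simp only [Complex.sub_re, Complex.ofReal_re]
          field_simp
        have h2 : (‖((lam * r : ℝ) : ℂ) - w‖ ^ s)⁻¹ ≤ (lam ^ s)⁻¹ * (|r - x| ^ s)⁻¹ := by
          rw [← mul_inv, ← Real.mul_rpow hlam.le h0.le]
          gcongr
        refine (ENNReal.ofReal_le_ofReal h2).trans ?_
        rw [ENNReal.ofReal_mul (by positivity)]
        gcongr
        by_cases hm : r - x ∈ Set.Icc (-1 : ℝ) 1
        · rw [Set.indicator_of_mem hm]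
          exact le_add_left le_rfl
        · rw [Set.indicator_of_notMem hm, add_zero, ← ENNReal.ofReal_one]
          apply ENNReal.ofReal_le_ofReal
          apply inv_le_one_of_one_le₀
          apply Real.one_le_rpow _ hs0.le
          by_contra hc
          exact hm ⟨(abs_lt.1 (not_le.1 hc)).1.le, (abs_lt.1 (not_le.1 hc)).2.le⟩
    _ = ENNReal.ofReal ((lam ^ s)⁻¹) * (1 + ∫⁻ r, (Set.Icc (-1 : ℝ) 1).indicator
        (fun u => ENNReal.ofReal ((|u| ^ s)⁻¹)) (r - x) ∂μ) := by
        have hm : Measurable fun r : ℝ => (Set.Icc (-1 : ℝ) 1).indicator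
            (fun u => ENNReal.ofReal ((|u| ^ s)⁻¹)) (r - x) := by
          have : Measurable ((Set.Icc (-1 : ℝ) 1).indicator
            (fun u => ENNReal.ofReal ((|u| ^ s)⁻¹))) :=
            Measurable.indicator (by fun_prop) measurableSet_Icc
          exact this.comp (by fun_prop)
        rw [lintegral_const_mul _ (by fun_prop), lintegral_add_left measurable_const]
        simp
    _ ≤ _ := by
        gcongr
        refine (lintegral_mono' hμD le_rfl).trans ?_
        rw [lintegral_smul_measure, smul_eq_mul, lintegral_sub_right_eq_self
          ((Set.Icc (-1 : ℝ) 1).indicator (fun u => ENNReal.ofReal ((|u| ^ s)⁻¹))) x,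
          lintegral_indicator measurableSet_Icc]

/-! ### Uniform approximation near the edge of the spectrum -/

/-- This is where the law is seen not to concentrate at `-1`, which makes the contraction factor
strictly smaller than `1`. -/
theorem exists_measure_Icc_le_half (μ : Measure ℝ) {D : ℝ≥0∞} (hD : D ≠ ⊤)
    (hμD : μ ≤ D • volume) :
    ∃ τ : ℝ, 0 < τ ∧ μ (Set.Icc (-1) (-1 + τ)) ≤ ENNReal.ofReal (1 / 2) := by
  refine ⟨1 / (2 * (D.toReal + 1)), by positivity, (hμD _).trans ?_⟩
  rw [Measure.smul_apply, smul_eq_mul, Real.volume_Icc, ← ENNReal.ofReal_toReal hD,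
    ← ENNReal.ofReal_mul ENNReal.toReal_nonneg]
  apply ENNReal.ofReal_le_ofReal
  rw [ENNReal.toReal_ofReal ENNReal.toReal_nonneg]
  have := ENNReal.toReal_nonneg (a := D)
  rw [show -1 + 1 / (2 * (D.toReal + 1)) - -1 = 1 / (2 * (D.toReal + 1)) by ring,
    mul_one_div, div_le_div_iff₀ (by positivity) (by norm_num)]
  linarith

/-- The integrand decreases in `r`: it is at most its value at `-1` on `[-1, -1 + τ]` and its value
at `-1 + τ` beyond. Mass one half on the first interval is the worst case. -/
theorem lintegral_negMoment_le (μ : Measure ℝ) [IsProbabilityMeasure μ]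
    (hμ : ∀ᵐ r ∂μ, r ∈ Set.Icc (-1 : ℝ) 1) {τ : ℝ} (hτ : 0 < τ)
    (hτμ : μ (Set.Icc (-1) (-1 + τ)) ≤ ENNReal.ofReal (1 / 2)) {lam s b : ℝ} (hlam : 0 < lam)
    (hs : 0 < s) (hb : 0 < b) :
    ∫⁻ r, ENNReal.ofReal (((b + lam * (r + 1)) ^ s)⁻¹) ∂μ ≤
      ENNReal.ofReal (((b ^ s)⁻¹ + ((b + lam * τ) ^ s)⁻¹) / 2) := by
  set g₀ := (b ^ s)⁻¹ with hg₀
  set g₁ := ((b + lam * τ) ^ s)⁻¹ with hg₁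
  have hp : 0 < lam * τ := mul_pos hlam hτ
  have hg₁0 : 0 ≤ g₁ := by positivity
  have hg : g₁ ≤ g₀ := by
    rw [hg₀, hg₁]
    gcongr
    linarith
  calc _ ≤ ∫⁻ r, (ENNReal.ofReal g₁ +
        (Set.Icc (-1) (-1 + τ)).indicator (fun _ => ENNReal.ofReal (g₀ - g₁)) r) ∂μ := by
        refine lintegral_mono_ae ?_
        filter_upwards [hμ] with r hr
        have h0 : 0 ≤ lam * (r + 1) := mul_nonneg hlam.le (by linarith [hr.1])
        by_cases hm : r ∈ Set.Icc (-1) (-1 + τ)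
        · rw [Set.indicator_of_mem hm, ← ENNReal.ofReal_add hg₁0 (by linarith)]
          apply ENNReal.ofReal_le_ofReal
          rw [add_sub_cancel, hg₀]
          gcongr
          linarith
        · rw [Set.indicator_of_notMem hm, add_zero]
          apply ENNReal.ofReal_le_ofReal
          rw [hg₁]
          gcongr
          by_contra hc
          exact hm ⟨hr.1, by linarith [not_le.1 hc]⟩
    _ = ENNReal.ofReal g₁ + ENNReal.ofReal (g₀ - g₁) * μ (Set.Icc (-1) (-1 + τ)) := by
        rw [lintegral_add_left measurable_const, lintegral_indicator_const measurableSet_Icc]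
        simp
    _ ≤ ENNReal.ofReal g₁ + ENNReal.ofReal (g₀ - g₁) * ENNReal.ofReal (1 / 2) := by gcongr
    _ = _ := by
        rw [← ENNReal.ofReal_mul (by linarith), ← ENNReal.ofReal_add hg₁0 (by linarith)]
        congr 1
        ring

/-- For a small coupling margin `t`, the transfer of the `(1 - t)`-moment is a contraction. -/
theorem exists_contraction (hK : 1 < K) (μ : Measure ℝ) [IsProbabilityMeasure μ]
    (hμ : ∀ᵐ r ∂μ, r ∈ Set.Icc (-1 : ℝ) 1) {D : ℝ≥0∞} (hD : D ≠ ⊤)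
    (hμD : μ ≤ D • volume) {lam : ℝ} (hlam : 0 < lam) :
    ∃ t : ℝ, 0 < t ∧ t < 1 ∧ t < √K ∧ 1 / (√K - t) ≤ 1 / √K + 3 * t / 4 ∧
      K * ENNReal.ofReal ((1 / √K) ^ (1 - t)) *
        ∫⁻ r, ENNReal.ofReal (((√K + lam * (r + 1) - t) ^ (1 - t))⁻¹) ∂μ < 1 := by
  have hK2 : (2 : ℝ) ≤ K := by exact_mod_cast hK
  have hR : 0 < √(K : ℝ) := Real.sqrt_pos.2 (by linarith)
  have hR1 : 1 < √(K : ℝ) := by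
    rw [Real.lt_sqrt (by norm_num)]
    linarith
  have hRR : √(K : ℝ) * √K = K := Real.mul_self_sqrt (by positivity)
  obtain ⟨τ, hτ, hτμ⟩ := exists_measure_Icc_le_half μ hD hμD
  have hp : 0 < lam * τ := mul_pos hlam hτ
  -- An explicit majorant of the contraction factor, continuous at `t = 0`. Its value there is the
  -- mean of `1` and `√K/(√K + λτ)`, hence below `1`.
  set φ : ℝ → ℝ := fun t => K * (1 / √K) ^ (1 - t) *
    ((((√K - t) ^ (1 - t))⁻¹ + ((√K - t + lam * τ) ^ (1 - t))⁻¹) / 2) with hφ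
  have hcont : ContinuousAt φ 0 := by
    have h1 : ContinuousAt (fun t : ℝ => (1 / √(K : ℝ)) ^ (1 - t)) 0 :=
      ContinuousAt.rpow (by fun_prop) (by fun_prop) (Or.inl (by positivity))
    have h2 : ContinuousAt (fun t : ℝ => (√(K : ℝ) - t) ^ (1 - t)) 0 :=
      ContinuousAt.rpow (by fun_prop) (by fun_prop) (Or.inl (by simpa using hR.ne'))
    have h3 : ContinuousAt (fun t : ℝ => (√(K : ℝ) - t + lam * τ) ^ (1 - t)) 0 :=
      ContinuousAt.rpow (by fun_prop) (by fun_prop) (Or.inl (by simp; positivity))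
    have h4 := h2.inv₀ (by simp; positivity)
    have h5 := h3.inv₀ (by simp; positivity)
    exact (continuousAt_const.mul h1).mul ((h4.add h5).div_const 2)
  have hφ0 : φ 0 < 1 := by
    simp only [hφ, sub_zero, Real.rpow_one]
    have h1 : (√(K : ℝ) + lam * τ)⁻¹ < (√(K : ℝ))⁻¹ := by
      apply inv_strictAnti₀ hR
      linarith
    have h2 : (K : ℝ) * (1 / √K) = √K := by
      field_simp
      linarith
    rw [h2]
    calc _ < √(K : ℝ) * (((√(K : ℝ))⁻¹ + (√(K : ℝ))⁻¹) / 2) := by gcongr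
      _ = 1 := by field_simp; norm_num
  have hev : ∀ᶠ t in 𝓝[>] (0 : ℝ), φ t < 1 :=
    (hcont.eventually_lt continuousAt_const hφ0).filter_mono nhdsWithin_le_nhds
  have hev2 : ∀ᶠ t in 𝓝[>] (0 : ℝ), t < 1 / 4 :=
    (eventually_lt_nhds (by norm_num)).filter_mono nhdsWithin_le_nhds
  obtain ⟨t, ⟨ht1, ht2⟩, ht0⟩ := ((hev.and hev2).and self_mem_nhdsWithin).exists
  have ht0 : 0 < t := ht0
  refine ⟨t, ht0, by linarith, by linarith, ?_, ?_⟩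
  -- The slope of `1/(√K - t)` at `0` is `1/K ≤ 1/2`, so the slope `3/4` leaves room for `t < 1/4`.
  · have h1 : 0 < √(K : ℝ) - t := by linarith
    rw [div_le_iff₀ h1]
    have h2 : (1 / √(K : ℝ) + 3 * t / 4) * (√K - t) =
        1 + t * (3 / 4 * √K - 3 / 4 * t - 1 / √K) := by
      field_simp
      ring
    rw [h2]
    have h4 : √(K : ℝ) ≤ K - 1/2 := by nlinarith
    have h3 : 0 ≤ 3 / 4 * √(K : ℝ) - 3 / 4 * t - 1 / √K := by
      have h5 : 1 / √(K : ℝ) ≤ 3 / 4 * √K - 3 / 4 * t := by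
        rw [div_le_iff₀ hR]
        nlinarith
      linarith
    have := mul_nonneg ht0.le h3
    linarith
  · have h1 := lintegral_negMoment_le μ hμ hτ hτμ (s := 1 - t) (b := √K - t) hlam
      (by linarith) (by linarith)
    have h2 : ∀ r : ℝ, √(K : ℝ) - t + lam * (r + 1) = √K + lam * (r + 1) - t := fun r => by ring
    simp only [h2] at h1
    calc _ ≤ ENNReal.ofReal K * ENNReal.ofReal ((1 / √K) ^ (1 - t)) * ENNReal.ofReal
          ((((√K - t) ^ (1 - t))⁻¹ + ((√K - t + lam * τ) ^ (1 - t))⁻¹) / 2) := by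
          rw [ENNReal.ofReal_natCast]
          gcongr
      _ = ENNReal.ofReal (φ t) := by
          rw [← ENNReal.ofReal_mul (by positivity), ← ENNReal.ofReal_mul (by positivity)]
      _ < 1 := by
          rw [← ENNReal.ofReal_one]
          exact (ENNReal.ofReal_lt_ofReal_iff one_pos).2 ht1

theorem exists_edge_margin (hK : 0 < K) (M : ℕ) {c : ℝ} (hc : 0 < c) :
    ∃ ε : ℝ, 0 < ε ∧ ε ≤ c ∧ ε * ((2 * M + 1) * (2 * M + 2)) ≤ √K := by
  have hR : 0 < √(K : ℝ) := Real.sqrt_pos.2 (by exact_mod_cast hK)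
  refine ⟨min c (√K / ((2 * M + 1) * (2 * M + 2))), by positivity, min_le_left _ _, ?_⟩
  rw [← le_div_iff₀ (by positivity)]
  exact min_le_right _ _

/-- Near the bottom of the spectrum, all truncated Green functions are uniformly close to the one
at a fixed deep truncation. -/
theorem exists_truncDist_le (hK : 1 < K) (μ : Measure ℝ) [IsProbabilityMeasure μ]
    (hμ : ∀ᵐ r ∂μ, r ∈ Set.Icc (-1 : ℝ) 1) {D : ℝ≥0∞} (hD : D ≠ ⊤)
    (hμD : μ ≤ D • volume) {lam : ℝ} (hlam : 0 < lam) :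
    ∃ s : ℝ, 0 < s ∧ s < 1 ∧ ∀ H₀ : ℝ, 0 < H₀ → ∀ m₀ : ℕ, ∃ m ≥ m₀, ∃ ε > 0,
      (∀ z : ℂ, z.re ≤ -2 * √K - lam + ε → ∀ j ≤ m + 1, ∀ v : Vertex K → ℝ,
        (∀ x, v x ∈ Set.Icc (-1 : ℝ) 1) → ‖truncGreen lam z j v‖ ≤ 1 / √K) ∧
      ∀ z : ℂ, 0 < z.im → z.re ≤ -2 * √K - lam + ε → ∀ n ≥ m,
        truncDist K lam μ s z n m ≤ ENNReal.ofReal H₀ := by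
  have hK0 : 0 < K := by omega
  have hR : 0 < √(K : ℝ) := Real.sqrt_pos.2 (by exact_mod_cast hK0)
  obtain ⟨t, ht0, ht1, htK, hρ, hθ⟩ := exists_contraction hK μ hμ hD hμD hlam
  obtain ⟨C, hCtop, hC⟩ := exists_negMoment_bound μ hD hμD hlam (s := 1 - t) (by linarith)
    (by linarith)
  set s := 1 - t with hs
  have hs0 : 0 < s := by linarith
  have hs1 : s < 1 := by linarith
  refine ⟨s, hs0, hs1, fun H₀ hH₀ m₀ => ?_⟩
  set θ := K * ENNReal.ofReal ((1 / √K) ^ s) *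
    ∫⁻ r, ENNReal.ofReal (((√K + lam * (r + 1) - t) ^ s)⁻¹) ∂μ with hθdef
  set c₁ := K * ENNReal.ofReal ((1 / √K) ^ s) * C with hc₁
  set c₂ := c₁ * (ENNReal.ofReal (((t / 8) ^ s)⁻¹) * K) with hc₂
  have hc₁top : c₁ ≠ ⊤ := by finiteness
  have hc₂top : c₂ ≠ ⊤ := by finiteness
  have hθtop : θ ≠ ⊤ := ne_top_of_lt hθ
  -- The constants are chosen in the order `N`, `H`, `m`, `ε`. Here `N` makes the linear term at
  -- most `H/4` when the side distances are at most `2H`; then `H` is small enough for the quadratic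
  -- term `N c₂ (2H)²` to be at most `H/4`.
  obtain ⟨N, hN⟩ : ∃ N : ℕ, θ.toReal ^ N * c₁.toReal ≤ 1 / 8 := by
    have h1 : θ.toReal < 1 := by
      rw [← ENNReal.toReal_one]
      exact (ENNReal.toReal_lt_toReal hθtop ENNReal.one_ne_top).2 hθ
    have h2 := (tendsto_pow_atTop_nhds_zero_of_lt_one ENNReal.toReal_nonneg h1).mul_const c₁.toReal
    rw [zero_mul] at h2
    exact (h2.eventually (eventually_le_nhds (by norm_num))).exists
  obtain ⟨H, hH0, hHH₀, hH⟩ : ∃ H : ℝ, 0 < H ∧ H ≤ H₀ ∧ N * (c₂.toReal * 4 * H) ≤ 1 / 4 := by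
    refine ⟨min H₀ (1 / (16 * (N * c₂.toReal + 1))), by positivity, min_le_left _ _, ?_⟩
    have h1 := min_le_right H₀ (1 / (16 * (N * c₂.toReal + 1)))
    have h0 : (0 : ℝ) ≤ N * c₂.toReal := by positivity
    rw [le_div_iff₀ (by positivity)] at h1
    have h3 : 0 < min H₀ (1 / (16 * (N * c₂.toReal + 1))) := by positivity
    nlinarith
  obtain ⟨m, hmm₀, hm⟩ : ∃ m ≥ m₀, (1 / √K * (1 / √((m : ℝ) + 1))) ^ s ≤ H / 2 := by
    have h1 : Tendsto (fun m : ℕ => (1 / √(K : ℝ) * (1 / √((m : ℝ) + 1))) ^ s) atTop (𝓝 0) := by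
      have h2 : Tendsto (fun m : ℕ => 1 / √(K : ℝ) * (1 / √((m : ℝ) + 1))) atTop
          (𝓝 (1 / √K * 0)) := by
        refine Tendsto.const_mul _ ?_
        simp only [one_div]
        exact (Real.tendsto_sqrt_atTop.comp
          (tendsto_atTop_add_const_right _ 1 tendsto_natCast_atTop_atTop)).inv_tendsto_atTop
      have h3 := h2.rpow_const (p := s) (Or.inr hs0.le)
      rwa [mul_zero, Real.zero_rpow hs0.ne'] at h3
    exact ((eventually_ge_atTop m₀).and (h1.eventually (eventually_le_nhds (by linarith)))).exists
  -- The deterministic bounds are needed only up to depth `m + N + 2`, so `ε` may depend on `m` and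
  -- `N` but not on `n`.
  obtain ⟨ε, hε0, hεt, hεM⟩ := exists_edge_margin hK0 (m + N + 2) (c := t / 8) (by linarith)
  refine ⟨m, hmm₀, ε, hε0, fun z hre j hj v hv => truncGreen_norm_le' hK0 hlam.le hre hεM hε0.le
    (by omega) hv, fun z hz hre n => ?_⟩
  have hτ : ∀ r l, m ≤ l → l + r ≤ m + N + 2 →
      truncDist K lam μ s z (l + r) l ≤ ENNReal.ofReal (H / 2) := by
    intro r l hl hlr
    refine (truncDist_le_of_forall lam μ hs0 z _ _ hμ
      (truncGreen_dist_le hK0 hlam.le hz hre hεM hε0.le r l hlr)).trans ?_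
    apply ENNReal.ofReal_le_ofReal
    refine le_trans ?_ hm
    gcongr
  have hsymm : ∀ a b, truncDist K lam μ s z a b = truncDist K lam μ s z b a := fun a b => by
    simp only [truncDist, norm_sub_rev]
  suffices h : ∀ n ≥ m, truncDist K lam μ s z n m ≤ ENNReal.ofReal H from
    fun hn => (h n hn).trans (ENNReal.ofReal_le_ofReal hHH₀)
  intro n
  induction n using Nat.strong_induction_on with
  | _ n ih =>
    intro hn
    by_cases hnN : n ≤ m + N + 1
    · obtain ⟨r, rfl⟩ := Nat.exists_eq_add_of_le hn
      exact (hτ r m le_rfl (by omega)).trans (ENNReal.ofReal_le_ofReal (by linarith))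
    -- Comparing depth `n = p + N + 1` with `m + N + 1` allows `N` contracting generations after a
    -- first crude one. The side distances involve depths `p + j < n`, covered by induction. This
    -- gives `H/2`, and the deterministic distance from `m + N + 1` to `m` gives the other `H/2`.
    · obtain ⟨p, hp⟩ : ∃ p, n = p + N + 1 := ⟨n - N - 1, by omega⟩
      have hpm : m ≤ p := by omega
      have hside : ∀ j ≤ N, truncDist K lam μ s z (p + j) (m + j) ≤ ENNReal.ofReal (2 * H) := by
        intro j hj
        refine (truncDist_triangle lam μ hs0 hs1.le z (p + j) m (m + j)).trans ?_
        have h1 := ih (p + j) (by omega) (by omega)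
        have h2 := hτ j m le_rfl (by omega)
        rw [hsymm] at h2
        refine (add_le_add h1 h2).trans ?_
        rw [← ENNReal.ofReal_add hH0.le (by linarith)]
        exact ENNReal.ofReal_le_ofReal (by linarith)
      have hmain := weightedDist_iterate_le μ hlam hs0 hs1.le hK0 hz ht0 htK hρ
        (hre.trans (by linarith)) hμ (n := p) (m := m) (N := N)
        (fun j hj v hv => truncGreen_norm_le' hK0 hlam.le hre hεM hε0.le (by omega) hv)
        hC hθdef hθ.le hc₁ hc₂ hside N le_rfl 0 (by simp) (by
          rw [norm_zero]
          exact div_nonneg zero_le_one (by linarith))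
      rw [weightedDist_zero] at hmain
      have h1 : θ ^ N * (c₁ * ENNReal.ofReal (2 * H)) +
          N * (c₂ * ENNReal.ofReal (2 * H) * ENNReal.ofReal (2 * H)) ≤ ENNReal.ofReal (H / 2) := by
        rw [← ENNReal.ofReal_toReal hθtop, ← ENNReal.ofReal_toReal hc₁top,
          ← ENNReal.ofReal_toReal hc₂top, ← ENNReal.ofReal_natCast N,
          ← ENNReal.ofReal_pow (by positivity), ← ENNReal.ofReal_mul (by positivity),
          ← ENNReal.ofReal_mul (by positivity), ← ENNReal.ofReal_mul (by positivity),
          ← ENNReal.ofReal_mul (by positivity), ← ENNReal.ofReal_mul (by positivity),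
          ← ENNReal.ofReal_add (by positivity) (by positivity)]
        apply ENNReal.ofReal_le_ofReal
        nlinarith
      have h2 := hτ (N + 1) m le_rfl (by omega)
      rw [hp]
      refine (truncDist_triangle lam μ hs0 hs1.le z _ (m + N + 1) m).trans ?_
      refine (add_le_add (hmain.trans h1) h2).trans ?_
      rw [← ENNReal.ofReal_add (by linarith) (by linarith)]
      exact ENNReal.ofReal_le_ofReal (by linarith)

/-! ### Vertical limits of bounded analytic functions -/

/-- A function that is analytic and bounded in the upper half-plane has a limit at almost every
point of the real line, along the vertical direction. -/
theorem exists_vertical_limit_of_bounded {f : ℂ → ℂ} (hf : DifferentiableOn ℂ f {z | 0 < z.im})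
    {C : ℝ} (hC : ∀ z : ℂ, 0 < z.im → ‖f z‖ ≤ C) :
    ∀ᵐ E : ℝ, ∃ c : ℂ, Tendsto (fun η : ℝ => f (E + η * Complex.I)) (𝓝[>] 0) (𝓝 c) := by
  have hC0 : 0 ≤ C := (norm_nonneg _).trans (hC Complex.I (by simp))
  have hU : Convex ℝ {z : ℂ | 0 < z.im} := convex_halfSpace_im_gt 0
  have hUo : IsOpen {z : ℂ | 0 < z.im} := isOpen_lt continuous_const Complex.continuous_im
  -- A primitive of the bounded `f` is Lipschitz, so it extends to the plane and is differentiable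
  -- almost everywhere on the real line. At such a point the derivative `a` is shown to be the
  -- vertical limit of `f`.
  obtain ⟨F₀, hF₀⟩ := hU.exists_forall_hasDerivWithinAt hf
  have hlip : LipschitzOnWith C.toNNReal F₀ {z : ℂ | 0 < z.im} :=
    hU.lipschitzOnWith_of_nnnorm_hasDerivWithin_le hF₀ fun z hz => by
      rw [← NNReal.coe_le_coe, Real.coe_toNNReal _ hC0]
      exact hC z hz
  obtain ⟨F, hF, hFF₀⟩ := hlip.extend_finite_dimension
  have hFd : ∀ z : ℂ, 0 < z.im → HasDerivAt F (f z) z := fun z hz =>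
    ((hF₀ z hz).congr (fun w hw => (hFF₀ hw).symm) (hFF₀ hz).symm).hasDerivAt (hUo.mem_nhds hz)
  set L : ℝ := NNReal.toReal (lipschitzExtensionConstant ℂ * C.toNNReal) with hL
  have hFL : ∀ z w, ‖F z - F w‖ ≤ L * ‖z - w‖ := fun z w => by
    simpa only [dist_eq_norm] using hF.dist_le_mul z w
  have hreal : LipschitzWith (lipschitzExtensionConstant ℂ * C.toNNReal)
      (fun x : ℝ => F x) := LipschitzWith.of_dist_le_mul fun x y => by
    refine (hF.dist_le_mul _ _).trans ?_
    rw [Complex.dist_of_im_eq (by simp)]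
    simp
  filter_upwards [hreal.ae_differentiableAt_real] with E hE
  set a := deriv (fun x : ℝ => F x) E with ha
  have hEd : HasDerivAt (fun x : ℝ => F x) a E := hE.hasDerivAt
  refine ⟨a, ?_⟩
  have hL0 : 0 ≤ L := by rw [hL]; exact NNReal.coe_nonneg _
  have haL : ‖a‖ ≤ L := norm_deriv_le_of_lipschitz hreal
  rw [Metric.tendsto_nhdsWithin_nhds]
  intro ε hε
  obtain ⟨R, hR2, hR⟩ : ∃ R : ℝ, 2 ≤ R ∧ 16 * L / R ≤ ε / 80 := by
    refine ⟨max 2 (16 * L * 80 / ε), le_max_left _ _, ?_⟩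
    have h1 : 0 < max 2 (16 * L * 80 / ε) := lt_of_lt_of_le two_pos (le_max_left _ _)
    rw [div_le_iff₀ h1]
    have h2 := le_max_right 2 (16 * L * 80 / ε)
    rw [div_le_iff₀ hε] at h2
    linarith
  have hlit := hEd.isLittleO.def (c := ε / 80 / R) (by positivity)
  rw [Metric.eventually_nhds_iff] at hlit
  obtain ⟨δ, hδ, hδE⟩ := hlit
  refine ⟨δ / (2 * R), by positivity, fun {η} hη hηδ => ?_⟩
  have hη : 0 < η := hη
  rw [dist_zero_right, Real.norm_of_nonneg hη.le, lt_div_iff₀ (by positivity)] at hηδ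
  have hηC : (η : ℂ) ≠ 0 := by exact_mod_cast hη.ne'
  -- Blow-up at `E` on scale `η`: `h` is small on `[-R, R]`, grows at most linearly, and `h'(i) =
  -- f(E + iη) - a`.
  set h : ℂ → ℂ := fun w => (F (E + η * w) - F E) / η - a * w with hh
  have hhb : ∀ w, ‖h w‖ ≤ 2 * L * ‖w‖ := by
    intro w
    refine (norm_sub_le _ _).trans ?_
    rw [norm_div, norm_mul, Complex.norm_real, Real.norm_of_nonneg hη.le]
    have h1 := hFL (E + η * w) E
    rw [add_sub_cancel_left, norm_mul, Complex.norm_real, Real.norm_of_nonneg hη.le] at h1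
    have h2 : ‖F (E + η * w) - F E‖ / η ≤ L * ‖w‖ := by
      rw [div_le_iff₀ hη]
      linarith
    have h3 : ‖a‖ * ‖w‖ ≤ L * ‖w‖ := by gcongr
    linarith
  have hhr : ∀ x : ℝ, |x| ≤ R → ‖h x‖ ≤ ε / 80 := by
    intro x hx
    have h1 := @hδE (E + η * x) (by
      rw [Real.dist_eq, add_sub_cancel_left, abs_mul, abs_of_pos hη]
      nlinarith)
    have h2 : h x = ((F ((E + η * x : ℝ) : ℂ) - F E) - (E + η * x - E) • a) / η := by
      rw [hh]
      simp only [Complex.real_smul]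
      push_cast
      field_simp
      ring
    rw [h2, norm_div, Complex.norm_real, Real.norm_of_nonneg hη.le, div_le_iff₀ hη]
    refine h1.trans ?_
    rw [add_sub_cancel_left, norm_mul, Real.norm_of_nonneg hη.le, Real.norm_eq_abs]
    calc ε / 80 / R * (η * |x|) ≤ ε / 80 / R * (η * R) := by gcongr
      _ = _ := by field_simp
  have hhd : ∀ w : ℂ, 0 < w.im → HasDerivAt h (f (E + η * w) - a) w := by
    intro w hw
    have h1 : 0 < ((E : ℂ) + η * w).im := by simp; positivity
    have h2 : HasDerivAt (fun w : ℂ => (E : ℂ) + η * w) (η : ℂ) w := by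
      simpa using ((hasDerivAt_id w).const_mul (η : ℂ)).const_add (E : ℂ)
    have h3 := (((hFd _ h1).comp w h2).sub_const (F E)).div_const (η : ℂ)
    have h4 := h3.sub ((hasDerivAt_id w).const_mul a)
    have h5 : f (E + η * w) * η / η - a * 1 = f (E + η * w) - a := by field_simp
    rw [← h5]
    exact h4
  have hFc : Continuous F := hF.continuous
  have hhc : Continuous h := by
    rw [hh]
    fun_prop
  set U : Set ℂ := Metric.ball 0 R ∩ {w | 0 < w.im} with hUdef
  have hUop : IsOpen U := Metric.isOpen_ball.inter hUo
  have hcl : closure U ⊆ Metric.closedBall 0 R ∩ {w | 0 ≤ w.im} := by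
    refine closure_minimal (fun w hw => ⟨Metric.ball_subset_closedBall hw.1, le_of_lt (show 0 < w.im from hw.2)⟩) ?_
    exact Metric.isClosed_closedBall.inter (isClosed_le continuous_const Complex.continuous_im)
  have hden : ∀ w : ℂ, 0 ≤ w.im → 1 ≤ ‖w + Complex.I‖ := fun w hw => by
    refine le_trans ?_ (Complex.im_le_norm _)
    simp [hw]
  have hden0 : ∀ w : ℂ, 0 ≤ w.im → w + Complex.I ≠ 0 := fun w hw h0 => by
    have := hden w hw
    rw [h0, norm_zero] at this
    linarith
  -- Dividing by `(w + i)²` beats the linear growth on the arc `|w| = R`, so the maximum principle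
  -- on the half-disc gives smallness near `i`.
  have hdiff : DiffContOnCl ℂ (fun w => h w / (w + Complex.I) ^ 2) U := by
    constructor
    · intro w hw
      exact ((hhd w hw.2).differentiableAt.div (c := h) (d := fun w => (w + Complex.I) ^ 2)
        (by fun_prop) (pow_ne_zero 2 (hden0 w (le_of_lt (show 0 < w.im from hw.2))))).differentiableWithinAt
    · intro w hw
      exact (hhc.continuousAt.div (g := fun w => (w + Complex.I) ^ 2) (by fun_prop)
        (pow_ne_zero 2 (hden0 w (hcl hw).2))).continuousWithinAt
  have hfront : ∀ w ∈ frontier U, ‖h w / (w + Complex.I) ^ 2‖ ≤ ε / 80 := by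
    intro w hw
    rw [hUop.frontier_eq] at hw
    obtain ⟨hwR, hwim⟩ := hcl hw.1
    have hwim : 0 ≤ w.im := hwim
    rw [mem_closedBall_zero_iff] at hwR
    rw [norm_div, norm_pow]
    have h1 := hden w hwim
    rcases hwim.eq_or_lt with h0 | h0
    · have h2 : w = (w.re : ℂ) := Complex.ext (by simp) (by simp [← h0])
      have h3 := hhr w.re ((Complex.abs_re_le_norm w).trans hwR)
      rw [← h2] at h3
      exact (div_le_self (norm_nonneg _) (one_le_pow₀ h1)).trans h3
    · have h2 : ‖w‖ = R := by
        refine le_antisymm hwR (not_lt.1 fun hlt => hw.2 ⟨?_, h0⟩)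
        rwa [mem_ball_zero_iff]
      have h3 : R / 2 ≤ ‖w + Complex.I‖ := by
        have := norm_sub_le (w + Complex.I) Complex.I
        rw [add_sub_cancel_right, h2, Complex.norm_I] at this
        linarith
      calc ‖h w‖ / ‖w + Complex.I‖ ^ 2 ≤ (2 * L * R) / (R / 2) ^ 2 := by
            gcongr
            simpa [h2] using hhb w
        _ = 8 * L / R := by field_simp; ring
        _ ≤ 16 * L / R := by gcongr; norm_num
        _ ≤ _ := hR
  have hbound : ∀ w ∈ Metric.closedBall Complex.I (1 / 2), ‖h w‖ ≤ ε / 80 * 9 ∧ 0 < w.im := by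
    intro w hw
    rw [mem_closedBall_iff_norm] at hw
    have h1 : 1 / 2 ≤ w.im := by
      have := (Complex.abs_im_le_norm _).trans hw
      simp only [Complex.sub_im, Complex.I_im] at this
      linarith [(abs_le.1 this).1]
    have h2 : ‖w‖ ≤ 3 / 2 := by
      have := norm_add_le (w - Complex.I) Complex.I
      rw [sub_add_cancel, Complex.norm_I] at this
      linarith
    have h3 : w ∈ U := ⟨by rw [mem_ball_zero_iff]; linarith, show 0 < w.im by linarith⟩
    have h4 := Complex.norm_le_of_forall_mem_frontier_norm_le
      (Metric.isBounded_ball.subset Set.inter_subset_left) hdiff hfront (subset_closure h3)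
    refine ⟨?_, by linarith⟩
    have h5 := hden w (by linarith)
    have h6 : ‖w + Complex.I‖ ≤ 3 := by
      have := norm_add_le w Complex.I
      rw [Complex.norm_I] at this
      linarith
    rw [norm_div, norm_pow, div_le_iff₀ (by positivity)] at h4
    refine h4.trans ?_
    gcongr
    nlinarith
  -- Cauchy's estimate on the circle of radius `1/2` about `i` bounds `h'(i)`.
  have hderiv := Complex.norm_deriv_le_of_forall_mem_sphere_norm_le (f := h) (c := Complex.I)
    (R := 1 / 2) (C := ε / 80 * 9) (by norm_num) (by
      refine DifferentiableOn.diffContOnCl fun w hw => ?_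
      rw [closure_ball _ (by norm_num)] at hw
      exact (hhd w (hbound w hw).2).differentiableAt.differentiableWithinAt)
    (fun w hw => (hbound w (Metric.sphere_subset_closedBall hw)).1)
  rw [(hhd Complex.I (by simp)).deriv] at hderiv
  rw [dist_eq_norm]
  refine hderiv.trans_lt ?_
  linarith

/-! ### The Hamiltonian of a bounded potential and its resolvent -/

theorem memℓp_of_norm_le_mul {ι : Type*} {f g : ι → ℂ} {B : ℝ} (hg : Memℓp g 2)
    (h : ∀ i, ‖f i‖ ≤ B * ‖g i‖) : Memℓp f 2 := by
  have h2 : 0 < (2 : ℝ≥0∞).toReal := by norm_num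
  refine memℓp_gen ?_
  refine Summable.of_nonneg_of_le (fun i => by positivity) (fun i => ?_)
    ((hg.summable h2).mul_left (B ^ 2))
  simp only [ENNReal.toReal_ofNat, Real.rpow_ofNat]
  rw [← mul_pow]
  gcongr
  exact h i

theorem memℓp_of_finite_support {ι : Type*} {f : ι → ℂ} (hf : f.support.Finite) :
    Memℓp f 2 := by
  refine memℓp_gen (summable_of_hasFiniteSupport (hf.subset fun i hi => ?_))
  simp only [Function.mem_support] at hi ⊢
  rintro h0
  simp [h0] at hi

theorem memℓp_branchFun {ψ : Vertex K → ℂ} (hψ : Memℓp ψ 2) (b : Fin K) :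
    Memℓp (branchFun ψ b) 2 := by
  have h2 : 0 < (2 : ℝ≥0∞).toReal := by norm_num
  have hinj : Function.Injective (fun x : Vertex K => b :: x) := fun x y h => by
    simpa using h
  refine memℓp_gen ?_
  rw [← hinj.summable_iff]
  · simpa only [Function.comp_def, branchFun, if_true] using hψ.summable h2
  · rintro (_ | ⟨c, t⟩) hx
    · simp [branchFun]
    · have hc : c ≠ b := by
        rintro rfl
        exact hx ⟨t, rfl⟩
      simp [branchFun, hc]

theorem memℓp_comp_cons {ψ : Vertex K → ℂ} (hψ : Memℓp ψ 2) (b : Fin K) :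
    Memℓp (fun x : Vertex K => ψ (b :: x)) 2 := by
  have h2 : 0 < (2 : ℝ≥0∞).toReal := by norm_num
  have hinj : Function.Injective (fun x : Vertex K => b :: x) := fun x y h => by
    simpa using h
  exact memℓp_gen ((hψ.summable h2).comp_injective hinj)

/-- Transport to the branch `b` and restriction to that branch are mutually adjoint. The adjacency
operator is a sum of such pairs, hence symmetric. -/
theorem inner_branch (φ ψ : Hil K) (b : Fin K) :
    inner ℂ (⟨branchFun φ b, memℓp_branchFun (lp.memℓp φ) b⟩ : Hil K) ψ =
      inner ℂ φ (⟨fun x => ψ (b :: x), memℓp_comp_cons (lp.memℓp ψ) b⟩ : Hil K) := by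
  have hinj : Function.Injective (fun x : Vertex K => b :: x) := fun x y h => by
    simpa using h
  rw [lp.inner_eq_tsum, lp.inner_eq_tsum, ← hinj.tsum_eq]
  · simp [branchFun]
  · rintro (_ | ⟨c, t⟩) hx
    · simp [branchFun] at hx
    · by_cases hc : c = b
      · exact ⟨t, by rw [hc]⟩
      · simp [branchFun, hc] at hx

theorem adjFun_lp_eq (φ : Hil K) : (⟨adjFun φ, memℓp_adjFun (lp.memℓp φ)⟩ : Hil K) =
    ∑ b : Fin K, ((⟨branchFun φ b, memℓp_branchFun (lp.memℓp φ) b⟩ : Hil K) +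
      ⟨fun x => φ (b :: x), memℓp_comp_cons (lp.memℓp φ) b⟩) := by
  apply lp.ext
  rw [lp.coeFn_sum]
  exact adjFun_eq φ

theorem inner_adjFun (φ ψ : Hil K) :
    inner ℂ (⟨adjFun φ, memℓp_adjFun (lp.memℓp φ)⟩ : Hil K) ψ =
      inner ℂ φ (⟨adjFun ψ, memℓp_adjFun (lp.memℓp ψ)⟩ : Hil K) := by
  rw [adjFun_lp_eq, adjFun_lp_eq, sum_inner, inner_sum]
  refine Finset.sum_congr rfl fun b _ => ?_
  rw [inner_add_left, inner_add_right, inner_branch, ← inner_conj_symm _ ψ, ← inner_branch ψ φ b,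
    inner_conj_symm, add_comm]

section Bounded

variable {lam : ℝ} {v : Vertex K → ℝ}

theorem mem_hamiltonian_domain {B : ℝ} (hB : ∀ x, |lam * v x| ≤ B) (ψ : Hil K) :
    ψ ∈ (hamiltonian lam v).domain :=
  memℓp_of_norm_le_mul (lp.memℓp ψ) fun x => by
    rw [norm_mul, Complex.norm_real, Real.norm_eq_abs]
    gcongr
    exact hB x

/-- The Hamiltonian of a bounded potential, as an everywhere defined linear map. -/
noncomputable def hamLin {B : ℝ} (hB : ∀ x, |lam * v x| ≤ B) : Hil K →ₗ[ℂ] Hil K :=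
  (hamiltonian lam v).toFun ∘ₗ
    LinearMap.codRestrict _ LinearMap.id (mem_hamiltonian_domain hB)

theorem hamLin_apply {B : ℝ} (hB : ∀ x, |lam * v x| ≤ B) (ψ : Hil K) (x : Vertex K) :
    hamLin hB ψ x = adjFun ψ x + ((lam * v x : ℝ) : ℂ) * ψ x := rfl

theorem hamLin_eq {B : ℝ} (hB : ∀ x, |lam * v x| ≤ B) (ψ : Hil K)
    (h : ψ ∈ (hamiltonian lam v).domain) : hamiltonian lam v ⟨ψ, h⟩ = hamLin hB ψ := rfl

theorem hamLin_isSymmetric {B : ℝ} (hB : ∀ x, |lam * v x| ≤ B) : (hamLin hB).IsSymmetric := by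
  intro φ ψ
  have hd : ∀ ψ : Hil K, hamLin hB ψ = (⟨adjFun ψ, memℓp_adjFun (lp.memℓp ψ)⟩ : Hil K) +
      ⟨fun x => ((lam * v x : ℝ) : ℂ) * ψ x, mem_hamiltonian_domain hB ψ⟩ := fun ψ => rfl
  rw [hd, hd, inner_add_left, inner_add_right, inner_adjFun]
  congr 1
  rw [lp.inner_eq_tsum, lp.inner_eq_tsum]
  congr 1
  funext x
  simp only [RCLike.inner_apply, map_mul, Complex.conj_ofReal]
  ring

/-- The Hamiltonian of a bounded potential, as a bounded operator. -/
noncomputable def hamOp {B : ℝ} (hB : ∀ x, |lam * v x| ≤ B) : Hil K →L[ℂ] Hil K :=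
  -- Boundedness is the Hellinger–Toeplitz theorem for everywhere defined symmetric maps.
  ((hamLin_isSymmetric hB).toSelfAdjoint : Hil K →L[ℂ] Hil K)

theorem hamOp_apply {B : ℝ} (hB : ∀ x, |lam * v x| ≤ B) (ψ : Hil K) :
    hamOp hB ψ = hamLin hB ψ := rfl

theorem mem_resolventSet_hamOp {B : ℝ} (hB : ∀ x, |lam * v x| ≤ B) {z : ℂ} (hz : 0 < z.im) :
    z ∈ resolventSet ℂ (hamOp hB) := by
  by_contra h
  have h1 := (hamLin_isSymmetric hB).toSelfAdjoint.2.im_eq_zero_of_mem_spectrum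
    (z := z) h
  exact hz.ne' h1

theorem isResolvent_neg_resolvent {B : ℝ} (hB : ∀ x, |lam * v x| ≤ B) {z : ℂ} (hz : 0 < z.im) :
    IsResolvent (hamiltonian lam v) z (-resolvent (hamOp hB) z) := by
  have hu : IsUnit (algebraMap ℂ (Hil K →L[ℂ] Hil K) z - hamOp hB) :=
    mem_resolventSet_hamOp hB hz
  have h1 : ∀ φ, (algebraMap ℂ (Hil K →L[ℂ] Hil K) z - hamOp hB) (resolvent (hamOp hB) z φ) =
      φ := fun φ => congrArg (fun T : Hil K →L[ℂ] Hil K => T φ) (Ring.mul_inverse_cancel _ hu)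
  have h2 : ∀ φ, resolvent (hamOp hB) z ((algebraMap ℂ (Hil K →L[ℂ] Hil K) z - hamOp hB) φ) =
      φ := fun φ => congrArg (fun T : Hil K →L[ℂ] Hil K => T φ) (Ring.inverse_mul_cancel _ hu)
  have h3 : ∀ φ, (algebraMap ℂ (Hil K →L[ℂ] Hil K) z - hamOp hB) φ =
      z • φ - hamLin hB φ := fun φ => by
    simp [Algebra.algebraMap_eq_smul_one, hamOp_apply]
  refine ⟨fun φ => ⟨mem_hamiltonian_domain hB _, ?_⟩, fun ψ => ?_⟩
  · have h4 := h1 φ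
    rw [h3] at h4
    rw [hamLin_eq hB, neg_apply, map_neg, smul_neg, sub_neg_eq_add, neg_add_eq_sub, h4]
  · have h4 := h2 ψ
    rw [h3] at h4
    rw [show hamiltonian lam v ψ = hamLin hB (ψ : Hil K) from rfl,
      neg_apply, ← map_neg, neg_sub, h4]

theorem isResolvent_unique {E : Type*} [NormedAddCommGroup E] [NormedSpace ℂ E]
    {A : E →ₗ.[ℂ] E} {ζ : ℂ} {R R' : E →L[ℂ] E} (h : IsResolvent A ζ R)
    (h' : IsResolvent A ζ R') : R' = R := by
  ext φ
  obtain ⟨hd, he⟩ := h'.1 φ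
  exact (h.2 ⟨R' φ, hd⟩).symm.trans (congrArg R he)

theorem resolventOp_eq {B : ℝ} (hB : ∀ x, |lam * v x| ≤ B) {z : ℂ} (hz : 0 < z.im) :
    resolventOp (hamiltonian lam v) z = -resolvent (hamOp hB) z := by
  have h : ∃ R, IsResolvent (hamiltonian lam v) z R := ⟨_, isResolvent_neg_resolvent hB hz⟩
  rw [resolventOp, dif_pos h]
  exact isResolvent_unique (isResolvent_neg_resolvent hB hz) h.choose_spec

theorem inner_delta_left (x : Vertex K) (ψ : Hil K) : inner ℂ (delta x) ψ = ψ x := by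
  rw [delta, lp.inner_single_left]
  simp

theorem green_eq {B : ℝ} (hB : ∀ x, |lam * v x| ≤ B) {z : ℂ} (hz : 0 < z.im) (x y : Vertex K) :
    green lam v x y z = inner ℂ (delta x) (-resolvent (hamOp hB) z (delta y)) := by
  rw [green, resolventOp_eq hB hz]
  rfl

theorem differentiableOn_green {B : ℝ} (hB : ∀ x, |lam * v x| ≤ B) (x y : Vertex K) :
    DifferentiableOn ℂ (green lam v x y) {z | 0 < z.im} := by
  intro z hz
  have h1 : DifferentiableAt ℂ (resolvent (hamOp hB)) z :=
    (spectrum.hasDerivAt_resolvent_const_left (mem_resolventSet_hamOp hB hz)).differentiableAt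
  have h2 : DifferentiableAt ℂ (fun z => innerSL ℂ (delta x)
      (-resolvent (hamOp hB) z (delta y))) z :=
    (innerSL ℂ (delta x)).differentiableAt.comp z
      ((h1.clm_apply (differentiableAt_const (delta y))).neg)
  refine h2.differentiableWithinAt.congr (fun w hw => ?_) ?_
  · exact green_eq hB hw x y
  · exact green_eq hB hz x y

theorem im_inner_sub_smul {H : Hil K →ₗ[ℂ] Hil K} (hH : H.IsSymmetric) (z : ℂ) (ψ : Hil K) :
    (inner ℂ ψ (H ψ - z • ψ)).im = -(z.im * ‖ψ‖ ^ 2) := by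
  have h1 : (inner ℂ ψ (H ψ)).im = 0 := hH.im_inner_self_apply ψ
  rw [inner_sub_right, inner_smul_right, inner_self_eq_norm_sq_to_K, Complex.sub_im, h1]
  simp [Complex.mul_im, ← Complex.ofReal_pow]

theorem resolvent_spec {B : ℝ} (hB : ∀ x, |lam * v x| ≤ B) {z : ℂ} (hz : 0 < z.im) (φ : Hil K) :
    hamLin hB (-resolvent (hamOp hB) z φ) - z • (-resolvent (hamOp hB) z φ) = φ := by
  obtain ⟨_, h⟩ := (isResolvent_neg_resolvent hB hz).1 φ
  exact h

/-- The imaginary part equals `Im z · ‖ψ‖²` for the column `ψ` of the resolvent at `x`, which cannot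
vanish. -/
theorem green_im_pos {B : ℝ} (hB : ∀ x, |lam * v x| ≤ B) {z : ℂ} (hz : 0 < z.im) (x : Vertex K) :
    0 < (green lam v x x z).im := by
  rw [green_eq hB hz]
  set ψ := -resolvent (hamOp hB) z (delta x) with hψ
  have h1 : hamLin hB ψ - z • ψ = delta x := resolvent_spec hB hz _
  have h2 := im_inner_sub_smul (hamLin_isSymmetric hB) z ψ
  rw [h1, ← inner_conj_symm, Complex.conj_im, neg_inj] at h2
  rw [h2]
  have h3 : ψ ≠ 0 := by
    intro h0
    have h4 : (delta x : Hil K) x = 1 := by simp [delta]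
    rw [← h1, h0] at h4
    simp at h4
  positivity

end Bounded

/-! ### Convergence of the truncated Green functions -/

/-- Bounded vectors that leave every ball around the root tend weakly to zero: `w` is approximated
by finitely many of its coordinates, which `e n` eventually misses. -/
theorem tendsto_inner_of_escaping {w : Hil K} {e : ℕ → Hil K} {C : ℝ} (hC : ∀ n, ‖e n‖ ≤ C)
    (he : ∀ n x, x.length < n → e n x = 0) :
    Tendsto (fun n => inner ℂ w (e n)) atTop (𝓝 0) := by
  classical
  rw [Metric.tendsto_atTop]
  intro ε hε
  have hC0 : 0 ≤ C := (norm_nonneg _).trans (hC 0)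
  have hs : HasSum (fun x => lp.single 2 x (w x)) w := lp.hasSum_single ENNReal.ofNat_ne_top w
  obtain ⟨F, hF⟩ := ((Metric.tendsto_nhds.1 hs) (ε / (C + 1)) (by positivity)).exists
  refine ⟨F.sup List.length + 1, fun n hn => ?_⟩
  rw [dist_eq_norm, norm_sub_rev] at hF
  have h0 : inner ℂ (∑ x ∈ F, lp.single 2 x (w x)) (e n) = 0 := by
    rw [sum_inner]
    refine Finset.sum_eq_zero fun x hx => ?_
    rw [lp.inner_single_left, he n x, inner_zero_right]
    have := Finset.le_sup (f := List.length) hx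
    omega
  rw [dist_zero_right, ← sub_zero (inner ℂ w (e n)), ← h0, ← inner_sub_left]
  calc _ ≤ ‖w - ∑ x ∈ F, lp.single 2 x (w x)‖ * ‖e n‖ := norm_inner_le_norm _ _
    _ ≤ ε / (C + 1) * C := by
        gcongr
        exact hC n
    _ < ε := by
        rw [div_mul_eq_mul_div, div_lt_iff₀ (by positivity)]
        nlinarith

/-- The potential on the branch of the descendants of `x`. -/
def branchPot (v : Vertex K → ℝ) (x : Vertex K) : Vertex K → ℝ := fun t => v (t ++ x)

theorem childPot_branchPot (v : Vertex K → ℝ) (x : Vertex K) (a : Fin K) :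
    childPot (branchPot v x) a = branchPot v (a :: x) := by
  funext t
  simp [childPot, branchPot]

/-- The column of the resolvent of the tree truncated to the first `n` generations. -/
noncomputable def truncVec (lam : ℝ) (z : ℂ) (n : ℕ) (v : Vertex K → ℝ) : Vertex K → ℂ
  | [] => truncGreen lam z n v
  | a :: t => -truncGreen lam z (n - (t.length + 1)) (branchPot v (a :: t)) *
      truncVec lam z n v t

theorem truncVec_eq_zero (lam : ℝ) (z : ℂ) (n : ℕ) (v : Vertex K → ℝ) (x : Vertex K)
    (hx : n ≤ x.length) : truncVec lam z n v x = 0 := by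
  cases x with
  | nil =>
    obtain rfl : n = 0 := by simpa using hx
    rfl
  | cons a t =>
    rw [List.length_cons] at hx
    rw [truncVec, Nat.sub_eq_zero_of_le hx, truncGreen_zero, neg_zero, zero_mul]

theorem memℓp_truncVec (lam : ℝ) (z : ℂ) (n : ℕ) (v : Vertex K → ℝ) :
    Memℓp (truncVec lam z n v) 2 := by
  refine memℓp_of_finite_support ((List.finite_length_lt (Fin K) n).subset fun x hx => ?_)
  by_contra h
  exact hx (truncVec_eq_zero lam z n v x (not_lt.1 h))

/-- Passing to a child multiplies the column by minus the truncated Green function of its branch.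
The resolvent equation at `x` then reduces to the recursion at the root of the branch of `x`. -/
theorem truncVec_equation (lam : ℝ) {z : ℂ} (hz : 0 < z.im) (n : ℕ) (v : Vertex K → ℝ)
    (x : Vertex K) (hx : x.length < n) :
    adjFun (truncVec lam z n v) x + ((lam * v x : ℝ) : ℂ) * truncVec lam z n v x -
      z * truncVec lam z n v x = if x = [] then 1 else 0 := by
  have hkey : ∀ (k : ℕ) (w : Vertex K → ℝ), (((lam * w [] : ℝ) : ℂ) - z -
      ∑ a, truncGreen lam z k (childPot w a)) * truncGreen lam z (k + 1) w = 1 := fun k w => by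
    rw [truncGreen_succ, mul_inv_cancel₀ (ne_zero_of_im_neg (denom_im_neg lam hz k w))]
  obtain ⟨k, hk⟩ : ∃ k, n - x.length = k + 1 := ⟨n - x.length - 1, by omega⟩
  have hchild : ∑ a, truncVec lam z n v (a :: x) =
      -(∑ a, truncGreen lam z k (childPot (branchPot v x) a)) * truncVec lam z n v x := by
    rw [← Finset.sum_neg_distrib, Finset.sum_mul]
    refine Finset.sum_congr rfl fun a _ => ?_
    rw [truncVec, childPot_branchPot, show n - (x.length + 1) = k by omega]
  have h1 := hkey k (branchPot v x)
  have h2 : branchPot v x [] = v x := rfl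
  rw [h2] at h1
  cases x with
  | nil =>
    have h3 : branchPot v [] = v := by
      funext t
      simp [branchPot]
    rw [adjFun_nil, hchild, if_pos rfl]
    rw [List.length_nil, Nat.sub_zero] at hk
    rw [← hk, h3] at h1
    rw [h3, show truncVec lam z n v [] = truncGreen lam z n v from rfl]
    linear_combination h1
  | cons b t =>
    rw [adjFun_cons, hchild, if_neg (by simp)]
    rw [List.length_cons] at hk
    have h3 : truncVec lam z n v (b :: t) =
        -truncGreen lam z (k + 1) (branchPot v (b :: t)) * truncVec lam z n v t := by
      rw [truncVec, hk]
    rw [h3]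
    linear_combination (-truncVec lam z n v t) * h1

/-- The truncated Green functions converge to the Green function off the real axis. -/
theorem tendsto_truncGreen {lam : ℝ} {v : Vertex K → ℝ} {B : ℝ} (hB : ∀ x, |lam * v x| ≤ B)
    {z : ℂ} (hz : 0 < z.im) :
    Tendsto (fun n => truncGreen lam z n v) atTop (𝓝 (green lam v [] [] z)) := by
  set ψ : ℕ → Hil K := fun n => ⟨truncVec lam z n v, memℓp_truncVec lam z n v⟩ with hψ
  set e : ℕ → Hil K := fun n => hamLin hB (ψ n) - z • ψ n - delta [] with he
  have he0 : ∀ n x, x.length < n → e n x = 0 := by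
    intro n x hx
    have h1 := truncVec_equation lam hz n v x hx
    have h2 : (delta [] : Hil K) x = if x = [] then 1 else 0 := by
      simp [delta, Pi.single_apply]
    rw [he]
    simp only [lp.coeFn_sub, lp.coeFn_smul, Pi.sub_apply, Pi.smul_apply, smul_eq_mul]
    rw [h2, ← h1, hamLin_apply]
    exact sub_self _
  -- `ψ n` lives on the first `n` generations and the residual `e n` outside them. Hence `e n` drops
  -- out of the imaginary part of the energy identity, which gives a bound on `‖ψ n‖` uniform in
  -- `n`.
  have horth : ∀ n, inner ℂ (ψ n) (e n) = 0 := by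
    intro n
    rw [lp.inner_eq_tsum]
    refine (tsum_congr fun x => ?_).trans tsum_zero
    by_cases hx : x.length < n
    · rw [he0 n x hx, inner_zero_right]
    · rw [show ψ n x = 0 from truncVec_eq_zero lam z n v x (not_lt.1 hx), inner_zero_left]
  have hnorm : ∀ n, ‖ψ n‖ ≤ 1 / z.im := by
    intro n
    have h1 := im_inner_sub_smul (hamLin_isSymmetric hB) z (ψ n)
    have h2 : hamLin hB (ψ n) - z • ψ n = delta [] + e n := (add_sub_cancel _ _).symm
    rw [h2, inner_add_right, horth, add_zero] at h1
    have h3 : ‖inner ℂ (ψ n) (delta [])‖ ≤ ‖ψ n‖ * 1 := by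
      refine (norm_inner_le_norm _ _).trans (le_of_eq ?_)
      rw [delta, lp.norm_single (by norm_num), norm_one]
    have h4 := (Complex.abs_im_le_norm _).trans h3
    rw [h1, abs_neg, abs_of_nonneg (by positivity)] at h4
    rw [le_div_iff₀ hz]
    by_cases h0 : ‖ψ n‖ = 0
    · simp [h0]
    · have h5 : 0 < ‖ψ n‖ := lt_of_le_of_ne (norm_nonneg _) (Ne.symm h0)
      refine le_of_mul_le_mul_right ?_ h5
      linarith
  have heC : ∀ n, ‖e n‖ ≤ ‖hamOp hB‖ * (1 / z.im) + ‖z‖ * (1 / z.im) + 1 := by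
    intro n
    refine (norm_sub_le _ _).trans (add_le_add ((norm_sub_le _ _).trans (add_le_add ?_ ?_)) ?_)
    · rw [← hamOp_apply]
      exact ((hamOp hB).le_opNorm _).trans (by gcongr; exact hnorm n)
    · rw [norm_smul]
      gcongr
      exact hnorm n
    · rw [delta, lp.norm_single (by norm_num), norm_one]
  set R : Hil K →L[ℂ] Hil K := -resolvent (hamOp hB) z with hR
  have hRψ : ∀ n, ψ n - R (delta []) = R (e n) := by
    intro n
    have h1 := (isResolvent_neg_resolvent hB hz).2 ⟨ψ n, mem_hamiltonian_domain hB _⟩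
    have h2 : R (hamLin hB (ψ n) - z • ψ n) = ψ n := h1
    rw [he]
    simp only
    rw [map_sub, h2]
  -- The error at the root is `⟨δ, R e_n⟩ = ⟨R* δ, e_n⟩`, so weak convergence of the residual is
  -- enough.
  have hlim := tendsto_inner_of_escaping (w := ContinuousLinearMap.adjoint R (delta [])) heC he0
  have heq : ∀ n, truncGreen lam z n v = inner ℂ (ContinuousLinearMap.adjoint R (delta [])) (e n) +
      green lam v [] [] z := by
    intro n
    rw [ContinuousLinearMap.adjoint_inner_left, ← hRψ, green_eq hB hz, inner_sub_right,
      inner_delta_left]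
    change _ = truncGreen lam z n v - inner ℂ (delta []) (R (delta [])) +
      inner ℂ (delta []) (R (delta []))
    ring
  simp only [heq]
  simpa using hlim.add_const (green lam v [] [] z)

/-! ### Boundary values of the Green function -/

theorem lintegral_le_of_tendsto_ae {Ω : Type*} [MeasurableSpace Ω] {P : Measure Ω}
    {f : ℕ → Ω → ℝ≥0∞} {g : Ω → ℝ≥0∞} {C : ℝ≥0∞} (hf : ∀ n, AEMeasurable (f n) P)
    (hlim : ∀ᵐ ω ∂P, Tendsto (fun n => f n ω) atTop (𝓝 (g ω)))
    (hC : ∀ n, ∫⁻ ω, f n ω ∂P ≤ C) : ∫⁻ ω, g ω ∂P ≤ C := by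
  calc _ = ∫⁻ ω, liminf (fun n => f n ω) atTop ∂P := by
        refine lintegral_congr_ae ?_
        filter_upwards [hlim] with ω h
        exact h.liminf_eq.symm
    _ ≤ liminf (fun n => ∫⁻ ω, f n ω ∂P) atTop := lintegral_liminf_le' hf
    _ ≤ C := (liminf_le_liminf (Eventually.of_forall hC)).trans (by simp)

section Law

variable (μ : Measure ℝ) [IsProbabilityMeasure μ]

/-- Given all other sites, the Green function is `1/(λV(0) - w)` with `w` independent of `V(0)`, so
averaging over `V(0)` alone suffices, uniformly in `z` and `n`. -/
theorem lintegral_truncGreen_le (hK : 0 < K) {lam s : ℝ} (hs0 : 0 < s) {C : ℝ≥0∞}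
    (hC : ∀ w : ℂ, ∫⁻ r, ENNReal.ofReal ((‖((lam * r : ℝ) : ℂ) - w‖ ^ s)⁻¹) ∂μ ≤ C)
    (z : ℂ) (n : ℕ) :
    ∫⁻ v : Vertex K → ℝ, ENNReal.ofReal (‖truncGreen lam z n v‖ ^ s) ∂potLaw K μ ≤ C := by
  cases n with
  | zero => simp [truncGreen_zero, Real.zero_rpow hs0.ne']
  | succ n =>
    have hm : Measurable fun v : Vertex K → ℝ =>
        ENNReal.ofReal (‖truncGreen lam z (n + 1) v‖ ^ s) := by fun_prop
    rw [lintegral_glue μ ⟨0, hK⟩ hm]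
    have hval : ∀ (r : ℝ) (w u : Vertex K → ℝ),
        ‖truncGreen lam z (n + 1) (glue ⟨0, hK⟩ r w u)‖ ^ s =
        (‖((lam * r : ℝ) : ℂ) - (z + siblingSum lam z n ⟨0, hK⟩ w + truncGreen lam z n u)‖ ^ s)⁻¹ := by
      intro r w u
      rw [truncGreen_succ, glue_nil, ← Finset.add_sum_erase _ _ (Finset.mem_univ ⟨0, hK⟩),
        childPot_glue_self, Finset.sum_congr rfl fun b hb => by
          rw [childPot_glue_of_ne (Finset.ne_of_mem_erase hb)], norm_inv,
        Real.inv_rpow (norm_nonneg _)]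
      congr 3
      unfold siblingSum
      ring
    simp only [hval]
    calc _ ≤ ∫⁻ _ : Vertex K → ℝ, C ∂potLaw K μ := by
          refine lintegral_mono fun w => ?_
          have hg : Measurable fun p : ℝ × (Vertex K → ℝ) => truncGreen lam z n p.2 :=
            (measurable_truncGreen lam z n).comp measurable_snd
          simp only
          rw [lintegral_lintegral_swap (by fun_prop)]
          calc _ ≤ ∫⁻ _ : Vertex K → ℝ, C ∂potLaw K μ := lintegral_mono fun u => hC _
            _ = C := by simp
      _ = C := by simp

theorem lintegral_inv_truncGreen_le (hK : 0 < K) {lam s : ℝ} (hlam : 0 ≤ lam) (hs0 : 0 < s)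
    (hs1 : s ≤ 1) {C : ℝ≥0∞} (hμ : ∀ᵐ r ∂μ, r ∈ Set.Icc (-1 : ℝ) 1)
    (hC : ∀ w : ℂ, ∫⁻ r, ENNReal.ofReal ((‖((lam * r : ℝ) : ℂ) - w‖ ^ s)⁻¹) ∂μ ≤ C)
    {z : ℂ} {b : ℝ} (hb : ‖z‖ ≤ b) (n : ℕ) :
    ∫⁻ v : Vertex K → ℝ, ENNReal.ofReal (‖(truncGreen lam z n v)⁻¹‖ ^ s) ∂potLaw K μ ≤
      ENNReal.ofReal ((lam + b) ^ s) + K * C := by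
  have hb0 : 0 ≤ b := (norm_nonneg _).trans hb
  cases n with
  | zero => simp [truncGreen_zero, Real.zero_rpow hs0.ne']
  | succ n =>
    have h1 := lintegral_childSum_le (K := K) μ hs0 hs1 z n 0 Finset.univ (lam := lam)
    have h2 := lintegral_truncGreen_le (K := K) μ hK hs0 hC z n
    calc _ ≤ ∫⁻ v : Vertex K → ℝ, (ENNReal.ofReal ((lam + b) ^ s) +
          ENNReal.ofReal (‖∑ a, (truncGreen lam z n (childPot v a) -
            truncGreen lam z 0 (childPot v a))‖ ^ s)) ∂potLaw K μ := by
          refine lintegral_mono_ae ?_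
          filter_upwards [ae_potLaw_mem μ hμ] with v hv
          rw [← ENNReal.ofReal_add (by positivity) (by positivity)]
          apply ENNReal.ofReal_le_ofReal
          refine le_trans ?_ (Real.rpow_add_le_add_rpow (by positivity) (norm_nonneg _) hs0.le hs1)
          refine Real.rpow_le_rpow (norm_nonneg _) ?_ hs0.le
          rw [truncGreen_succ, inv_inv]
          simp only [truncGreen_zero, sub_zero]
          refine (norm_sub_le _ _).trans (add_le_add ((norm_sub_le _ _).trans
            (add_le_add ?_ hb)) le_rfl)
          rw [Complex.norm_real, norm_mul, Real.norm_of_nonneg hlam]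
          exact mul_le_of_le_one_right hlam (abs_le.2 (hv []))
      _ ≤ _ := by
          rw [lintegral_add_left measurable_const, lintegral_const, measure_univ, mul_one]
          gcongr
          refine h1.trans ?_
          gcongr
          simpa [truncDist, truncGreen_zero] using h2

/-- In the difference of the inverses the root term cancels, leaving only the children one
generation shallower. -/
theorem lintegral_inv_sub_le {lam s : ℝ} (hs0 : 0 < s) (hs1 : s ≤ 1) (z : ℂ) (n m : ℕ) :
    ∫⁻ v : Vertex K → ℝ, ENNReal.ofReal (‖(truncGreen lam z (n + 1) v)⁻¹ -
      (truncGreen lam z (m + 1) v)⁻¹‖ ^ s) ∂potLaw K μ ≤ K * truncDist K lam μ s z n m := by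
  refine le_trans (le_of_eq ?_)
    (lintegral_childSum_le (K := K) μ hs0 hs1 z n m Finset.univ (lam := lam))
  congr 1
  funext v
  rw [truncGreen_succ, truncGreen_succ, inv_inv, inv_inv, Finset.sum_sub_distrib, ← norm_neg]
  congr 3
  ring

end Law

/-- The Green function at the root for potentials with values in `[-1, 1]`, and `0` for all other
potentials. -/
noncomputable def boxGreen (lam : ℝ) (z : ℂ) (v : Vertex K → ℝ) : ℂ :=
  {v : Vertex K → ℝ | ∀ x, v x ∈ Set.Icc (-1 : ℝ) 1}.indicator (fun v => green lam v [] [] z) v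

theorem measurableSet_box : MeasurableSet {v : Vertex K → ℝ | ∀ x, v x ∈ Set.Icc (-1 : ℝ) 1} := by
  have h : {v : Vertex K → ℝ | ∀ x, v x ∈ Set.Icc (-1 : ℝ) 1} =
      ⋂ x, (fun v => v x) ⁻¹' Set.Icc (-1 : ℝ) 1 := by
    ext v
    simp
  rw [h]
  exact MeasurableSet.iInter fun x => measurableSet_Icc.preimage (by fun_prop)

theorem boxGreen_eq (lam : ℝ) (z : ℂ) {v : Vertex K → ℝ} (hv : ∀ x, v x ∈ Set.Icc (-1 : ℝ) 1) :
    boxGreen lam z v = green lam v [] [] z :=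
  Set.indicator_of_mem (s := {v : Vertex K → ℝ | ∀ x, v x ∈ Set.Icc (-1 : ℝ) 1}) hv _

theorem abs_mul_le_of_box {lam : ℝ} (hlam : 0 ≤ lam) {v : Vertex K → ℝ}
    (hv : ∀ x, v x ∈ Set.Icc (-1 : ℝ) 1) (x : Vertex K) : |lam * v x| ≤ lam := by
  rw [abs_mul, abs_of_nonneg hlam]
  exact mul_le_of_le_one_right hlam (abs_le.2 (hv x))

theorem tendsto_boxGreen {lam : ℝ} (hlam : 0 ≤ lam) {z : ℂ} (hz : 0 < z.im) {v : Vertex K → ℝ}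
    (hv : ∀ x, v x ∈ Set.Icc (-1 : ℝ) 1) :
    Tendsto (fun n => truncGreen lam z n v) atTop (𝓝 (boxGreen lam z v)) := by
  rw [boxGreen_eq lam z hv]
  exact tendsto_truncGreen (abs_mul_le_of_box hlam hv) hz

theorem measurable_boxGreen_vertical {lam : ℝ} (hlam : 0 ≤ lam) {η : ℝ} (hη : 0 < η) :
    Measurable fun p : ℝ × (Vertex K → ℝ) => boxGreen lam (p.1 + η * Complex.I) p.2 := by
  have hm : ∀ n, Measurable fun p : ℝ × (Vertex K → ℝ) =>
      {v : Vertex K → ℝ | ∀ x, v x ∈ Set.Icc (-1 : ℝ) 1}.indicator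
        (fun v => truncGreen lam (p.1 + η * Complex.I) n v) p.2 := by
    intro n
    have h1 : Measurable fun p : ℝ × (Vertex K → ℝ) =>
        truncGreen lam (p.1 + η * Complex.I) n p.2 :=
      (measurable_truncGreen_prod lam n).comp
        (f := fun p : ℝ × (Vertex K → ℝ) => ((p.1 : ℂ) + η * Complex.I, p.2)) (by fun_prop)
    exact h1.indicator (measurableSet_box.preimage measurable_snd)
  refine measurable_of_tendsto_metrizable hm ?_
  rw [tendsto_pi_nhds]
  intro p
  by_cases hp : p.2 ∈ {v : Vertex K → ℝ | ∀ x, v x ∈ Set.Icc (-1 : ℝ) 1}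
  · simp only [Set.indicator_of_mem hp]
    exact tendsto_boxGreen hlam (by simpa using hη) hp
  · simp only [Set.indicator_of_notMem hp, boxGreen]
    exact tendsto_const_nhds

/-- Restricting to rational heights makes the existence of the limit a measurable event, as Fubini
requires; continuity recovers the full limit. -/
theorem tendsto_nhdsGT_of_tendsto_rat {g : ℝ → ℂ} (hg : ContinuousOn g (Set.Ioi 0)) {c : ℂ}
    (h : Tendsto (fun q : Set.Ioi (0 : ℚ) => g (q : ℚ))
      (comap (fun q : Set.Ioi (0 : ℚ) => ((q : ℚ) : ℝ)) (𝓝 0)) (𝓝 c)) :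
    Tendsto g (𝓝[>] 0) (𝓝 c) := by
  rw [Metric.tendsto_nhdsWithin_nhds]
  intro ε hε
  have h1 := (Metric.tendsto_nhds.1 h) (ε / 2) (by positivity)
  rw [eventually_comap, Metric.eventually_nhds_iff] at h1
  obtain ⟨δ, hδ, h1⟩ := h1
  refine ⟨δ, hδ, fun {η} hη hηδ => ?_⟩
  have hη : 0 < η := hη
  rw [dist_zero_right, Real.norm_of_nonneg hη.le] at hηδ
  by_contra hc
  have h2 : ∀ᶠ x in 𝓝 η, ε / 2 < dist (g x) c := by
    have h3 : ContinuousAt (fun x => dist (g x) c) η :=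
      (hg.continuousAt (Ioi_mem_nhds hη)).dist continuousAt_const
    exact h3.eventually_const_lt (by linarith [not_lt.1 hc])
  have h4 := (h2.and (Ioo_mem_nhds hη hηδ))
  obtain ⟨U, hU, hUo, hUη⟩ := eventually_nhds_iff.1 h4
  obtain ⟨q, hq⟩ := Rat.denseRange_cast.exists_mem_open hUo ⟨η, hUη⟩
  obtain ⟨h5, h6⟩ := hU _ hq
  have h7 : (0 : ℚ) < q := by exact_mod_cast h6.1
  have h8 := h1 (y := q) (by
    rw [dist_zero_right, Real.norm_of_nonneg h6.1.le]
    exact h6.2) ⟨q, h7⟩ rfl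
  exact absurd h8 (not_lt.2 h5.le)

/-- The Cayley transform of the upper half-plane onto the unit disc. -/
noncomputable def cayley (w : ℂ) : ℂ := (w - Complex.I) / (w + Complex.I)

theorem add_I_ne_zero {w : ℂ} (hw : 0 ≤ w.im) : w + Complex.I ≠ 0 := by
  intro h
  have := congrArg Complex.im h
  simp at this
  linarith

theorem norm_cayley_le {w : ℂ} (hw : 0 ≤ w.im) : ‖cayley w‖ ≤ 1 := by
  rw [cayley, norm_div]
  refine div_le_one_of_le₀ ?_ (norm_nonneg _)
  rw [← sq_le_sq₀ (norm_nonneg _) (norm_nonneg _), Complex.sq_norm, Complex.sq_norm,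
    Complex.normSq_apply, Complex.normSq_apply]
  simp
  nlinarith

theorem one_sub_cayley {w : ℂ} (hw : 0 ≤ w.im) :
    1 - cayley w = 2 * Complex.I / (w + Complex.I) := by
  have := add_I_ne_zero hw
  rw [cayley]
  field_simp
  ring

theorem one_add_cayley {w : ℂ} (hw : 0 ≤ w.im) : 1 + cayley w = 2 * w / (w + Complex.I) := by
  have := add_I_ne_zero hw
  rw [cayley]
  field_simp
  ring

theorem eq_of_cayley {w : ℂ} (hw : 0 ≤ w.im) :
    w = Complex.I * (1 + cayley w) / (1 - cayley w) := by
  have h := add_I_ne_zero hw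
  rw [one_sub_cayley hw, one_add_cayley hw]
  field_simp

theorem boxGreen_im_nonneg {lam : ℝ} (hlam : 0 ≤ lam) {z : ℂ} (hz : 0 < z.im)
    (v : Vertex K → ℝ) : 0 ≤ (boxGreen lam z v).im := by
  by_cases hp : v ∈ {v : Vertex K → ℝ | ∀ x, v x ∈ Set.Icc (-1 : ℝ) 1}
  · rw [boxGreen_eq lam z hp]
    exact (green_im_pos (abs_mul_le_of_box hlam hp) hz []).le
  · rw [boxGreen, Set.indicator_of_notMem hp]
    simp

theorem differentiableOn_boxGreen {lam : ℝ} (hlam : 0 ≤ lam) (v : Vertex K → ℝ) :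
    DifferentiableOn ℂ (fun z => boxGreen lam z v) {z | 0 < z.im} := by
  by_cases hp : v ∈ {v : Vertex K → ℝ | ∀ x, v x ∈ Set.Icc (-1 : ℝ) 1}
  · simp only [boxGreen_eq lam _ hp]
    exact differentiableOn_green (abs_mul_le_of_box hlam hp) [] []
  · simp only [boxGreen, Set.indicator_of_notMem hp]
    exact differentiableOn_const 0

theorem differentiableOn_cayley_boxGreen {lam : ℝ} (hlam : 0 ≤ lam) (v : Vertex K → ℝ) :
    DifferentiableOn ℂ (fun z => cayley (boxGreen lam z v)) {z | 0 < z.im} := by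
  have h := differentiableOn_boxGreen hlam v
  exact (h.sub_const _).div (h.add_const _) fun z hz => add_I_ne_zero (boxGreen_im_nonneg hlam hz v)

/-- For almost every energy, the Cayley transform of the Green function has almost surely a
boundary value. -/
theorem ae_ae_exists_cayley_limit {lam : ℝ} (hlam : 0 ≤ lam) (Q : Measure (Vertex K → ℝ))
    [SFinite Q] : ∀ᵐ E : ℝ, ∀ᵐ v ∂Q, ∃ c : ℂ,
      Tendsto (fun η : ℝ => cayley (boxGreen lam (E + η * Complex.I) v)) (𝓝[>] 0) (𝓝 c) := by
  set p : ℝ → (Vertex K → ℝ) → Prop := fun E v => ∃ c : ℂ,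
    Tendsto (fun q : Set.Ioi (0 : ℚ) =>
      cayley (boxGreen lam (E + ((q : ℚ) : ℝ) * Complex.I) v))
      (comap (fun q : Set.Ioi (0 : ℚ) => ((q : ℚ) : ℝ)) (𝓝 0)) (𝓝 c) with hp
  have hmeas : MeasurableSet {x : ℝ × (Vertex K → ℝ) | p x.1 x.2} := by
    refine measurableSet_exists_tendsto fun q => ?_
    have hq : (0 : ℝ) < ((q : ℚ) : ℝ) := by exact_mod_cast q.2
    have := measurable_boxGreen_vertical (K := K) hlam hq
    unfold cayley
    fun_prop
  have h1 : ∀ᵐ v ∂Q, ∀ᵐ E : ℝ, p E v := by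
    refine Eventually.of_forall fun v => ?_
    filter_upwards [exists_vertical_limit_of_bounded (differentiableOn_cayley_boxGreen hlam v)
      fun z hz => norm_cayley_le (boxGreen_im_nonneg hlam hz v)] with E ⟨c, hc⟩
    refine ⟨c, hc.comp ?_⟩
    refine tendsto_nhdsWithin_iff.2 ⟨tendsto_comap, Eventually.of_forall fun q => ?_⟩
    exact (Rat.cast_pos (K := ℝ)).2 q.2
  -- Fubini exchanges "for every potential, almost every energy" with "for almost every energy,
  -- almost every potential".
  filter_upwards [(Measure.ae_ae_comm hmeas).2 h1] with E hE
  filter_upwards [hE] with v ⟨c, hc⟩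
  refine ⟨c, tendsto_nhdsGT_of_tendsto_rat ?_ hc⟩
  refine (differentiableOn_cayley_boxGreen hlam v).continuousOn.comp (by fun_prop) ?_
  intro η hη
  simpa using hη

/-! ### The Lyapunov exponent at almost every energy -/

theorem boxGreen_ne_zero {lam : ℝ} (hlam : 0 ≤ lam) {z : ℂ} (hz : 0 < z.im) {v : Vertex K → ℝ}
    (hv : ∀ x, v x ∈ Set.Icc (-1 : ℝ) 1) : boxGreen lam z v ≠ 0 := by
  intro h
  have := green_im_pos (abs_mul_le_of_box hlam hv) hz []
  rw [← boxGreen_eq lam z hv, h] at this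
  simp at this

theorem measurable_boxGreen {lam : ℝ} (hlam : 0 ≤ lam) (E : ℝ) {η : ℝ} (hη : 0 < η) :
    Measurable fun v : Vertex K → ℝ => boxGreen lam (E + η * Complex.I) v := by
  have h := (measurable_boxGreen_vertical (K := K) hlam hη).comp
    (measurable_prodMk_left (x := E))
  simpa only [Function.comp_def] using h

/-- The heights `1 / (k + 1)` along which boundary values are taken. -/
noncomputable def height (k : ℕ) : ℝ := 1 / ((k : ℝ) + 1)

theorem height_pos (k : ℕ) : 0 < height k := by
  unfold height
  positivity

theorem height_le_one (k : ℕ) : height k ≤ 1 := by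
  unfold height
  rw [div_le_one (by positivity)]
  linarith [show (0 : ℝ) ≤ k from Nat.cast_nonneg k]

theorem tendsto_height : Tendsto height atTop (𝓝[>] 0) :=
  tendsto_nhdsWithin_iff.2 ⟨tendsto_one_div_add_atTop_nhds_zero_nat,
    Eventually.of_forall height_pos⟩

/-- By Fatou's lemma the lower limit is almost surely finite. Boundedness along a subsequence is all
that is needed, since the Cayley transform is already known to converge. -/
theorem frequently_le_of_lintegral_le {Ω : Type*} [MeasurableSpace Ω] {P : Measure Ω}
    {f : ℕ → Ω → ℝ} (hf : ∀ n, Measurable (f n)) {C : ℝ≥0∞} (hCtop : C ≠ ⊤)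
    (hC : ∀ n, ∫⁻ ω, ENNReal.ofReal (f n ω) ∂P ≤ C) :
    ∀ᵐ ω ∂P, ∃ B : ℝ, ∃ᶠ n in atTop, f n ω ≤ B := by
  have h1 : ∫⁻ ω, liminf (fun n => ENNReal.ofReal (f n ω)) atTop ∂P ≤ C :=
    (lintegral_liminf_le fun n => (hf n).ennreal_ofReal).trans
      ((liminf_le_liminf (Eventually.of_forall hC)).trans (by simp))
  have h2 := ae_lt_top (Measurable.liminf fun n => (hf n).ennreal_ofReal)
    (ne_top_of_le_ne_top hCtop h1)
  filter_upwards [h2] with ω hω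
  obtain ⟨b, hb1, hb2⟩ := exists_between hω
  refine ⟨b.toReal, (frequently_lt_of_liminf_lt (by isBoundedDefault) hb1).mono fun n hn => ?_⟩
  exact (ENNReal.ofReal_le_iff_le_toReal hb2.ne).1 hn.le

theorem rpow_le_imp_le {x s B : ℝ} (hx : 0 ≤ x) (hs : 0 < s) (h : x ^ s ≤ B) :
    x ≤ B ^ s⁻¹ := by
  rwa [Real.le_rpow_inv_iff_of_pos hx ((Real.rpow_nonneg hx s).trans h) hs]

/-- A function with values in the closed upper half-plane whose Cayley transform has a limit has
a finite nonzero limit unless it diverges or vanishes along every sequence. -/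
theorem exists_limit_of_cayley {g : ℝ → ℂ} (hg : ∀ η, 0 < η → 0 ≤ (g η).im)
    (hg0 : ∀ η, 0 < η → g η ≠ 0) {c : ℂ}
    (hc : Tendsto (fun η => cayley (g η)) (𝓝[>] 0) (𝓝 c)) {B : ℝ}
    (hB : ∃ᶠ k in atTop, ‖g (height k)‖ ≤ B ∧ ‖(g (height k))⁻¹‖ ≤ B) :
    ∃ a : ℂ, a ≠ 0 ∧ Tendsto g (𝓝[>] 0) (𝓝 a) := by
  have hseq := hc.comp tendsto_height
  have hB0 : 0 ≤ B := by
    obtain ⟨k, hk⟩ := hB.exists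
    exact (norm_nonneg _).trans hk.1
  have hle : ∀ w : ℂ, ‖w‖ ≤ B → ‖w + Complex.I‖ ≤ B + 1 := fun w hw =>
    (norm_add_le _ _).trans (by rw [Complex.norm_I]; linarith)
  -- The Cayley transform sends `∞` to `1` and `0` to `-1`. Boundedness of `g` along a subsequence
  -- excludes the first limit, boundedness of `g⁻¹` as well excludes the second.
  have hc1 : 1 - c ≠ 0 := by
    intro h0
    have h1 := (tendsto_const_nhds.sub hseq : Tendsto (fun k => (1 : ℂ) - _) _ _).norm
    rw [h0, norm_zero] at h1
    have h2 := h1.eventually (eventually_lt_nhds (show (0 : ℝ) < 2 / (B + 1) by positivity))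
    obtain ⟨k, hk1, hk2⟩ := (hB.and_eventually h2).exists
    simp only [Function.comp] at hk2
    have h3 := add_I_ne_zero (hg _ (height_pos k))
    rw [one_sub_cayley (hg _ (height_pos k)), norm_div, norm_mul, Complex.norm_I,
      Complex.norm_ofNat, mul_one, div_lt_div_iff_of_pos_left two_pos (by positivity)
      (by positivity)] at hk2
    linarith [hle _ hk1.1]
  have hc2 : 1 + c ≠ 0 := by
    intro h0
    have h1 := (tendsto_const_nhds.add hseq : Tendsto (fun k => (1 : ℂ) + _) _ _).norm
    rw [h0, norm_zero] at h1
    have h2 := h1.eventually (eventually_lt_nhds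
      (show (0 : ℝ) < 2 / ((B + 1) * (B + 1)) by positivity))
    obtain ⟨k, hk1, hk2⟩ := (hB.and_eventually h2).exists
    simp only [Function.comp] at hk2
    have h3 := add_I_ne_zero (hg _ (height_pos k))
    have h4 := hg0 _ (height_pos k)
    have h5 : 1 + cayley (g (height k)) =
        2 / ((g (height k))⁻¹ * (g (height k) + Complex.I)) := by
      rw [one_add_cayley (hg _ (height_pos k))]
      field_simp
    rw [h5, norm_div, norm_mul, Complex.norm_ofNat,
      div_lt_div_iff_of_pos_left two_pos
        (mul_pos (norm_pos_iff.2 (inv_ne_zero h4)) (norm_pos_iff.2 h3)) (by positivity)] at hk2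
    have h6 : ‖(g (height k))⁻¹‖ * ‖g (height k) + Complex.I‖ ≤ (B + 1) * (B + 1) := by
      gcongr
      · linarith [hk1.2]
      · exact hle _ hk1.1
    linarith
  refine ⟨Complex.I * (1 + c) / (1 - c), div_ne_zero (mul_ne_zero Complex.I_ne_zero hc2) hc1, ?_⟩
  have hlim : Tendsto (fun η => Complex.I * (1 + cayley (g η)) / (1 - cayley (g η))) (𝓝[>] 0)
      (𝓝 (Complex.I * (1 + c) / (1 - c))) :=
    (tendsto_const_nhds.mul (tendsto_const_nhds.add hc)).div (tendsto_const_nhds.sub hc) hc1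
  refine hlim.congr' ?_
  filter_upwards [self_mem_nhdsWithin] with η hη
  exact (eq_of_cayley (hg η hη)).symm

theorem abs_log_le {x s : ℝ} (hx : 0 < x) (hs : 0 < s) :
    |Real.log x| ≤ (x ^ s + x⁻¹ ^ s) / s := by
  have h1 := Real.log_le_rpow_div hx.le hs
  have h2 := Real.log_le_rpow_div (inv_pos.2 hx).le hs
  rw [Real.log_inv] at h2
  have h3 : 0 ≤ x ^ s / s := by positivity
  have h4 : 0 ≤ x⁻¹ ^ s / s := by positivity
  rw [add_div, abs_le]
  constructor <;> linarith

section Law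

variable (μ : Measure ℝ) [IsProbabilityMeasure μ]

theorem lintegral_boxGreen_le (hK : 0 < K) {lam s : ℝ} (hlam : 0 ≤ lam) (hs0 : 0 < s) {C : ℝ≥0∞}
    (hμ : ∀ᵐ r ∂μ, r ∈ Set.Icc (-1 : ℝ) 1)
    (hC : ∀ w : ℂ, ∫⁻ r, ENNReal.ofReal ((‖((lam * r : ℝ) : ℂ) - w‖ ^ s)⁻¹) ∂μ ≤ C)
    {z : ℂ} (hz : 0 < z.im) :
    ∫⁻ v : Vertex K → ℝ, ENNReal.ofReal (‖boxGreen lam z v‖ ^ s) ∂potLaw K μ ≤ C := by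
  refine lintegral_le_of_tendsto_ae (fun n => Measurable.aemeasurable (by fun_prop)) ?_
    (lintegral_truncGreen_le μ hK hs0 hC z)
  filter_upwards [ae_potLaw_mem μ hμ] with v hv
  exact ENNReal.tendsto_ofReal ((tendsto_boxGreen hlam hz hv).norm.rpow_const (Or.inr hs0.le))

theorem lintegral_inv_boxGreen_le (hK : 0 < K) {lam s : ℝ} (hlam : 0 ≤ lam) (hs0 : 0 < s)
    (hs1 : s ≤ 1) {C : ℝ≥0∞} (hμ : ∀ᵐ r ∂μ, r ∈ Set.Icc (-1 : ℝ) 1)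
    (hC : ∀ w : ℂ, ∫⁻ r, ENNReal.ofReal ((‖((lam * r : ℝ) : ℂ) - w‖ ^ s)⁻¹) ∂μ ≤ C)
    {z : ℂ} (hz : 0 < z.im) {b : ℝ} (hb : ‖z‖ ≤ b) :
    ∫⁻ v : Vertex K → ℝ, ENNReal.ofReal (‖(boxGreen lam z v)⁻¹‖ ^ s) ∂potLaw K μ ≤
      ENNReal.ofReal ((lam + b) ^ s) + K * C := by
  refine lintegral_le_of_tendsto_ae (fun n => Measurable.aemeasurable (by fun_prop)) ?_
    (lintegral_inv_truncGreen_le μ hK hlam hs0 hs1 hμ hC hb)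
  filter_upwards [ae_potLaw_mem μ hμ] with v hv
  exact ENNReal.tendsto_ofReal (((tendsto_boxGreen hlam hz hv).inv₀
    (boxGreen_ne_zero hlam hz hv)).norm.rpow_const (Or.inr hs0.le))

variable {Ω : Type*} [MeasurableSpace Ω] {P : Measure Ω} {V : Vertex K → Ω → ℝ}

/-- The `s`-moments of `G` and `1/G`, uniform in the height, serve twice: they exclude the boundary
values `∞` and `0`, and by Fatou they pass to the boundary value, where they dominate `|log|`. -/
theorem lyapunovDefined_of_ae_cayley (hK : 0 < K) {lam s : ℝ} (hlam : 0 ≤ lam) (hs0 : 0 < s)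
    (hs1 : s ≤ 1) {C : ℝ≥0∞} (hCtop : C ≠ ⊤) (hμ : ∀ᵐ r ∂μ, r ∈ Set.Icc (-1 : ℝ) 1)
    (hC : ∀ w : ℂ, ∫⁻ r, ENNReal.ofReal ((‖((lam * r : ℝ) : ℂ) - w‖ ^ s)⁻¹) ∂μ ≤ C)
    (hV : MeasurePreserving (fun ω x => V x ω) P (potLaw K μ)) {E : ℝ}
    (hE : ∀ᵐ v ∂potLaw K μ, ∃ c : ℂ,
      Tendsto (fun η : ℝ => cayley (boxGreen lam (E + η * Complex.I) v)) (𝓝[>] 0) (𝓝 c)) :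
    LyapunovDefined P V lam E := by
  have him : ∀ η : ℝ, 0 < η → 0 < ((E : ℂ) + η * Complex.I).im := fun η hη => by simpa using hη
  set G : ℕ → Ω → ℂ := fun k ω =>
    boxGreen lam (E + height k * Complex.I) (fun x => V x ω) with hG
  have hGm : ∀ k, Measurable (G k) := fun k =>
    (measurable_boxGreen hlam E (height_pos k)).comp hV.measurable
  set C' : ℝ≥0∞ := ENNReal.ofReal ((lam + (|E| + 1)) ^ s) + K * C with hC'
  have hC'top : C' ≠ ⊤ := by finiteness
  have hm1 : ∀ k, ∫⁻ ω, ENNReal.ofReal (‖G k ω‖ ^ s) ∂P ≤ C := by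
    intro k
    have := measurable_boxGreen (K := K) hlam E (height_pos k)
    rw [hV.lintegral_comp (f := fun v => ENNReal.ofReal
      (‖boxGreen lam (E + height k * Complex.I) v‖ ^ s)) (by fun_prop)]
    exact lintegral_boxGreen_le μ hK hlam hs0 hμ hC (him _ (height_pos k))
  have hm2 : ∀ k, ∫⁻ ω, ENNReal.ofReal (‖(G k ω)⁻¹‖ ^ s) ∂P ≤ C' := by
    intro k
    have := measurable_boxGreen (K := K) hlam E (height_pos k)
    rw [hV.lintegral_comp (f := fun v => ENNReal.ofReal
      (‖(boxGreen lam (E + height k * Complex.I) v)⁻¹‖ ^ s)) (by fun_prop)]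
    refine lintegral_inv_boxGreen_le μ hK hlam hs0 hs1 hμ hC (him _ (height_pos k)) ?_
    refine (norm_add_le _ _).trans ?_
    rw [Complex.norm_real, Real.norm_eq_abs, norm_mul, Complex.norm_I, mul_one, Complex.norm_real,
      Real.norm_of_nonneg (height_pos k).le]
    gcongr
    exact height_le_one k
  have hm3 : ∀ k, ∫⁻ ω, ENNReal.ofReal (‖G k ω‖ ^ s + ‖(G k ω)⁻¹‖ ^ s) ∂P ≤ C + C' := by
    intro k
    have := hGm k
    calc _ = ∫⁻ ω, (ENNReal.ofReal (‖G k ω‖ ^ s) + ENNReal.ofReal (‖(G k ω)⁻¹‖ ^ s)) ∂P := by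
          congr 1
          funext ω
          rw [ENNReal.ofReal_add (by positivity) (by positivity)]
      _ ≤ _ := by
          rw [lintegral_add_left (by fun_prop)]
          exact add_le_add (hm1 k) (hm2 k)
  have hbox : ∀ᵐ ω ∂P, ∀ x, V x ω ∈ Set.Icc (-1 : ℝ) 1 :=
    hV.quasiMeasurePreserving.ae (ae_potLaw_mem μ hμ)
  have hcay := hV.quasiMeasurePreserving.ae hE
  have hfreq := frequently_le_of_lintegral_le (P := P)
    (f := fun k ω => ‖G k ω‖ ^ s + ‖(G k ω)⁻¹‖ ^ s)
    (fun k => by have := hGm k; fun_prop) (C := C + C') (by finiteness) hm3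
  have hlim : ∀ᵐ ω ∂P, ∃ g : ℂ, g ≠ 0 ∧
      Tendsto (fun η : ℝ => green lam (fun x => V x ω) [] [] (E + η * Complex.I))
        (𝓝[>] (0 : ℝ)) (𝓝 g) := by
    filter_upwards [hbox, hcay, hfreq] with ω hω ⟨c, hc⟩ ⟨B, hB⟩
    have := exists_limit_of_cayley
      (g := fun η : ℝ => boxGreen lam (E + η * Complex.I) (fun x => V x ω))
      (fun η hη => boxGreen_im_nonneg hlam (him η hη) _)
      (fun η hη => boxGreen_ne_zero hlam (him η hη) hω) hc (B := B ^ s⁻¹)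
      (hB.mono fun k hk => by
        have h1 : 0 ≤ ‖G k ω‖ ^ s := by positivity
        have h2 : 0 ≤ ‖(G k ω)⁻¹‖ ^ s := by positivity
        exact ⟨rpow_le_imp_le (norm_nonneg _) hs0 (by linarith),
          rpow_le_imp_le (norm_nonneg _) hs0 (by linarith)⟩)
    simpa only [boxGreen_eq lam _ hω] using this
  refine ⟨hlim, ?_⟩
  set g : Ω → ℂ := fun ω => greenBoundary lam (fun x => V x ω) [] [] E with hg
  have hgt : ∀ᵐ ω ∂P, g ω ≠ 0 ∧ Tendsto (fun k => G k ω) atTop (𝓝 (g ω)) := by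
    filter_upwards [hbox, hlim] with ω hω ⟨a, ha, hlim⟩
    have h1 : g ω = a := hlim.limUnder_eq
    rw [h1]
    refine ⟨ha, ?_⟩
    simp only [hG, boxGreen_eq lam _ hω]
    exact hlim.comp tendsto_height
  have hgm : AEStronglyMeasurable g P :=
    aestronglyMeasurable_of_tendsto_ae atTop (fun k => (hGm k).aestronglyMeasurable)
      (hgt.mono fun ω h => h.2)
  have hi1 : Integrable (fun ω => ‖g ω‖ ^ s) P := by
    refine ⟨(hgm.norm.aemeasurable.pow_const s).aestronglyMeasurable, ?_⟩
    rw [hasFiniteIntegral_iff_ofReal (Eventually.of_forall fun ω => by positivity)]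
    refine lt_of_le_of_lt (lintegral_le_of_tendsto_ae
      (f := fun k ω => ENNReal.ofReal (‖G k ω‖ ^ s)) (fun k => ?_) ?_ hm1) hCtop.lt_top
    · have := hGm k
      exact Measurable.aemeasurable (by fun_prop)
    · filter_upwards [hgt] with ω h
      exact ENNReal.tendsto_ofReal (h.2.norm.rpow_const (Or.inr hs0.le))
  have hi2 : Integrable (fun ω => ‖(g ω)⁻¹‖ ^ s) P := by
    refine ⟨(hgm.aemeasurable.inv.norm.pow_const s).aestronglyMeasurable, ?_⟩
    rw [hasFiniteIntegral_iff_ofReal (Eventually.of_forall fun ω => by positivity)]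
    refine lt_of_le_of_lt (lintegral_le_of_tendsto_ae
      (f := fun k ω => ENNReal.ofReal (‖(G k ω)⁻¹‖ ^ s)) (fun k => ?_) ?_ hm2) hC'top.lt_top
    · have := hGm k
      exact Measurable.aemeasurable (by fun_prop)
    · filter_upwards [hgt] with ω h
      exact ENNReal.tendsto_ofReal ((h.2.inv₀ h.1).norm.rpow_const (Or.inr hs0.le))
  refine Integrable.mono' ((hi1.add hi2).div_const s)
    (Real.measurable_log.comp_aemeasurable hgm.norm.aemeasurable).aestronglyMeasurable ?_
  filter_upwards [hgt] with ω h
  rw [Real.norm_eq_abs]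
  have := abs_log_le (norm_pos_iff.2 h.1) hs0
  rwa [← norm_inv] at this

end Law

/-! ### The free Green function -/

/-- The smaller root of `x * (c - K * x) = 1`. -/
noncomputable def freeGreen (K : ℕ) (c : ℝ) : ℝ := 2 / (c + √(c ^ 2 - 4 * K))

theorem freeGreen_pos {c : ℝ} (hc : 0 < c) : 0 < freeGreen K c := by
  unfold freeGreen
  positivity

theorem freeGreen_mul {c : ℝ} (hc : 0 < c) (hcK : 4 * (K : ℝ) ≤ c ^ 2) :
    freeGreen K c * (c - K * freeGreen K c) = 1 := by
  unfold freeGreen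
  have h := Real.mul_self_sqrt (sub_nonneg.2 hcK)
  have h0 := Real.sqrt_nonneg (c ^ 2 - 4 * K)
  generalize √(c ^ 2 - 4 * K) = r at h h0
  have : c + r ≠ 0 := by positivity
  have hK' : (K : ℝ) = (c ^ 2 - r * r) / 4 := by linarith
  rw [hK']
  field_simp
  ring

theorem four_mul_le_sq {lam : ℝ} (hlam : 0 ≤ lam) : 4 * (K : ℝ) ≤ (2 * √K + 2 * lam) ^ 2 := by
  have h1 : √(K : ℝ) ^ 2 = K := Real.sq_sqrt (by positivity)
  nlinarith [Real.sqrt_nonneg (K : ℝ), mul_nonneg (Real.sqrt_nonneg (K : ℝ)) hlam]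

theorem freeGreen_le (hK : 0 < K) {lam : ℝ} (hlam : 0 ≤ lam) :
    freeGreen K (2 * √K + 2 * lam) ≤ 1 / (√K + 2 * lam) := by
  have hR : 0 < √(K : ℝ) := Real.sqrt_pos.2 (by exact_mod_cast hK)
  have h1 : √(K : ℝ) ^ 2 = K := Real.sq_sqrt (by positivity)
  have h2 : 2 * lam ≤ √((2 * √(K : ℝ) + 2 * lam) ^ 2 - 4 * K) := by
    apply Real.le_sqrt_of_sq_le
    nlinarith [mul_nonneg hR.le hlam]
  unfold freeGreen
  rw [div_le_div_iff₀ (by positivity) (by positivity)]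
  linarith

/-- The truncated Green functions of the free operator below its spectrum, as a real sequence. -/
noncomputable def freeTrunc (K : ℕ) (c : ℝ) : ℕ → ℝ
  | 0 => 0
  | n + 1 => 1 / (c - K * freeTrunc K c n)

theorem freeTrunc_bounds (hK : 0 < K) {lam : ℝ} (hlam : 0 ≤ lam) (n : ℕ) :
    0 ≤ freeTrunc K (2 * √K + 2 * lam) n ∧ freeTrunc K (2 * √K + 2 * lam) n ≤ 1 / √K := by
  have hR : 0 < √(K : ℝ) := Real.sqrt_pos.2 (by exact_mod_cast hK)
  have h1 : √(K : ℝ) * √K = K := Real.mul_self_sqrt (by positivity)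
  induction n with
  | zero => exact ⟨le_rfl, by simp [freeTrunc]⟩
  | succ n ih =>
    have h2 : K * freeTrunc K (2 * √K + 2 * lam) n ≤ √K := by
      have := (le_div_iff₀ hR).1 ih.2
      nlinarith
    rw [freeTrunc]
    refine ⟨one_div_nonneg.2 (by linarith), one_div_le_one_div_of_le hR (by linarith)⟩

theorem freeTrunc_succ_pos (hK : 0 < K) {lam : ℝ} (hlam : 0 ≤ lam) (n : ℕ) :
    0 < freeTrunc K (2 * √K + 2 * lam) (n + 1) := by
  have hR : 0 < √(K : ℝ) := Real.sqrt_pos.2 (by exact_mod_cast hK)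
  have h1 : √(K : ℝ) * √K = K := Real.mul_self_sqrt (by positivity)
  have h2 : K * freeTrunc K (2 * √K + 2 * lam) n ≤ √K := by
    have := (le_div_iff₀ hR).1 (freeTrunc_bounds hK hlam n).2
    nlinarith
  rw [freeTrunc]
  exact one_div_pos.2 (by linarith)

/-- The truncated free Green functions converge geometrically, up to the height of the energy. -/
theorem norm_truncGreen_sub_freeGreen_le (hK : 0 < K) {lam : ℝ} (hlam : 0 < lam) {η : ℝ}
    (n : ℕ) (v : Vertex K → ℝ) :
    ‖truncGreen 0 ((-2 * √K - 2 * lam : ℝ) + η * Complex.I) n v -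
        freeGreen K (2 * √K + 2 * lam)‖ ≤
      (√K / (√K + 2 * lam)) ^ n + |η| / (2 * lam * √K) := by
  have hR : 0 < √(K : ℝ) := Real.sqrt_pos.2 (by exact_mod_cast hK)
  have hRK : √(K : ℝ) * √K = K := Real.mul_self_sqrt (by positivity)
  have hR1 : 1 ≤ √(K : ℝ) := Real.one_le_sqrt.2 (by exact_mod_cast hK)
  set R := √(K : ℝ) with hRdef
  set γ := freeGreen K (2 * R + 2 * lam) with hγ
  set z : ℂ := (-2 * R - 2 * lam : ℝ) + η * Complex.I with hz
  have hγ0 : 0 < γ := freeGreen_pos (by positivity)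
  have hγle : γ ≤ 1 / (R + 2 * lam) := freeGreen_le hK hlam.le
  have hγeq : γ * (2 * R + 2 * lam - K * γ) = 1 :=
    freeGreen_mul (by positivity) (four_mul_le_sq hlam.le)
  have hre : z.re = -2 * R - 2 * lam := by simp [hz]
  have hS : ∀ j, ∀ v : Vertex K → ℝ, ‖truncGreen 0 z j v‖ ≤ 1 / R ∧
      R + 2 * lam ≤ ‖((0 * v [] : ℝ) : ℂ) - z - ∑ a, truncGreen 0 z j (childPot v a)‖ := by
    have key : ∀ j, (∀ v : Vertex K → ℝ, ‖truncGreen 0 z j v‖ ≤ 1 / R) → ∀ v : Vertex K → ℝ,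
        R + 2 * lam ≤ ‖((0 * v [] : ℝ) : ℂ) - z - ∑ a, truncGreen 0 z j (childPot v a)‖ := by
      intro j hj v
      have h1 : ‖∑ a, truncGreen 0 z j (childPot v a)‖ ≤ R := by
        refine (norm_sum_le _ _).trans ((Finset.sum_le_sum fun a _ => hj _).trans ?_)
        rw [Finset.sum_const, Finset.card_univ, Fintype.card_fin, nsmul_eq_mul, ← hRK]
        exact le_of_eq (by field_simp)
      have h2 := (Complex.re_le_norm _).trans h1
      refine le_trans ?_ (Complex.re_le_norm _)
      rw [Complex.sub_re, Complex.sub_re, hre, Complex.ofReal_re]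
      linarith
    have h3 : ∀ j, ∀ v : Vertex K → ℝ, ‖truncGreen 0 z j v‖ ≤ 1 / R := by
      intro j
      induction j with
      | zero => intro v; simpa [truncGreen_zero] using hR.le
      | succ j ih =>
        intro v
        rw [truncGreen_succ, norm_inv, ← one_div]
        exact one_div_le_one_div_of_le hR (by linarith [key j ih v])
    exact fun j v => ⟨h3 j v, key j (h3 j) v⟩
  induction n generalizing v with
  | zero =>
    have : (γ : ℝ) ≤ 1 := hγle.trans ((div_le_one (by positivity)).2 (by linarith))
    rw [truncGreen_zero, zero_sub, norm_neg, Complex.norm_real, Real.norm_of_nonneg hγ0.le,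
      pow_zero]
    have : 0 ≤ |η| / (2 * lam * R) := by positivity
    linarith
  | succ n ih =>
    set q := (R / (R + 2 * lam)) ^ n + |η| / (2 * lam * R) with hq
    set d := ((0 * v [] : ℝ) : ℂ) - z - ∑ a, truncGreen 0 z n (childPot v a) with hd
    have hdn := (hS n v).2
    rw [← hd] at hdn
    have hd0 : d ≠ 0 := norm_pos_iff.1 (by linarith)
    have hγc : (γ : ℂ) * (2 * R + 2 * lam - K * γ) = 1 := by exact_mod_cast hγeq
    -- The fixed-point equation of `γ` is subtracted from the recursion. As `γ` belongs to the real
    -- energy, the height enters as a source term `iη`.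
    have hid : truncGreen 0 z (n + 1) v - γ = d⁻¹ * γ *
        (∑ a, (truncGreen 0 z n (childPot v a) - γ) + η * Complex.I) := by
      rw [truncGreen_succ, ← hd]
      have : d⁻¹ - (γ : ℂ) = d⁻¹ * γ * ((2 * R + 2 * lam - K * γ) - d) := by
        rw [mul_assoc, mul_sub, hγc]
        field_simp
      rw [this, Finset.sum_sub_distrib]
      congr 1
      simp only [hd, hz, Finset.sum_const, Finset.card_univ, Fintype.card_fin, nsmul_eq_mul]
      push_cast
      ring
    rw [hid, norm_mul, norm_mul, norm_inv, Complex.norm_real, Real.norm_of_nonneg hγ0.le]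
    have h1 : ‖∑ a, (truncGreen 0 z n (childPot v a) - γ) + η * Complex.I‖ ≤ K * q + |η| := by
      refine (norm_add_le _ _).trans (add_le_add ?_ (by simp))
      refine (norm_sum_le _ _).trans ((Finset.sum_le_sum fun a _ => ih _).trans ?_)
      simp
    have h2 : ‖d‖⁻¹ ≤ 1 / (R + 2 * lam) := by
      rw [← one_div]
      exact one_div_le_one_div_of_le (by positivity) hdn
    calc _ ≤ 1 / (R + 2 * lam) * (1 / (R + 2 * lam)) * (K * q + |η|) := by gcongr
      _ = R / (R + 2 * lam) * (R / (R + 2 * lam)) * q + |η| / (R + 2 * lam) ^ 2 := by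
          rw [← hRK]
          field_simp
      -- One of the two contraction factors is dropped. With ratio `R/(R + 2λ)` the source terms
      -- then sum exactly to `|η|/(2λR)`.
      _ ≤ R / (R + 2 * lam) * 1 * q + |η| / (R * (R + 2 * lam)) := by
          have : R / (R + 2 * lam) ≤ 1 := (div_le_one (by positivity)).2 (by linarith)
          gcongr
          rw [sq]
          gcongr
          linarith
      _ = _ := by
          rw [hq, pow_succ]
          field_simp
          ring

section FreeLimit

variable {Ω : Type*} [MeasurableSpace Ω] {P : Measure Ω} {V : Vertex K → Ω → ℝ}

theorem tendsto_green_zero (hK : 0 < K) {lam : ℝ} (hlam : 0 < lam) (v : Vertex K → ℝ) :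
    Tendsto (fun η : ℝ => green 0 v [] [] ((bottomEnergy K lam - lam : ℝ) + η * Complex.I))
      (𝓝[>] (0 : ℝ)) (𝓝 (freeGreen K (2 * √K + 2 * lam) : ℂ)) := by
  have hR : 0 < √(K : ℝ) := Real.sqrt_pos.2 (by exact_mod_cast hK)
  have hE : bottomEnergy K lam - lam = -2 * √K - 2 * lam := by
    unfold bottomEnergy
    ring
  rw [hE, tendsto_iff_norm_sub_tendsto_zero]
  have hlim : Tendsto (fun η : ℝ => |η| / (2 * lam * √K)) (𝓝[>] 0) (𝓝 0) := by
    have : Tendsto (fun η : ℝ => |η| / (2 * lam * √K)) (𝓝 0) (𝓝 (|0| / (2 * lam * √K))) :=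
      Continuous.tendsto (by fun_prop) 0
    simpa using this.mono_left nhdsWithin_le_nhds
  refine squeeze_zero' (Eventually.of_forall fun _ => norm_nonneg _) ?_ hlim
  filter_upwards [self_mem_nhdsWithin] with η hη
  have hz : 0 < ((-2 * √K - 2 * lam : ℝ) + η * Complex.I : ℂ).im := by simpa using hη
  have h1 := tendsto_truncGreen (lam := 0) (v := v) (B := 0) (by simp) hz
  have hp : Tendsto (fun n => (√K / (√K + 2 * lam)) ^ n + |η| / (2 * lam * √K)) atTop
      (𝓝 (0 + |η| / (2 * lam * √K))) :=
    (tendsto_pow_atTop_nhds_zero_of_lt_one (by positivity)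
      ((div_lt_one (by positivity)).2 (by linarith))).add tendsto_const_nhds
  rw [zero_add] at hp
  exact le_of_tendsto_of_tendsto' (h1.sub_const _).norm hp fun n =>
    norm_truncGreen_sub_freeGreen_le hK hlam n v

theorem greenBoundary_zero (hK : 0 < K) {lam : ℝ} (hlam : 0 < lam) (v : Vertex K → ℝ) :
    greenBoundary 0 v [] [] (bottomEnergy K lam - lam) = freeGreen K (2 * √K + 2 * lam) :=
  (tendsto_green_zero hK hlam v).limUnder_eq

theorem lyapunovDefined_zero [IsProbabilityMeasure P] (hK : 0 < K) {lam : ℝ} (hlam : 0 < lam) :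
    LyapunovDefined P V 0 (bottomEnergy K lam - lam) := by
  refine ⟨Eventually.of_forall fun ω => ⟨_, ?_, tendsto_green_zero hK hlam _⟩, ?_⟩
  · exact_mod_cast (freeGreen_pos (K := K) (by positivity : 0 < 2 * √(K : ℝ) + 2 * lam)).ne'
  · simp only [greenBoundary_zero hK hlam]
    exact integrable_const _

theorem lyapunov_zero [IsProbabilityMeasure P] (hK : 0 < K) {lam : ℝ} (hlam : 0 < lam) :
    lyapunov P V 0 (bottomEnergy K lam - lam) = -Real.log (freeGreen K (2 * √K + 2 * lam)) := by
  have h := freeGreen_pos (K := K) (by positivity : 0 < 2 * √(K : ℝ) + 2 * lam)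
  simp [lyapunov, greenBoundary_zero hK hlam, Real.norm_of_nonneg h.le]

end FreeLimit

/-! ### The Lyapunov exponent near the edge of the spectrum -/

theorem truncGreen_zero_eq_freeTrunc (lam : ℝ) (n : ℕ) (v : Vertex K → ℝ) :
    truncGreen 0 ((-2 * √K - 2 * lam : ℝ) + (0 : ℝ) * Complex.I) n v =
      freeTrunc K (2 * √K + 2 * lam) n := by
  induction n generalizing v with
  | zero => simp [truncGreen_zero, freeTrunc]
  | succ n ih =>
    rw [truncGreen_succ, freeTrunc]
    simp only [ih, Finset.sum_const, Finset.card_univ, Fintype.card_fin, nsmul_eq_mul]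
    push_cast
    rw [one_div]
    congr 1
    ring

theorem tendsto_freeTrunc (hK : 0 < K) {lam : ℝ} (hlam : 0 < lam) :
    Tendsto (freeTrunc K (2 * √K + 2 * lam)) atTop (𝓝 (freeGreen K (2 * √K + 2 * lam))) := by
  have hR : 0 < √(K : ℝ) := Real.sqrt_pos.2 (by exact_mod_cast hK)
  rw [tendsto_iff_norm_sub_tendsto_zero]
  refine squeeze_zero (fun _ => norm_nonneg _) (fun n => ?_)
    (tendsto_pow_atTop_nhds_zero_of_lt_one (r := √K / (√K + 2 * lam)) (by positivity)
      ((div_lt_one (by positivity)).2 (by linarith)))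
  have h := norm_truncGreen_sub_freeGreen_le hK hlam (η := 0) n (fun _ => 0)
  rw [truncGreen_zero_eq_freeTrunc, ← Complex.ofReal_sub, Complex.norm_real] at h
  simpa using h

theorem sum_truncGreen_re_le (hK : 0 < K) {lam : ℝ} {z : ℂ} {j : ℕ} {v : Vertex K → ℝ}
    (h : ∀ a, ‖truncGreen lam z j (childPot v a)‖ ≤ 1 / √K) :
    (∑ a, truncGreen lam z j (childPot v a)).re ≤ √K := by
  have hR : 0 < √(K : ℝ) := Real.sqrt_pos.2 (by exact_mod_cast hK)
  have hRK : √(K : ℝ) * √K = K := Real.mul_self_sqrt (by positivity)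
  refine (Complex.re_le_norm _).trans ((norm_sum_le _ _).trans
    ((Finset.sum_le_sum fun a _ => h a).trans ?_))
  rw [Finset.sum_const, Finset.card_univ, Fintype.card_fin, nsmul_eq_mul]
  nth_rewrite 1 [← hRK]
  exact le_of_eq (by field_simp)

section RealEnergy

variable {lam E : ℝ} {M : ℕ}

theorem denom_re_pos (hK : 0 < K) (hlam : 0 ≤ lam) (hE : E < bottomEnergy K lam + √K)
    (hM : ∀ j ≤ M, ∀ v : Vertex K → ℝ, (∀ x, v x ∈ Set.Icc (-1 : ℝ) 1) →
      ‖truncGreen lam E j v‖ ≤ 1 / √K) {j : ℕ} (hj : j ≤ M) {v : Vertex K → ℝ}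
    (hv : ∀ x, v x ∈ Set.Icc (-1 : ℝ) 1) :
    0 < (((lam * v [] : ℝ) : ℂ) - E - ∑ a, truncGreen lam E j (childPot v a)).re := by
  have h1 := sum_truncGreen_re_le hK fun a => hM j hj (childPot v a) fun x => hv _
  have h2 : -lam ≤ lam * v [] := by nlinarith [(hv []).1]
  rw [Complex.sub_re, Complex.sub_re, Complex.ofReal_re, Complex.ofReal_re]
  unfold bottomEnergy at hE
  linarith

/-- At bounded depth no denominator vanishes at the real energy itself, because its real part is
positive; the truncations are therefore continuous up to the axis. -/
theorem tendsto_truncGreen_vertical (hK : 0 < K) (hlam : 0 ≤ lam)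
    (hE : E < bottomEnergy K lam + √K)
    (hM : ∀ j ≤ M, ∀ v : Vertex K → ℝ, (∀ x, v x ∈ Set.Icc (-1 : ℝ) 1) →
      ‖truncGreen lam E j v‖ ≤ 1 / √K) :
    ∀ j ≤ M, ∀ v : Vertex K → ℝ, (∀ x, v x ∈ Set.Icc (-1 : ℝ) 1) →
      Tendsto (fun η : ℝ => truncGreen lam (E + η * Complex.I) j v) (𝓝 0)
        (𝓝 (truncGreen lam E j v)) := by
  intro j
  induction j with
  | zero => intro _ v _; simp [truncGreen_zero]
  | succ j ih =>
    intro hj v hv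
    simp only [truncGreen_succ]
    refine Tendsto.inv₀ (Tendsto.sub ?_ (tendsto_finsetSum _ fun a _ =>
      ih (by omega) _ fun x => hv _)) fun h0 => ?_
    · have : Tendsto (fun η : ℝ => ((lam * v [] : ℝ) : ℂ) - (E + η * Complex.I)) (𝓝 0)
          (𝓝 (((lam * v [] : ℝ) : ℂ) - (E + (0 : ℝ) * Complex.I))) :=
        Continuous.tendsto (by fun_prop) 0
      simpa using this
    · have := denom_re_pos hK hlam hE hM (show j ≤ M by omega) hv
      rw [h0] at this
      simp at this

/-- At real energies above the bottom of the spectrum, the truncated Green functions dominate the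
free ones at the energy shifted by the coupling. -/
theorem freeTrunc_le_truncGreen (hK : 0 < K) (hlam : 0 ≤ lam) (hE0 : bottomEnergy K lam < E)
    (hE : E < bottomEnergy K lam + √K)
    (hM : ∀ j ≤ M, ∀ v : Vertex K → ℝ, (∀ x, v x ∈ Set.Icc (-1 : ℝ) 1) →
      ‖truncGreen lam E j v‖ ≤ 1 / √K) :
    ∀ j ≤ M, ∀ v : Vertex K → ℝ, (∀ x, v x ∈ Set.Icc (-1 : ℝ) 1) →
      ∃ r : ℝ, truncGreen lam E j v = r ∧ freeTrunc K (2 * √K + 2 * lam) j ≤ r := by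
  intro j
  induction j with
  | zero => exact fun _ v _ => ⟨0, by simp [truncGreen_zero], le_rfl⟩
  | succ j ih =>
    intro hj v hv
    choose r hr1 hr2 using fun a => ih (by omega) (childPot v a) fun x => hv _
    have hpos := denom_re_pos hK hlam hE hM (show j ≤ M by omega) hv
    have hd : ((lam * v [] : ℝ) : ℂ) - E - ∑ a, truncGreen lam E j (childPot v a) =
        ((lam * v [] - E - ∑ a, r a : ℝ) : ℂ) := by
      simp only [hr1]
      push_cast
      ring
    rw [hd, Complex.ofReal_re] at hpos
    refine ⟨(lam * v [] - E - ∑ a, r a)⁻¹, ?_, ?_⟩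
    · rw [truncGreen_succ, hd, Complex.ofReal_inv]
    · rw [freeTrunc, ← one_div]
      refine one_div_le_one_div_of_le hpos ?_
      have h1 : K * freeTrunc K (2 * √K + 2 * lam) j ≤ ∑ a, r a := by
        refine le_trans ?_ (Finset.sum_le_sum fun a _ => hr2 a)
        simp
      have h2 : lam * v [] ≤ lam := mul_le_of_le_one_right hlam (hv []).2
      unfold bottomEnergy at hE0
      linarith

end RealEnergy

theorem log_one_add_le {d s : ℝ} (hd : 0 ≤ d) (hs0 : 0 < s) (hs1 : s ≤ 1) :
    Real.log (1 + d) ≤ d ^ s / s := by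
  rw [le_div_iff₀ hs0, mul_comm, ← Real.log_rpow (by positivity)]
  have h1 : (1 + d) ^ s ≤ 1 + d ^ s := by
    simpa using Real.rpow_add_le_add_rpow zero_le_one hd hs0.le hs1
  have h2 : 0 ≤ d ^ s := by positivity
  refine (Real.log_le_log (by positivity) h1).trans ?_
  linarith [Real.log_le_sub_one_of_pos (show 0 < 1 + d ^ s by positivity)]

/-- As `‖w⁻¹‖ ≥ 1`, the additive error on the inverse is at most a factor `1 + d` with `d = ‖g⁻¹ -
w⁻¹‖`, and `log (1 + d) ≤ d^s / s`. The logarithm is thus controlled by a fractional moment. -/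
theorem neg_log_norm_le {g w : ℂ} (hg : g ≠ 0) (hw : w ≠ 0) (hw1 : ‖w‖ ≤ 1) {s : ℝ}
    (hs0 : 0 < s) (hs1 : s ≤ 1) :
    -Real.log ‖g‖ ≤ -Real.log ‖w‖ + ‖g⁻¹ - w⁻¹‖ ^ s / s := by
  have h1 : 1 ≤ ‖w⁻¹‖ := by
    rw [norm_inv]
    exact (one_le_inv₀ (norm_pos_iff.2 hw)).2 hw1
  have h2 : ‖g⁻¹‖ ≤ ‖w⁻¹‖ * (1 + ‖g⁻¹ - w⁻¹‖) := by
    have h3 : ‖g⁻¹‖ ≤ ‖w⁻¹‖ + ‖g⁻¹ - w⁻¹‖ := by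
      simpa using norm_add_le w⁻¹ (g⁻¹ - w⁻¹)
    nlinarith [norm_nonneg (g⁻¹ - w⁻¹)]
  rw [← Real.log_inv, ← Real.log_inv, ← norm_inv, ← norm_inv]
  refine (Real.log_le_log (norm_pos_iff.2 (inv_ne_zero hg)) h2).trans ?_
  rw [Real.log_mul (by linarith) (by positivity)]
  linarith [log_one_add_le (norm_nonneg (g⁻¹ - w⁻¹)) hs0 hs1]

section Law

variable (μ : Measure ℝ) [IsProbabilityMeasure μ]
variable {Ω : Type*} [MeasurableSpace Ω] {P : Measure Ω} {V : Vertex K → Ω → ℝ}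

theorem lintegral_inv_boxGreen_sub_le {lam s H : ℝ} (hlam : 0 ≤ lam) (hs0 : 0 < s) (hs1 : s ≤ 1)
    (hμ : ∀ᵐ r ∂μ, r ∈ Set.Icc (-1 : ℝ) 1) {z : ℂ} (hz : 0 < z.im) {m : ℕ}
    (hH : ∀ n ≥ m, truncDist K lam μ s z n m ≤ ENNReal.ofReal H) :
    ∫⁻ v : Vertex K → ℝ, ENNReal.ofReal (‖(boxGreen lam z v)⁻¹ -
      (truncGreen lam z (m + 1) v)⁻¹‖ ^ s) ∂potLaw K μ ≤ K * ENNReal.ofReal H := by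
  refine lintegral_le_of_tendsto_ae (f := fun n v => ENNReal.ofReal
    (‖(truncGreen lam z (n + m + 1) v)⁻¹ - (truncGreen lam z (m + 1) v)⁻¹‖ ^ s))
    (fun n => Measurable.aemeasurable (by fun_prop)) ?_ fun n =>
    (lintegral_inv_sub_le μ hs0 hs1 z (n + m) m).trans (by gcongr; exact hH _ (by omega))
  filter_upwards [ae_potLaw_mem μ hμ] with v hv
  have h := (tendsto_add_atTop_iff_nat (m + 1)).2 (tendsto_boxGreen hlam hz hv)
  exact ENNReal.tendsto_ofReal (((h.inv₀ (boxGreen_ne_zero hlam hz hv)).sub_const _).norm.rpow_const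
    (Or.inr hs0.le))

/-- The boundary value `g` is compared with the depth `m + 1` truncation `w` at the real energy. The
moment of `g⁻¹ - w⁻¹` is obtained at positive height and passed to the axis by Fatou, while `|w|` is
bounded below by the free truncation. -/
theorem lyapunov_le [IsProbabilityMeasure P] (hK : 0 < K) {lam s H E : ℝ} (hlam : 0 ≤ lam)
    (hs0 : 0 < s) (hs1 : s ≤ 1) (hH0 : 0 ≤ H) (hμ : ∀ᵐ r ∂μ, r ∈ Set.Icc (-1 : ℝ) 1)
    (hV : MeasurePreserving (fun ω x => V x ω) P (potLaw K μ)) {m : ℕ}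
    (hE0 : bottomEnergy K lam < E) (hE : E < bottomEnergy K lam + √K)
    (hM : ∀ j ≤ m + 1, ∀ v : Vertex K → ℝ, (∀ x, v x ∈ Set.Icc (-1 : ℝ) 1) →
      ‖truncGreen lam E j v‖ ≤ 1 / √K)
    (hH : ∀ η : ℝ, 0 < η → ∀ n ≥ m,
      truncDist K lam μ s (E + η * Complex.I) n m ≤ ENNReal.ofReal H)
    (hdef : LyapunovDefined P V lam E) :
    lyapunov P V lam E ≤
      -Real.log (freeTrunc K (2 * √K + 2 * lam) (m + 1)) + K * H / s := by
  set g : Ω → ℂ := fun ω => greenBoundary lam (fun x => V x ω) [] [] E with hg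
  set w : Ω → ℂ := fun ω => truncGreen lam E (m + 1) (fun x => V x ω) with hw
  set l := freeTrunc K (2 * √K + 2 * lam) (m + 1) with hl
  have hl0 : 0 < l := freeTrunc_succ_pos hK hlam m
  have hR1 : 1 ≤ √(K : ℝ) := Real.one_le_sqrt.2 (by exact_mod_cast hK)
  have hbox : ∀ᵐ ω ∂P, ∀ x, V x ω ∈ Set.Icc (-1 : ℝ) 1 :=
    hV.quasiMeasurePreserving.ae (ae_potLaw_mem μ hμ)
  have hw0 : ∀ᵐ ω ∂P, w ω ≠ 0 ∧ ‖w ω‖ ≤ 1 ∧ l ≤ ‖w ω‖ := by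
    filter_upwards [hbox] with ω hω
    obtain ⟨r, hr, hlr⟩ := freeTrunc_le_truncGreen hK hlam hE0 hE hM (m + 1) le_rfl _ hω
    have h1 : l ≤ ‖w ω‖ := by
      simp only [hw, hr, Complex.norm_real]
      exact hlr.trans (Real.le_norm_self r)
    refine ⟨norm_pos_iff.1 (by linarith), ?_, h1⟩
    exact (hM (m + 1) le_rfl _ hω).trans ((div_le_one (by linarith)).2 hR1)
  set G : ℕ → Ω → ℂ := fun k ω =>
    boxGreen lam (E + height k * Complex.I) (fun x => V x ω) with hG
  set W : ℕ → Ω → ℂ := fun k ω =>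
    truncGreen lam (E + height k * Complex.I) (m + 1) (fun x => V x ω) with hW
  have hGm : ∀ k, Measurable (G k) := fun k =>
    (measurable_boxGreen hlam E (height_pos k)).comp hV.measurable
  have hWm : ∀ k, Measurable (W k) := fun k => by
    have h := (measurable_truncGreen (K := K) lam (E + height k * Complex.I) (m + 1)).comp
      hV.measurable
    simpa only [Function.comp_def] using h
  have hwm : Measurable w := by
    have h := (measurable_truncGreen (K := K) lam E (m + 1)).comp hV.measurable
    simpa only [Function.comp_def] using h
  have hgt : ∀ᵐ ω ∂P, g ω ≠ 0 ∧ Tendsto (fun k => G k ω) atTop (𝓝 (g ω)) := by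
    filter_upwards [hbox, hdef.1] with ω hω ⟨a, ha, hlim⟩
    have h1 : g ω = a := hlim.limUnder_eq
    rw [h1]
    refine ⟨ha, ?_⟩
    simp only [hG, boxGreen_eq lam _ hω]
    exact hlim.comp tendsto_height
  have hwt : ∀ᵐ ω ∂P, Tendsto (fun k => W k ω) atTop (𝓝 (w ω)) := by
    filter_upwards [hbox] with ω hω
    exact (tendsto_truncGreen_vertical hK hlam hE hM (m + 1) le_rfl _ hω).comp
      (tendsto_height.mono_right nhdsWithin_le_nhds)
  have hgm : AEStronglyMeasurable g P :=
    aestronglyMeasurable_of_tendsto_ae atTop (fun k => (hGm k).aestronglyMeasurable)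
      (hgt.mono fun ω h => h.2)
  have hk : ∀ k, ∫⁻ ω, ENNReal.ofReal (‖(G k ω)⁻¹ - (W k ω)⁻¹‖ ^ s) ∂P ≤
      K * ENNReal.ofReal H := by
    intro k
    have := measurable_boxGreen (K := K) hlam E (height_pos k)
    rw [hV.lintegral_comp (f := fun v => ENNReal.ofReal
      (‖(boxGreen lam (E + height k * Complex.I) v)⁻¹ -
        (truncGreen lam (E + height k * Complex.I) (m + 1) v)⁻¹‖ ^ s)) (by fun_prop)]
    exact lintegral_inv_boxGreen_sub_le μ hlam hs0 hs1 hμ (by simpa using height_pos k)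
      (hH _ (height_pos k))
  have hlim : ∫⁻ ω, ENNReal.ofReal (‖(g ω)⁻¹ - (w ω)⁻¹‖ ^ s) ∂P ≤ K * ENNReal.ofReal H := by
    refine lintegral_le_of_tendsto_ae (f := fun k ω => ENNReal.ofReal
      (‖(G k ω)⁻¹ - (W k ω)⁻¹‖ ^ s)) (fun k => ?_) ?_ hk
    · have := hGm k
      have := hWm k
      exact Measurable.aemeasurable (by fun_prop)
    · filter_upwards [hgt, hwt, hw0] with ω h1 h2 h3
      exact ENNReal.tendsto_ofReal
        (((h1.2.inv₀ h1.1).sub (h2.inv₀ h3.1)).norm.rpow_const (Or.inr hs0.le))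
  have hfin : (K : ℝ≥0∞) * ENNReal.ofReal H ≠ ⊤ := by finiteness
  have hfm : AEStronglyMeasurable (fun ω => ‖(g ω)⁻¹ - (w ω)⁻¹‖ ^ s) P :=
    ((hgm.aemeasurable.inv.sub hwm.aemeasurable.inv).norm.pow_const s).aestronglyMeasurable
  have hnn : 0 ≤ᵐ[P] fun ω => ‖(g ω)⁻¹ - (w ω)⁻¹‖ ^ s :=
    Eventually.of_forall fun ω => by positivity
  have hi : Integrable (fun ω => ‖(g ω)⁻¹ - (w ω)⁻¹‖ ^ s) P :=
    ⟨hfm, (hasFiniteIntegral_iff_ofReal hnn).2 (hlim.trans_lt hfin.lt_top)⟩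
  have hint : ∫ ω, ‖(g ω)⁻¹ - (w ω)⁻¹‖ ^ s ∂P ≤ K * H := by
    rw [integral_eq_lintegral_of_nonneg_ae hnn hfm]
    refine (ENNReal.toReal_mono hfin hlim).trans ?_
    rw [ENNReal.toReal_mul, ENNReal.toReal_ofReal hH0, ENNReal.toReal_natCast]
  calc lyapunov P V lam E = ∫ ω, -Real.log ‖g ω‖ ∂P := (integral_neg _).symm
    _ ≤ ∫ ω, (-Real.log l + ‖(g ω)⁻¹ - (w ω)⁻¹‖ ^ s / s) ∂P := by
        refine integral_mono_ae hdef.2.neg ((integrable_const _).add (hi.div_const s)) ?_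
        filter_upwards [hgt, hw0] with ω h1 h2
        have h3 := neg_log_norm_le h1.1 h2.1 h2.2.1 hs0 hs1
        have h4 := Real.log_le_log hl0 h2.2.2
        linarith
    _ = -Real.log l + (∫ ω, ‖(g ω)⁻¹ - (w ω)⁻¹‖ ^ s ∂P) / s := by
        rw [integral_add (integrable_const _) (hi.div_const s), integral_div]
        simp
    _ ≤ _ := by gcongr

theorem limsup_lyapunov_le [IsProbabilityMeasure P] (hK : 1 < K) {lam : ℝ} (hlam : 0 < lam)
    (hμ : ∀ᵐ r ∂μ, r ∈ Set.Icc (-1 : ℝ) 1) {D : ℝ≥0∞} (hD : D ≠ ⊤) (hμD : μ ≤ D • volume)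
    (hV : MeasurePreserving (fun ω x => V x ω) P (potLaw K μ)) :
    limsup (fun E : ℝ => ((lyapunov P V lam E : ℝ) : EReal))
        (𝓝[{E : ℝ | bottomEnergy K lam < E ∧ LyapunovDefined P V lam E}] (bottomEnergy K lam)) ≤
      ((lyapunov P V 0 (bottomEnergy K lam - lam) : ℝ) : EReal) := by
  have hK0 : 0 < K := by omega
  have hR : 0 < √(K : ℝ) := Real.sqrt_pos.2 (by exact_mod_cast hK0)
  rw [lyapunov_zero hK0 hlam]
  set γ := freeGreen K (2 * √K + 2 * lam) with hγ
  have hγ0 : 0 < γ := freeGreen_pos (by positivity)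
  obtain ⟨s, hs0, hs1, hs⟩ := exists_truncDist_le hK μ hμ hD hμD hlam
  rw [← EReal.le_of_forall_lt_iff_le]
  intro b hb
  have hb' : -Real.log γ < b := by exact_mod_cast hb
  have hlim : Tendsto (fun n => -Real.log (freeTrunc K (2 * √K + 2 * lam) n)) atTop
      (𝓝 (-Real.log γ)) := ((tendsto_freeTrunc hK0 hlam).log hγ0.ne').neg
  obtain ⟨b', hb1, hb2⟩ := exists_between hb'
  obtain ⟨m₀, hm₀⟩ := eventually_atTop.1 (hlim.eventually (eventually_lt_nhds hb1))
  -- With this tolerance the error `K * H / s` equals `b - b'`, exactly the gap left once the free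
  -- truncation is within `b'`.
  obtain ⟨m, hm, ε, hε, hM, hH⟩ := hs ((b - b') * s / K)
    (div_pos (mul_pos (by linarith) hs0) (by exact_mod_cast hK0)) m₀
  have hδ : 0 < min ε √K := lt_min hε hR
  refine limsup_le_of_le (by isBoundedDefault) ?_
  have hnear : ∀ᶠ E in 𝓝 (bottomEnergy K lam), E < bottomEnergy K lam + min ε √K :=
    eventually_lt_nhds (by linarith)
  filter_upwards [self_mem_nhdsWithin, mem_nhdsWithin_of_mem_nhds hnear] with E ⟨hE0, hdef⟩ hE
  have hE1 : E < bottomEnergy K lam + ε := lt_of_lt_of_le hE (by gcongr; exact min_le_left _ _)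
  have hE2 : E < bottomEnergy K lam + √K := lt_of_lt_of_le hE (by gcongr; exact min_le_right _ _)
  have h := lyapunov_le μ hK0 hlam.le hs0 hs1.le
    (H := (b - b') * s / K) (by have : 0 < b - b' := by linarith
                                positivity) hμ hV hE0 hE2
    (hM E (by simpa [bottomEnergy] using hE1.le))
    (fun η hη => hH _ (by simpa using hη) (by simpa [bottomEnergy] using hE1.le)) hdef
  have h1 := hm₀ (m + 1) (by omega)
  have h2 : K * ((b - b') * s / K) / s = b - b' := by
    have : (K : ℝ) ≠ 0 := by exact_mod_cast hK0.ne'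
    field_simp
  rw [h2] at h
  exact_mod_cast (by linarith : lyapunov P V lam E ≤ b)

end Law

/-! ### From the density to the law of the potential -/

theorem exists_densityMeasure_le {ϱ : ℝ → ℝ} (hϱ : MemLp ϱ ∞ volume) :
    ∃ D : ℝ≥0∞, D ≠ ⊤ ∧ densityMeasure ϱ ≤ D • volume := by
  refine ⟨eLpNormEssSup ϱ volume, ?_, ?_⟩
  · have := hϱ.2
    rw [eLpNorm_exponent_top] at this
    exact this.ne
  · rw [densityMeasure, ← withDensity_const]
    refine withDensity_mono ?_
    filter_upwards [enorm_ae_le_eLpNormEssSup ϱ volume] with v hv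
    exact (Real.ofReal_le_enorm _).trans hv

theorem IsAdmissiblePotential.measurePreserving {Ω : Type*} [MeasurableSpace Ω] {P : Measure Ω}
    [IsProbabilityMeasure P] {V : Vertex K → Ω → ℝ} {ϱ : ℝ → ℝ}
    (hV : IsAdmissiblePotential P V ϱ) :
    MeasurePreserving (fun ω x => V x ω) P (potLaw K (densityMeasure ϱ)) := by
  refine ⟨measurable_pi_iff.2 hV.measurable, ?_⟩
  rw [hV.indep.map_fun_eq_infinitePi_map hV.measurable, potLaw]
  simp only [hV.law]

end TreeAnderson

theorem theorem6p2 {Ω : Type*} [MeasurableSpace Ω] (P : MeasureTheory.Measure Ω)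
    [MeasureTheory.IsProbabilityMeasure P]
    (K : ℕ) (hK : 1 < K)
    (V : TreeAnderson.Vertex K → Ω → ℝ) (ϱ : ℝ → ℝ)
    (hV : TreeAnderson.IsAdmissiblePotential P V ϱ)
    (hsupp : (TreeAnderson.densityMeasure ϱ).support = Set.Icc (-1) 1)
    (lam : ℝ) (hlam : 0 < lam) :
    (∀ᵐ E : ℝ, TreeAnderson.LyapunovDefined P V lam E) ∧
    TreeAnderson.LyapunovDefined P V 0 (TreeAnderson.bottomEnergy K lam - lam) ∧
    Filter.limsup (fun E : ℝ => ((TreeAnderson.lyapunov P V lam E : ℝ) : EReal))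
        (𝓝[{E : ℝ | TreeAnderson.bottomEnergy K lam < E ∧
            TreeAnderson.LyapunovDefined P V lam E}] (TreeAnderson.bottomEnergy K lam)) ≤
      ((TreeAnderson.lyapunov P V 0 (TreeAnderson.bottomEnergy K lam - lam) : ℝ) : EReal) := by
  have hK0 : 0 < K := by omega
  have : MeasureTheory.IsProbabilityMeasure (TreeAnderson.densityMeasure ϱ) := by
    rw [← hV.law []]
    exact MeasureTheory.Measure.isProbabilityMeasure_map (hV.measurable []).aemeasurable
  have hμ : ∀ᵐ r ∂TreeAnderson.densityMeasure ϱ, r ∈ Set.Icc (-1 : ℝ) 1 := by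
    rw [← hsupp]
    exact MeasureTheory.Measure.support_mem_ae
  obtain ⟨D, hD, hμD⟩ := TreeAnderson.exists_densityMeasure_le hV.density_bounded
  refine ⟨?_, TreeAnderson.lyapunovDefined_zero hK0 hlam,
    TreeAnderson.limsup_lyapunov_le _ hK hlam hμ hD hμD hV.measurePreserving⟩
  -- Any exponent in `(0, 1)` would serve here; only the edge estimate needs `s` near `1`.
  obtain ⟨C, hCtop, hC⟩ := TreeAnderson.exists_negMoment_bound _ hD hμD hlam
    (s := 1 / 2) (by norm_num) (by norm_num)
  filter_upwards [TreeAnderson.ae_ae_exists_cayley_limit hlam.le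
    (TreeAnderson.potLaw K (TreeAnderson.densityMeasure ϱ))] with E hE
  exact TreeAnderson.lyapunovDefined_of_ae_cayley _ hK0 hlam.le (by norm_num) (by norm_num) hCtop
    hμ hC hV.measurePreserving hE
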